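/- **Conventions.** All objects are smooth. A distribution on a smooth manifold $M$ is a constant rank subbundle of $TM$; an invariant of a distribution $D$ is a smooth function whose differential vanishes on $D$; invariants are functionally independent at a point if their differentials are linearly independent there. The completion $D^{(\infty)}$ of $D$ consists, at each point, of the values of the vector fields obtained from local vector fields contained in $D$ by repeated Lie brackets and linear combinations. A vector field $X$ is a symmetry of $D$ if $[X,Y]$ is contained in $D$ for every vector field $Y$ contained in $D$. Let $(M,\mathcal F,\mathcal G)$ be a *decomposable system*: $\mathcal F$ and $\mathcal G$ are distributions of ranks $k$ and $l$ on the manifold $M$, $\mathcal F\cap\mathcal G=0$, and $[X,Y]$ is contained in $\mathcal V=\mathcal F\oplus\mathcal G$ for all local vector fields $X$ contained in $\mathcal F$ and $Y$ contained in $\mathcal G$. Assume that the system has no invariants, that is, $\mathcal V^{(\infty)}=TM$, and that it is *Darboux integrable*: near every point, $\mathcal F$ has $l$ functionally independent invariants $I^1,\dots,I^l$ and $\mathcal G$ has $k$ functionally independent invariants $J^1,\dots,J^k$, such that at every point no non-zero linear combination of $dI^1,\dots,dI^l,dJ^1,\dots,dJ^k$ vanishes on $\mathcal V$. Assume moreover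 that near every point the maximal number of functionally independent local invariants is exactly $l$ for $\mathcal F$ and exactly $k$ for $\mathcal G$. Let $\pi=(\pi_1,\pi_2):M\to B_1\times B_2$ be a *Darboux projection*: $B_1$ and $B_2$ are manifolds and $\pi_1$, $\pi_2$ are surjective submersions with $\ker T\pi_1=\mathcal G^{(\infty)}$ and $\ker T\pi_2=\mathcal F^{(\infty)}$. For an open set $U\subseteq M$ and $b\in\pi(U)$ put $U_b=U\cap\pi^{-1}(b)$. If $\tilde F_1,\dots,\tilde F_k$ is a frame of pairwise commuting vector fields on an open set of $B_1$ containing $\pi_1(U)$, let $F_i$ be the vector field on $U$ that is contained in $\mathcal V$ and satisfies $T\pi_1 F_i=\tilde F_i\circ \pi_1$, $T\pi_2F_i=0$; let $\mathfrak f$ be the real Lie algebra generated by $F_1,\dots,F_k$, let $\mathfrak f'=[\mathfrak f,\mathfrak f]$, which consists of vector fields tangent to the fibres of $\pi$, and let $\mathfrak f'_b$ be the Lie algebra of the restrictions of the elements of $\mathfrak f'$ to $U_b$. Define $\mathfrak g'$ and $\mathfrak g'_b$ in the same way from a commuting frame $\tilde G_1,\dots,\tilde G_l$ defined on an open set of $B_2$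 containing $\pi_2(U)$. **Theorem (Main theorem).** Every point of $M$ has an open neighbourhood $U$ such that $\pi_1(U)$ and $\pi_2(U)$ are contained in the domains of commuting frames as above, and such that there exist finite-dimensional Lie algebras $L$ and $R$ of vector fields on $U$ with the following properties. 1. The elements of $L$ and $R$ are tangent to the fibres of $\pi$; the elements of $L$ are symmetries of $\mathcal G|_U$ and the elements of $R$ are symmetries of $\mathcal F|_U$. 2. $[X,Y]=0$ for all $X\in L$ and $Y\in R$. 3. For every choice of commuting frames $(\tilde F_i)$, $(\tilde G_j)$ as above and every $b\in\pi(U)$, restriction to $U_b$ is a Lie algebra isomorphism from $L$ onto $\mathfrak f'_b$ and from $R$ onto $\mathfrak g'_b$. -/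

import Mathlib

open Set TopologicalSpace VectorField
open scoped Manifold ContDiff

noncomputable section

namespace DarbouxSystem

theorem nat_le_infty (n : ℕ) : (n : WithTop ℕ∞) ≤ ∞ := by
  have h : ((n : ℕ∞) : WithTop ℕ∞) ≤ ((⊤ : ℕ∞) : WithTop ℕ∞) := WithTop.coe_le_coe.2 le_top
  simpa using h

section VecField

variable (E : Type*) [NormedAddCommGroup E] [NormedSpace ℝ E]
  {M : Type*} [TopologicalSpace M] [ChartedSpace E M] [IsManifold 𝓘(ℝ, E) ∞ M]

/-- The space `𝔛(U)` of smooth vector fields on an open subset `U` of a smooth manifold `M`.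
A vector field on `U` is represented by its extension by zero to all of `M`, so that two elements
are equal if and only if they agree at every point of `U`. -/
def VecField (U : Opens M) : Submodule ℝ ((x : M) → TangentSpace 𝓘(ℝ, E) x) where
  carrier := {X | ContMDiffOn 𝓘(ℝ, E) 𝓘(ℝ, E).tangent ∞
      (fun x => (⟨x, X x⟩ : TangentBundle 𝓘(ℝ, E) M)) (U : Set M) ∧ ∀ x ∉ U, X x = 0}
  add_mem' := by
    rintro X Y ⟨hX, hX'⟩ ⟨hY, hY'⟩
    exact ⟨ContMDiffOn.add_section hX hY, fun x hx => by simp [hX' x hx, hY' x hx]⟩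
  zero_mem' :=
    ⟨(Bundle.contMDiff_zeroSection ℝ (TangentSpace 𝓘(ℝ, E) (M := M))).contMDiffOn,
      fun x _ => rfl⟩
  smul_mem' := by
    rintro c X ⟨hX, hX'⟩
    exact ⟨ContMDiffOn.const_smul_section hX, fun x hx => by simp [hX' x hx]⟩

variable {E}

theorem VecField.contMDiffAt {U : Opens M} (X : VecField E U) {x : M} (hx : x ∈ U) :
    ContMDiffAt 𝓘(ℝ, E) 𝓘(ℝ, E).tangent ∞
      (fun y => (⟨y, X.1 y⟩ : TangentBundle 𝓘(ℝ, E) M)) x :=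
  (X.2.1 x hx).contMDiffAt (U.isOpen.mem_nhds hx)

theorem VecField.mdiffAt {U : Opens M} (X : VecField E U) {x : M} (hx : x ∈ U) :
    MDifferentiableAt 𝓘(ℝ, E) 𝓘(ℝ, E).tangent
      (fun y => (⟨y, X.1 y⟩ : TangentBundle 𝓘(ℝ, E) M)) x :=
  (VecField.contMDiffAt X hx).mdifferentiableAt (by simp)

theorem VecField.ext {U : Opens M} {X Y : VecField E U} (h : ∀ x ∈ U, X.1 x = Y.1 x) : X = Y := by
  apply Subtype.ext
  funext x
  by_cases hx : x ∈ U
  · exact h x hx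
  · rw [X.2.2 x hx, Y.2.2 x hx]

variable [FiniteDimensional ℝ E]

set_option linter.unusedSectionVars false

/-- The Lie bracket of two smooth vector fields on `U`. -/
instance VecField.instBracket (U : Opens M) : Bracket (VecField E U) (VecField E U) where
  bracket X Y := ⟨fun x => by
      classical exact if x ∈ U then mlieBracket 𝓘(ℝ, E) X.1 Y.1 x else 0, by
    have : CompleteSpace E := FiniteDimensional.complete ℝ E
    have : IsManifold 𝓘(ℝ, E) (((⊤ : ℕ∞) : WithTop ℕ∞) + 1) M := by
      simpa using (inferInstance : IsManifold 𝓘(ℝ, E) ∞ M)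
    have : IsManifold 𝓘(ℝ, E) (minSmoothness ℝ 2) M := IsManifold.of_le (n := ∞)
      (by rw [minSmoothness_of_isRCLikeNormedField]; exact nat_le_infty 2)
    refine ⟨fun x hx => ?_, fun x hx => if_neg hx⟩
    refine ContMDiffAt.contMDiffWithinAt ?_
    have h := ContMDiffAt.mlieBracket_vectorField (𝕜 := ℝ) (m := ⊤) (n := ⊤)
      (VecField.contMDiffAt X hx) (VecField.contMDiffAt Y hx)
      (by simp)
    refine h.congr_of_eventuallyEq ?_
    filter_upwards [U.isOpen.mem_nhds hx] with y hy
    have hy' : y ∈ U := hy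
    simp [hy']⟩

theorem VecField.bracket_apply {U : Opens M} (X Y : VecField E U) {x : M} (hx : x ∈ U) :
    (⁅X, Y⁆ : VecField E U).1 x = mlieBracket 𝓘(ℝ, E) X.1 Y.1 x := if_pos hx

theorem VecField.bracket_eventuallyEq {U : Opens M} (X Y : VecField E U) {x : M} (hx : x ∈ U) :
    (⁅X, Y⁆ : VecField E U).1 =ᶠ[nhds x] mlieBracket 𝓘(ℝ, E) X.1 Y.1 := by
  filter_upwards [U.isOpen.mem_nhds hx] with y hy
  exact VecField.bracket_apply X Y hy

instance VecField.instLieRing (U : Opens M) : LieRing (VecField E U) where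
  add_lie X Y Z := by
    have : CompleteSpace E := FiniteDimensional.complete ℝ E
    have : IsManifold 𝓘(ℝ, E) 2 M := IsManifold.of_le (n := ∞) (nat_le_infty 2)
    refine VecField.ext fun x hx => ?_
    have h := mlieBracket_add_left (W := Z.1) (VecField.mdiffAt X hx) (VecField.mdiffAt Y hx)
    simpa [VecField.bracket_apply _ _ hx] using h
  lie_add X Y Z := by
    have : CompleteSpace E := FiniteDimensional.complete ℝ E
    have : IsManifold 𝓘(ℝ, E) 2 M := IsManifold.of_le (n := ∞) (nat_le_infty 2)
    refine VecField.ext fun x hx => ?_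
    have h := mlieBracket_add_right (V := X.1) (VecField.mdiffAt Y hx) (VecField.mdiffAt Z hx)
    simpa [VecField.bracket_apply _ _ hx] using h
  lie_self X := by
    refine VecField.ext fun x hx => ?_
    simp [VecField.bracket_apply _ _ hx]
  leibniz_lie X Y Z := by
    have : CompleteSpace E := FiniteDimensional.complete ℝ E
    have : IsManifold 𝓘(ℝ, E) (minSmoothness ℝ 3) M :=
      IsManifold.of_le (n := ∞)
        (by rw [minSmoothness_of_isRCLikeNormedField]; exact nat_le_infty 3)
    have h2 : minSmoothness ℝ 2 ≤ (∞ : WithTop ℕ∞) := by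
      rw [minSmoothness_of_isRCLikeNormedField]; exact nat_le_infty 2
    refine VecField.ext fun x hx => ?_
    have h := leibniz_identity_mlieBracket_apply ((VecField.contMDiffAt X hx).of_le h2)
      ((VecField.contMDiffAt Y hx).of_le h2) ((VecField.contMDiffAt Z hx).of_le h2)
    change _ = (⁅⁅X, Y⁆, Z⁆ : VecField E U).1 x + (⁅Y, ⁅X, Z⁆⁆ : VecField E U).1 x
    have h₁ : mlieBracket 𝓘(ℝ, E) X.1 (⁅Y, Z⁆ : VecField E U).1 x =
        mlieBracket 𝓘(ℝ, E) X.1 (mlieBracket 𝓘(ℝ, E) Y.1 Z.1) x :=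
      Filter.EventuallyEq.mlieBracket_vectorField_eq (Filter.EventuallyEq.refl _ _)
        (VecField.bracket_eventuallyEq Y Z hx)
    have h₂ : mlieBracket 𝓘(ℝ, E) (⁅X, Y⁆ : VecField E U).1 Z.1 x =
        mlieBracket 𝓘(ℝ, E) (mlieBracket 𝓘(ℝ, E) X.1 Y.1) Z.1 x :=
      Filter.EventuallyEq.mlieBracket_vectorField_eq
        (VecField.bracket_eventuallyEq X Y hx) (Filter.EventuallyEq.refl _ _)
    have h₃ : mlieBracket 𝓘(ℝ, E) Y.1 (⁅X, Z⁆ : VecField E U).1 x =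
        mlieBracket 𝓘(ℝ, E) Y.1 (mlieBracket 𝓘(ℝ, E) X.1 Z.1) x :=
      Filter.EventuallyEq.mlieBracket_vectorField_eq (Filter.EventuallyEq.refl _ _)
        (VecField.bracket_eventuallyEq X Z hx)
    rw [VecField.bracket_apply _ _ hx, VecField.bracket_apply _ _ hx, VecField.bracket_apply _ _ hx,
      h₁, h₂, h₃, h]

instance VecField.instLieAlgebra (U : Opens M) : LieAlgebra ℝ (VecField E U) where
  lie_smul c X Y := by
    have : CompleteSpace E := FiniteDimensional.complete ℝ E
    have : IsManifold 𝓘(ℝ, E) 2 M := IsManifold.of_le (n := ∞) (nat_le_infty 2)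
    refine VecField.ext fun x hx => ?_
    have h := mlieBracket_const_smul_right (c := c) (V := X.1) (VecField.mdiffAt Y hx)
    simpa [VecField.bracket_apply _ _ hx] using h

end VecField

section Distributions

variable {E : Type*} [NormedAddCommGroup E] [NormedSpace ℝ E]
  {M : Type*} [TopologicalSpace M] [ChartedSpace E M] [IsManifold 𝓘(ℝ, E) ∞ M]

/-- `D` is a smooth distribution of constant rank `k`: a rank `k` subbundle of `TM`. -/
def IsDistribution (D : (x : M) → Submodule ℝ (TangentSpace 𝓘(ℝ, E) x)) (k : ℕ) : Prop :=
  ∀ m : M, ∃ U : Opens M, m ∈ U ∧ ∃ X : Fin k → VecField E U, ∀ x ∈ U,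
    LinearIndependent ℝ (fun i => (X i).1 x) ∧ Submodule.span ℝ (range fun i => (X i).1 x) = D x

/-- The vector fields on `U` that are contained in `D` pointwise. -/
def sections (D : (x : M) → Submodule ℝ (TangentSpace 𝓘(ℝ, E) x)) (U : Opens M) :
    Set (VecField E U) :=
  {X | ∀ x ∈ U, X.1 x ∈ D x}

/-- The completion of `D`: at `m` it consists of the values at `m` of the vector fields obtained
from local vector fields contained in `D` by repeated Lie brackets and linear combinations. -/
def completion [FiniteDimensional ℝ E] (D : (x : M) → Submodule ℝ (TangentSpace 𝓘(ℝ, E) x))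
    (m : M) : Submodule ℝ (TangentSpace 𝓘(ℝ, E) m) :=
  Submodule.span ℝ {v | ∃ U : Opens M, m ∈ U ∧
    ∃ X ∈ LieSubalgebra.lieSpan ℝ (VecField E U) (sections D U), X.1 m = v}

/-- `J` is a family of smooth functions on the open set `U` that are invariants (first integrals)
of `D` and that are functionally independent at each point of `U`. -/
structure IndependentInvariants (D : (x : M) → Submodule ℝ (TangentSpace 𝓘(ℝ, E) x))
    (U : Opens M) {q : ℕ} (J : Fin q → M → ℝ) : Prop where
  smooth : ∀ i, ContMDiffOn 𝓘(ℝ, E) 𝓘(ℝ, ℝ) ∞ (J i) (U : Set M)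
  invariant : ∀ i, ∀ x ∈ U, ∀ v ∈ D x, mvfderiv 𝓘(ℝ, E) (J i) x v = 0
  independent : ∀ x ∈ U, LinearIndependent ℝ (fun i => mvfderiv 𝓘(ℝ, E) (J i) x)

/-- The number of invariants of `D` is `p`: near every point of `M` there are `p` functionally
independent invariants of `D`, but not more. -/
def HasNumInvariants (D : (x : M) → Submodule ℝ (TangentSpace 𝓘(ℝ, E) x)) (p : ℕ) : Prop :=
  ∀ m : M, IsGreatest {q : ℕ | ∃ U : Opens M, m ∈ U ∧
    ∃ J : Fin q → M → ℝ, IndependentInvariants D U J} p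

/-- `(M, F, G)` is a decomposable system with `rank F = k` and `rank G = l`. -/
structure IsDecomposable [FiniteDimensional ℝ E]
    (F G : (x : M) → Submodule ℝ (TangentSpace 𝓘(ℝ, E) x)) (k l : ℕ) : Prop where
  distF : IsDistribution F k
  distG : IsDistribution G l
  inf_eq_bot : ∀ x, F x ⊓ G x = ⊥
  bracket_mem : ∀ (U : Opens M), ∀ X ∈ sections F U, ∀ Y ∈ sections G U, ∀ x ∈ U,
    (⁅X, Y⁆ : VecField E U).1 x ∈ F x ⊔ G x

/-- `(M, F, G)` has no invariants: the completion of `V = F ⊕ G` is the whole tangent bundle. -/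
def NoInvariants [FiniteDimensional ℝ E]
    (F G : (x : M) → Submodule ℝ (TangentSpace 𝓘(ℝ, E) x)) : Prop :=
  ∀ x, completion (fun y => F y ⊔ G y) x = ⊤

/-- Darboux integrability of `(M, F, G)` with `rank F = k` and `rank G = l`: near every point, `F`
has `l` functionally independent invariants `I`, `G` has `k` functionally independent invariants
`J`, and no non-zero linear combination of their differentials vanishes on `V = F ⊕ G`. -/
def IsDarbouxIntegrable (F G : (x : M) → Submodule ℝ (TangentSpace 𝓘(ℝ, E) x))
    (k l : ℕ) : Prop :=
  ∀ m : M, ∃ U : Opens M, m ∈ U ∧ ∃ (I : Fin l → M → ℝ) (J : Fin k → M → ℝ),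
    IndependentInvariants F U I ∧ IndependentInvariants G U J ∧
    ∀ x ∈ U, ∀ α ∈ Submodule.span ℝ ((range fun i => mvfderiv 𝓘(ℝ, E) (I i) x) ∪
        (range fun j => mvfderiv 𝓘(ℝ, E) (J j) x)),
      (∀ v ∈ F x ⊔ G x, α v = 0) → α = 0

/-- The vector field `X` on `U` is a symmetry of the distribution `D`, i.e. `[X, D] ⊆ D`. -/
def IsSymmetry [FiniteDimensional ℝ E] (D : (x : M) → Submodule ℝ (TangentSpace 𝓘(ℝ, E) x))
    {U : Opens M} (X : VecField E U) : Prop :=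
  ∀ Y ∈ sections D U, ⁅X, Y⁆ ∈ sections D U

end Distributions

section Projection

variable {E E₁ E₂ : Type*}
  [NormedAddCommGroup E] [NormedSpace ℝ E] [FiniteDimensional ℝ E]
  [NormedAddCommGroup E₁] [NormedSpace ℝ E₁] [FiniteDimensional ℝ E₁]
  [NormedAddCommGroup E₂] [NormedSpace ℝ E₂] [FiniteDimensional ℝ E₂]
  {M : Type*} [TopologicalSpace M] [ChartedSpace E M] [IsManifold 𝓘(ℝ, E) ∞ M]
  {B₁ : Type*} [TopologicalSpace B₁] [ChartedSpace E₁ B₁] [IsManifold 𝓘(ℝ, E₁) ∞ B₁]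
  {B₂ : Type*} [TopologicalSpace B₂] [ChartedSpace E₂ B₂] [IsManifold 𝓘(ℝ, E₂) ∞ B₂]

variable (E₁) in
/-- `π` is a projection onto a quotient of `M` by the foliation defined by the completion of `D`:
a surjective submersion whose fibres are tangent to the completion of `D`. -/
structure IsFoliationProjection (D : (x : M) → Submodule ℝ (TangentSpace 𝓘(ℝ, E) x))
    (π : M → B₁) : Prop where
  surjective : Function.Surjective π
  smooth : ContMDiff 𝓘(ℝ, E) 𝓘(ℝ, E₁) ∞ π
  submersion : ∀ x, Function.Surjective (mfderiv 𝓘(ℝ, E) 𝓘(ℝ, E₁) π x)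
  ker_eq : ∀ x, LinearMap.ker (mfderiv 𝓘(ℝ, E) 𝓘(ℝ, E₁) π x).toLinearMap = completion D x

variable (E₁ E₂) in
/-- `π = (π₁, π₂) : M → B₁ × B₂` is a Darboux projection of `(M, F, G)`: `B₁` and `B₂` are the
quotients of `M` by the completion of `G` and by the completion of `F`, respectively. -/
structure IsDarbouxProjection (F G : (x : M) → Submodule ℝ (TangentSpace 𝓘(ℝ, E) x))
    (π₁ : M → B₁) (π₂ : M → B₂) : Prop where
  fst : IsFoliationProjection E₁ G π₁
  snd : IsFoliationProjection E₂ F π₂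

variable (E₁ E₂) in
/-- The vector field `X` on `U` is tangent to the fibres of `π = (π₁, π₂)`. -/
def IsTangential (π₁ : M → B₁) (π₂ : M → B₂) {U : Opens M} (X : VecField E U) : Prop :=
  ∀ x ∈ U, mfderiv 𝓘(ℝ, E) 𝓘(ℝ, E₁) π₁ x (X.1 x) = 0 ∧
    mfderiv 𝓘(ℝ, E) 𝓘(ℝ, E₂) π₂ x (X.1 x) = 0

variable (E₁ E₂) in
/-- `Φ` is a family of vector fields on `U` that is the lift, with respect to the connection
`V = F ⊕ G`, of a commuting frame `Ψ` of `B₁` defined near `π₁(U)`: each `Φ i` is contained in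
`F ⊕ G` and projects to `(Ψ i, 0)`. -/
def IsLiftedCommutingFrame (F G : (x : M) → Submodule ℝ (TangentSpace 𝓘(ℝ, E) x))
    (π₁ : M → B₁) (π₂ : M → B₂) {U : Opens M} {k : ℕ} (Φ : Fin k → VecField E U) : Prop :=
  ∃ W : Opens B₁, (∀ x ∈ U, π₁ x ∈ W) ∧ ∃ Ψ : Fin k → VecField E₁ W,
    (∀ i j, ⁅Ψ i, Ψ j⁆ = 0) ∧
    (∀ b ∈ W, LinearIndependent ℝ (fun i => (Ψ i).1 b) ∧
      Submodule.span ℝ (range fun i => (Ψ i).1 b) = ⊤) ∧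
    ∀ i, ∀ x ∈ U, (Φ i).1 x ∈ F x ⊔ G x ∧
      mfderiv 𝓘(ℝ, E) 𝓘(ℝ, E₁) π₁ x ((Φ i).1 x) = (Ψ i).1 (π₁ x) ∧
      mfderiv 𝓘(ℝ, E) 𝓘(ℝ, E₂) π₂ x ((Φ i).1 x) = 0

/-- The derived algebra `[𝔞, 𝔞]` of the real Lie algebra `𝔞` of vector fields generated by the
vector fields `Φ i`. -/
def derivedOfGenerated {U : Opens M} {k : ℕ} (Φ : Fin k → VecField E U) :
    Submodule ℝ (VecField E U) :=
  Submodule.span ℝ {Z | ∃ X ∈ LieSubalgebra.lieSpan ℝ (VecField E U) (range Φ),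
    ∃ Y ∈ LieSubalgebra.lieSpan ℝ (VecField E U) (range Φ), ⁅X, Y⁆ = Z}

/-- Restriction of vector fields on `U` to the fibre `U_b` over `b` of `(π₁, π₂)`. -/
def fibreRestriction (π₁ : M → B₁) (π₂ : M → B₂) (U : Opens M) (b : B₁ × B₂) :
    VecField E U →ₗ[ℝ] ((x : {x : M // x ∈ U ∧ (π₁ x, π₂ x) = b}) →
      TangentSpace 𝓘(ℝ, E) (x : M)) where
  toFun X := fun x => X.1 x
  map_add' _ _ := rfl
  map_smul' _ _ := rfl

/-- Let `L` and `A` be spaces of vector fields on `U` tangent to the fibres of `(π₁, π₂)`.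
Restriction to the fibre over `b` is a Lie algebra isomorphism from `L` onto the restriction of `A`
to the fibre; the Lie bracket of two vector fields on the fibre that are restrictions of `X` and `Y`
is the restriction of `⁅X, Y⁆`. -/
structure RestrictsIsomorphically (π₁ : M → B₁) (π₂ : M → B₂) {U : Opens M} (b : B₁ × B₂)
    (L : LieSubalgebra ℝ (VecField E U)) (A : Submodule ℝ (VecField E U)) : Prop where
  injOn : Set.InjOn (fibreRestriction π₁ π₂ U b) (L : Set (VecField E U))
  map_eq : L.toSubmodule.map (fibreRestriction π₁ π₂ U b) =
    A.map (fibreRestriction π₁ π₂ U b)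
  map_lie : ∀ X ∈ L, ∀ Y ∈ L, ∀ X' ∈ A, ∀ Y' ∈ A,
    fibreRestriction π₁ π₂ U b X = fibreRestriction π₁ π₂ U b X' →
    fibreRestriction π₁ π₂ U b Y = fibreRestriction π₁ π₂ U b Y' →
    fibreRestriction π₁ π₂ U b ⁅X, Y⁆ = fibreRestriction π₁ π₂ U b ⁅X', Y'⁆

end Projection

end DarbouxSystem

end

open Filter
open scoped Topology

noncomputable section

namespace DarbouxSystem

section Calculus

variable {E : Type*} [NormedAddCommGroup E] [NormedSpace ℝ E]
  {E' : Type*} [NormedAddCommGroup E'] [NormedSpace ℝ E']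
  {M : Type*} [TopologicalSpace M] [ChartedSpace E M]

/-- The section `X` of `TM` is smooth at `x`. -/
abbrev SmoothSectionAt (X : (x : M) → TangentSpace 𝓘(ℝ, E) x) (x : M) [IsManifold 𝓘(ℝ, E) 1 M] :
    Prop :=
  ContMDiffAt 𝓘(ℝ, E) 𝓘(ℝ, E).tangent ∞ (fun y => (⟨y, X y⟩ : TangentBundle 𝓘(ℝ, E) M)) x

variable [IsManifold 𝓘(ℝ, E) ∞ M]

theorem SmoothSectionAt.mvfderiv_apply {f : M → E'} {X : (x : M) → TangentSpace 𝓘(ℝ, E) x} {x : M}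
    (hf : ContMDiffAt 𝓘(ℝ, E) 𝓘(ℝ, E') ∞ f x) (hX : SmoothSectionAt X x) :
    ContMDiffAt 𝓘(ℝ, E) 𝓘(ℝ, E') ∞ (fun y => mvfderiv 𝓘(ℝ, E) f y (X y)) x := by
  have h1 := ContMDiffAt.mfderiv_const (m := ∞) hf (by simp)
  have h2 := ContMDiffAt.clm_apply_of_inCoordinates (E₁ := TangentSpace 𝓘(ℝ, E) (M := M))
    (E₂ := TangentSpace 𝓘(ℝ, E') (M := E')) (b₁ := id) (b₂ := f)
    (ϕ := fun y => mfderiv 𝓘(ℝ, E) 𝓘(ℝ, E') f y) (v := fun y => X y) h1 hX hf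
  exact (contMDiff_snd_tangentBundle_modelSpace E' 𝓘(ℝ, E')).contMDiffAt.comp x h2

set_option linter.unusedSectionVars false in
theorem contMDiffAt_inverse {V W : Type*} [NormedAddCommGroup V] [NormedSpace ℝ V]
    [CompleteSpace V] [NormedAddCommGroup W] [NormedSpace ℝ W] {A : M → V →L[ℝ] W} {x : M}
    (hA : ContMDiffAt 𝓘(ℝ, E) 𝓘(ℝ, V →L[ℝ] W) ∞ A x) (e : V ≃L[ℝ] W) (he : (e : V →L[ℝ] W) = A x) :
    ContMDiffAt 𝓘(ℝ, E) 𝓘(ℝ, W →L[ℝ] V) ∞ (fun y => (A y).inverse) x := by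
  have h : ContDiffAt ℝ ∞ (ContinuousLinearMap.inverse : (V →L[ℝ] W) → W →L[ℝ] V) (A x) := by
    rw [← he]; exact contDiffAt_map_inverse e
  exact h.contMDiffAt.comp x hA

theorem eventually_isInvertible {V W : Type*} [NormedAddCommGroup V] [NormedSpace ℝ V]
    [CompleteSpace V] [NormedAddCommGroup W] [NormedSpace ℝ W] {A : M → V →L[ℝ] W} {x : M}
    (hA : ContinuousAt A x) (e : V ≃L[ℝ] W) (he : (e : V →L[ℝ] W) = A x) :
    ∀ᶠ y in 𝓝 x, (A y).IsInvertible := by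
  have := hA.eventually (ContinuousLinearEquiv.nhds e |> fun h => by rw [← he]; exact h)
  exact this

theorem SmoothSectionAt.exists_dual [FiniteDimensional ℝ E] {ι : Type*} [Fintype ι] [DecidableEq ι]
    {Y : ι → (x : M) → TangentSpace 𝓘(ℝ, E) x} {x : M} (hY : ∀ i, SmoothSectionAt (Y i) x)
    (hli : LinearIndependent ℝ fun i => Y i x) :
    ∃ ξ : ι → (y : M) → TangentSpace 𝓘(ℝ, E) y →L[ℝ] ℝ,
      (∀ᶠ y in 𝓝 x, ∀ i j, ξ i y (Y j y) = if i = j then 1 else 0) ∧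
      ∀ i X, SmoothSectionAt X x → ContMDiffAt 𝓘(ℝ, E) 𝓘(ℝ, ℝ) ∞ (fun y => ξ i y (X y)) x := by
  let φ : M → E := fun y => extChartAt 𝓘(ℝ, E) x y
  have hφs : ContMDiffAt 𝓘(ℝ, E) 𝓘(ℝ, E) ∞ φ x := contMDiffAt_extChartAt
  have hinj : Function.Injective (mvfderiv 𝓘(ℝ, E) φ x) :=
    (isInvertible_mfderiv_extChartAt (I := 𝓘(ℝ, E)) (mem_extChartAt_source x)).injective
  have hli' : LinearIndependent ℝ fun i => mvfderiv 𝓘(ℝ, E) φ x (Y i x) :=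
    hli.map' (mvfderiv 𝓘(ℝ, E) φ x).toLinearMap (LinearMap.ker_eq_bot.2 hinj)
  obtain ⟨P₀, hP₀⟩ := LinearMap.exists_leftInverse_of_injective
    (Fintype.linearCombination ℝ fun i => mvfderiv 𝓘(ℝ, E) φ x (Y i x))
    (LinearMap.ker_eq_bot.2 (by
      exact hli'.fintypeLinearCombination_injective))
  obtain ⟨P, hP⟩ : ∃ P : E →L[ℝ] (ι → ℝ), ∀ v, P v = P₀ v :=
    ⟨LinearMap.toContinuousLinearMap P₀, fun _ => rfl⟩
  have hPY : ∀ i, P (mvfderiv 𝓘(ℝ, E) φ x (Y i x)) = Pi.single i 1 := by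
    intro i
    have := LinearMap.congr_fun hP₀ (Pi.single i 1)
    simpa [Fintype.linearCombination_apply_single, hP] using this
  let A : M → (ι → ℝ) →L[ℝ] (ι → ℝ) := fun y =>
    ∑ i, (ContinuousLinearMap.proj (R := ℝ) (φ := fun _ : ι => ℝ) i).smulRight
      (P (mvfderiv 𝓘(ℝ, E) φ y (Y i y)))
  have hAs : ContMDiffAt 𝓘(ℝ, E) 𝓘(ℝ, (ι → ℝ) →L[ℝ] (ι → ℝ)) ∞ A x := by
    refine ContMDiffAt.sum fun i _ => ?_
    have h1 := P.contMDiff.contMDiffAt.comp x (SmoothSectionAt.mvfderiv_apply hφs (hY i))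
    exact ((ContinuousLinearMap.smulRightL ℝ (ι → ℝ) (ι → ℝ)
      (ContinuousLinearMap.proj (R := ℝ) (φ := fun _ : ι => ℝ) i)).contMDiff.contMDiffAt).comp x h1
  have hAa : ∀ y i, A y (Pi.single i 1) = P (mvfderiv 𝓘(ℝ, E) φ y (Y i y)) := by
    intro y i
    simp [A, Pi.single_apply]
  have hAx : ((ContinuousLinearEquiv.refl ℝ (ι → ℝ) : (ι → ℝ) ≃L[ℝ] (ι → ℝ)) :
      (ι → ℝ) →L[ℝ] (ι → ℝ)) = A x := by
    ext c j
    simp only [A, ContinuousLinearEquiv.coe_refl, ContinuousLinearMap.coe_id', id_eq,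
      sum_apply, ContinuousLinearMap.smulRight_apply,
      ContinuousLinearMap.proj_apply, hPY, Finset.sum_apply, Pi.smul_apply, Pi.single_apply]
    simp
  have hinv := eventually_isInvertible hAs.continuousAt _ hAx
  refine ⟨fun i y => (ContinuousLinearMap.proj (R := ℝ) (φ := fun _ : ι => ℝ) i).comp
    ((A y).inverse.comp (P.comp (mvfderiv 𝓘(ℝ, E) φ y))), ?_, ?_⟩
  · filter_upwards [hinv] with y hy i j
    obtain ⟨e, he⟩ := hy
    have h1 := hAa y j
    rw [← he] at h1
    simp only [ContinuousLinearMap.comp_apply, ContinuousLinearMap.proj_apply]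
    rw [← h1, ← he, ContinuousLinearMap.inverse_equiv]
    simp [Pi.single_apply]
  · intro i X hX
    have h1 := P.contMDiff.contMDiffAt.comp x (SmoothSectionAt.mvfderiv_apply hφs hX)
    have h2 := (contMDiffAt_inverse hAs _ hAx).clm_apply h1
    exact ((ContinuousLinearMap.proj (R := ℝ) (φ := fun _ : ι => ℝ) i).contMDiff.contMDiffAt).comp
      x h2

theorem SmoothSectionAt.coeff [FiniteDimensional ℝ E] {ι : Type*} [Fintype ι]
    {Y : ι → (x : M) → TangentSpace 𝓘(ℝ, E) x} {x : M} (hY : ∀ i, SmoothSectionAt (Y i) x)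
    (hli : LinearIndependent ℝ fun i => Y i x) {X : (x : M) → TangentSpace 𝓘(ℝ, E) x}
    (hX : SmoothSectionAt X x) {g : ι → M → ℝ} (hg : ∀ᶠ y in 𝓝 x, X y = ∑ i, g i y • Y i y)
    (i : ι) : ContMDiffAt 𝓘(ℝ, E) 𝓘(ℝ, ℝ) ∞ (g i) x := by
  classical
  obtain ⟨ξ, h1, h2⟩ := SmoothSectionAt.exists_dual hY hli
  refine (h2 i X hX).congr_of_eventuallyEq ?_
  filter_upwards [hg, h1] with y hy hy'
  rw [hy, map_sum]
  simp [hy']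

theorem SmoothSectionAt.eventually_linearIndependent [FiniteDimensional ℝ E] {ι : Type*} [Fintype ι]
    {Y : ι → (x : M) → TangentSpace 𝓘(ℝ, E) x} {x : M} (hY : ∀ i, SmoothSectionAt (Y i) x)
    (hli : LinearIndependent ℝ fun i => Y i x) :
    ∀ᶠ y in 𝓝 x, LinearIndependent ℝ fun i => Y i y := by
  classical
  obtain ⟨ξ, h1, -⟩ := SmoothSectionAt.exists_dual hY hli
  filter_upwards [h1] with y hy
  rw [Fintype.linearIndependent_iff]
  intro c hc i
  have := congrArg (ξ i y) hc
  simpa [hy] using this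

theorem SmoothSectionAt.smul {X : (x : M) → TangentSpace 𝓘(ℝ, E) x} {x : M} {f : M → ℝ}
    (hf : ContMDiffAt 𝓘(ℝ, E) 𝓘(ℝ, ℝ) ∞ f x) (hX : SmoothSectionAt X x) :
    SmoothSectionAt (fun y => f y • X y) x :=
  ContMDiffAt.smul_section hf hX

theorem SmoothSectionAt.sum {ι : Type*} {s : Finset ι} {X : ι → (x : M) → TangentSpace 𝓘(ℝ, E) x}
    {x : M} (hX : ∀ i ∈ s, SmoothSectionAt (X i) x) :
    SmoothSectionAt (fun y => ∑ i ∈ s, X i y) x :=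
  ContMDiffAt.sum_section hX

end Calculus

section Bracket

variable {E : Type*} [NormedAddCommGroup E] [NormedSpace ℝ E] [FiniteDimensional ℝ E]
  {M : Type*} [TopologicalSpace M] [ChartedSpace E M] [IsManifold 𝓘(ℝ, E) ∞ M]

omit [FiniteDimensional ℝ E] in
theorem SmoothSectionAt.mdiffAt {X : (x : M) → TangentSpace 𝓘(ℝ, E) x} {x : M}
    (hX : SmoothSectionAt X x) :
    MDifferentiableAt 𝓘(ℝ, E) 𝓘(ℝ, E).tangent
      (fun y => (⟨y, X y⟩ : TangentBundle 𝓘(ℝ, E) M)) x :=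
  ContMDiffAt.mdifferentiableAt hX (by simp)

omit [FiniteDimensional ℝ E] in
theorem SmoothSectionAt.eventually_mdiffAt {X : (x : M) → TangentSpace 𝓘(ℝ, E) x} {x : M}
    (hX : SmoothSectionAt X x) :
    ∀ᶠ y in 𝓝 x, MDifferentiableAt 𝓘(ℝ, E) 𝓘(ℝ, E).tangent
      (fun y => (⟨y, X y⟩ : TangentBundle 𝓘(ℝ, E) M)) y := by
  have h : ContMDiffAt 𝓘(ℝ, E) 𝓘(ℝ, E).tangent ((1 : ℕ) : WithTop ℕ∞)
      (fun y => (⟨y, X y⟩ : TangentBundle 𝓘(ℝ, E) M)) x := ContMDiffAt.of_le hX (nat_le_infty 1)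
  filter_upwards [(contMDiffAt_iff_contMDiffAt_nhds (by simp)).1 h] with y hy
  exact ContMDiffAt.mdifferentiableAt hy (by simp)

theorem SmoothSectionAt.mlieBracket {X Y : (x : M) → TangentSpace 𝓘(ℝ, E) x} {x : M}
    (hX : SmoothSectionAt X x) (hY : SmoothSectionAt Y x) :
    SmoothSectionAt (mlieBracket 𝓘(ℝ, E) X Y) x := by
  have : CompleteSpace E := FiniteDimensional.complete ℝ E
  have : IsManifold 𝓘(ℝ, E) (((⊤ : ℕ∞) : WithTop ℕ∞) + 1) M := by
    simpa using (inferInstance : IsManifold 𝓘(ℝ, E) ∞ M)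
  have : IsManifold 𝓘(ℝ, E) (minSmoothness ℝ 2) M := IsManifold.of_le (n := ∞)
    (by rw [minSmoothness_of_isRCLikeNormedField]; exact nat_le_infty 2)
  exact ContMDiffAt.mlieBracket_vectorField (𝕜 := ℝ) (m := ⊤) (n := ⊤) hX hY (by simp)

theorem mlieBracket_fun_smul_right {X Z : (x : M) → TangentSpace 𝓘(ℝ, E) x} {x : M} {f : M → ℝ}
    (hf : MDifferentiableAt 𝓘(ℝ, E) 𝓘(ℝ, ℝ) f x)
    (hZ : MDifferentiableAt 𝓘(ℝ, E) 𝓘(ℝ, E).tangent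
      (fun y => (⟨y, Z y⟩ : TangentBundle 𝓘(ℝ, E) M)) x) :
    mlieBracket 𝓘(ℝ, E) X (fun y => f y • Z y) x =
      mvfderiv 𝓘(ℝ, E) f x (X x) • Z x + f x • mlieBracket 𝓘(ℝ, E) X Z x := by
  have : CompleteSpace E := FiniteDimensional.complete ℝ E
  have : IsManifold 𝓘(ℝ, E) 2 M := IsManifold.of_le (n := ∞) (nat_le_infty 2)
  exact mlieBracket_smul_right (V := X) hf hZ

theorem mlieBracket_sum_smul_right {ι : Type*} (s : Finset ι) {X : (x : M) → TangentSpace 𝓘(ℝ, E) x}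
    {Z : ι → (x : M) → TangentSpace 𝓘(ℝ, E) x} {x : M} {g : ι → M → ℝ}
    (hg : ∀ i ∈ s, ContMDiffAt 𝓘(ℝ, E) 𝓘(ℝ, ℝ) ∞ (g i) x)
    (hZ : ∀ i ∈ s, SmoothSectionAt (Z i) x) :
    mlieBracket 𝓘(ℝ, E) X (fun y => ∑ i ∈ s, g i y • Z i y) x =
      ∑ i ∈ s, (mvfderiv 𝓘(ℝ, E) (g i) x (X x) • Z i x +
        g i x • mlieBracket 𝓘(ℝ, E) X (Z i) x) := by
  classical
  have : CompleteSpace E := FiniteDimensional.complete ℝ E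
  have : IsManifold 𝓘(ℝ, E) 2 M := IsManifold.of_le (n := ∞) (nat_le_infty 2)
  induction s using Finset.induction_on with
  | empty =>
    simp only [Finset.sum_empty]
    exact congrFun (mlieBracket_zero_right (W := X)) x
  | insert a s ha ih =>
    have h1 : SmoothSectionAt (fun y => g a y • Z a y) x :=
      SmoothSectionAt.smul (hg a (by simp)) (hZ a (by simp))
    have h2 : SmoothSectionAt (fun y => ∑ i ∈ s, g i y • Z i y) x :=
      SmoothSectionAt.sum fun i hi =>
        SmoothSectionAt.smul (hg i (by simp [hi])) (hZ i (by simp [hi]))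
    have h3 := mlieBracket_add_right (V := X) h1.mdiffAt h2.mdiffAt
    simp only [Finset.sum_insert ha]
    refine h3.trans ?_
    rw [ih (fun i hi => hg i (by simp [hi])) (fun i hi => hZ i (by simp [hi])),
      mlieBracket_fun_smul_right ((hg a (by simp)).mdifferentiableAt (by simp))
        (hZ a (by simp)).mdiffAt]

theorem mvfderiv_mlieBracket {X Y : (x : M) → TangentSpace 𝓘(ℝ, E) x} {x : M} {f : M → ℝ}
    (hX : SmoothSectionAt X x) (hY : SmoothSectionAt Y x)
    (hf : ContMDiffAt 𝓘(ℝ, E) 𝓘(ℝ, ℝ) ∞ f x) :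
    mvfderiv 𝓘(ℝ, E) f x (mlieBracket 𝓘(ℝ, E) X Y x) =
      mvfderiv 𝓘(ℝ, E) (fun y => mvfderiv 𝓘(ℝ, E) f y (Y y)) x (X x) -
      mvfderiv 𝓘(ℝ, E) (fun y => mvfderiv 𝓘(ℝ, E) f y (X y)) x (Y x) := by
  have : CompleteSpace E := FiniteDimensional.complete ℝ E
  have : IsManifold 𝓘(ℝ, E) 2 M := IsManifold.of_le (n := ∞) (nat_le_infty 2)
  have : IsManifold 𝓘(ℝ, E) (minSmoothness ℝ 3) M :=
    IsManifold.of_le (n := ∞)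
      (by rw [minSmoothness_of_isRCLikeNormedField]; exact nat_le_infty 3)
  have h2 : minSmoothness ℝ 2 ≤ (∞ : WithTop ℕ∞) := by
    rw [minSmoothness_of_isRCLikeNormedField]; exact nat_le_infty 2
  have hfe : ∀ᶠ y in 𝓝 x, MDifferentiableAt 𝓘(ℝ, E) 𝓘(ℝ, ℝ) f y := by
    have h : ContMDiffAt 𝓘(ℝ, E) 𝓘(ℝ, ℝ) ((1 : ℕ) : WithTop ℕ∞) f x := hf.of_le (nat_le_infty 1)
    filter_upwards [(contMDiffAt_iff_contMDiffAt_nhds (by simp)).1 h] with y hy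
    exact ContMDiffAt.mdifferentiableAt hy (by simp)
  -- the identity, multiplied by an auxiliary vector field
  have key : ∀ Z : (x : M) → TangentSpace 𝓘(ℝ, E) x, SmoothSectionAt Z x →
      mvfderiv 𝓘(ℝ, E) f x (mlieBracket 𝓘(ℝ, E) X Y x) • Z x =
      (mvfderiv 𝓘(ℝ, E) (fun y => mvfderiv 𝓘(ℝ, E) f y (Y y)) x (X x) -
      mvfderiv 𝓘(ℝ, E) (fun y => mvfderiv 𝓘(ℝ, E) f y (X y)) x (Y x)) • Z x := by
    intro Z hZ
    have hfZ : SmoothSectionAt (fun y => f y • Z y) x := SmoothSectionAt.smul hf hZ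
    have expand : ∀ A B : (x : M) → TangentSpace 𝓘(ℝ, E) x, SmoothSectionAt A x →
        SmoothSectionAt B x →
        mlieBracket 𝓘(ℝ, E) A (mlieBracket 𝓘(ℝ, E) B (fun y => f y • Z y)) x =
        (mvfderiv 𝓘(ℝ, E) (fun y => mvfderiv 𝓘(ℝ, E) f y (B y)) x (A x) • Z x +
          mvfderiv 𝓘(ℝ, E) f x (B x) • mlieBracket 𝓘(ℝ, E) A Z x) +
        (mvfderiv 𝓘(ℝ, E) f x (A x) • mlieBracket 𝓘(ℝ, E) B Z x +
          f x • mlieBracket 𝓘(ℝ, E) A (mlieBracket 𝓘(ℝ, E) B Z) x) := by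
      intro A B hA hB
      have hev : mlieBracket 𝓘(ℝ, E) B (fun y => f y • Z y) =ᶠ[𝓝 x]
          ((fun y => mvfderiv 𝓘(ℝ, E) f y (B y) • Z y) +
            fun y => f y • mlieBracket 𝓘(ℝ, E) B Z y) := by
        filter_upwards [hfe, hZ.eventually_mdiffAt] with y hy hy'
        exact mlieBracket_fun_smul_right hy hy'
      have hBf := SmoothSectionAt.mvfderiv_apply hf hB
      have hBZ := SmoothSectionAt.mlieBracket hB hZ
      rw [Filter.EventuallyEq.mlieBracket_vectorField_eq (Filter.EventuallyEq.refl _ A) hev,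
        mlieBracket_add_right (V := A) (SmoothSectionAt.smul hBf hZ).mdiffAt
          (SmoothSectionAt.smul hf hBZ).mdiffAt,
        mlieBracket_fun_smul_right (hBf.mdifferentiableAt (by simp)) hZ.mdiffAt,
        mlieBracket_fun_smul_right (hf.mdifferentiableAt (by simp)) hBZ.mdiffAt]
    have J1 := leibniz_identity_mlieBracket_apply (ContMDiffAt.of_le hX h2)
      (ContMDiffAt.of_le hY h2) (ContMDiffAt.of_le hfZ h2)
    have J2 := leibniz_identity_mlieBracket_apply (ContMDiffAt.of_le hX h2)
      (ContMDiffAt.of_le hY h2) (ContMDiffAt.of_le hZ h2)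
    rw [expand X Y hX hY, expand Y X hY hX, mlieBracket_fun_smul_right
      (hf.mdifferentiableAt (by simp)) hZ.mdiffAt, J2] at J1
    rw [sub_smul]
    rw [smul_add] at J1
    generalize mvfderiv 𝓘(ℝ, E) f x (mlieBracket 𝓘(ℝ, E) X Y x) • Z x = a at *
    rw [eq_sub_iff_add_eq]
    have := sub_eq_zero.2 J1
    rw [← sub_eq_zero, ← neg_eq_zero, ← this]
    abel
  by_cases h : X x = 0 ∧ Y x = 0
  · have h0 : mlieBracket 𝓘(ℝ, E) X Y x = 0 := by
      rw [← mlieBracketWithin_univ]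
      exact mlieBracketWithin_eq_zero_of_eq_zero h.1 h.2
    rw [h0, h.1, h.2]
    simp
  · have : ∃ Z : (x : M) → TangentSpace 𝓘(ℝ, E) x, SmoothSectionAt Z x ∧ Z x ≠ 0 := by
      by_cases hx : X x = 0
      · exact ⟨Y, hY, fun hy => h ⟨hx, hy⟩⟩
      · exact ⟨X, hX, hx⟩
    obtain ⟨Z, hZ, hZ0⟩ := this
    exact smul_left_injective ℝ hZ0 (key Z hZ)

end Bracket

section VecFieldOps

variable {E : Type*} [NormedAddCommGroup E] [NormedSpace ℝ E]
  {M : Type*} [TopologicalSpace M] [ChartedSpace E M] [IsManifold 𝓘(ℝ, E) ∞ M]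

/-- The vector field on `U` defined by a section that is smooth at every point of `U`. -/
def VecField.mkOn (U : Opens M) (X : (x : M) → TangentSpace 𝓘(ℝ, E) x)
    (hX : ∀ x ∈ U, SmoothSectionAt X x) : VecField E U :=
  ⟨fun x => by classical exact if x ∈ U then X x else 0, by
    refine ⟨fun x hx => ContMDiffAt.contMDiffWithinAt ?_, fun x hx => if_neg hx⟩
    refine ContMDiffAt.congr_of_eventuallyEq (hX x hx) ?_
    filter_upwards [U.isOpen.mem_nhds hx] with y hy
    have hy' : y ∈ U := hy
    simp [hy']⟩

theorem VecField.mkOn_apply {U : Opens M} {X : (x : M) → TangentSpace 𝓘(ℝ, E) x}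
    (hX : ∀ x ∈ U, SmoothSectionAt X x) {x : M} (hx : x ∈ U) : (VecField.mkOn U X hX).1 x = X x :=
  if_pos hx

theorem VecField.smoothAt {U : Opens M} (X : VecField E U) {x : M} (hx : x ∈ U) :
    SmoothSectionAt X.1 x := VecField.contMDiffAt X hx

theorem VecField.sum_apply {U : Opens M} {ι : Type*} (s : Finset ι) (X : ι → VecField E U) (x : M) :
    (∑ i ∈ s, X i).1 x = ∑ i ∈ s, (X i).1 x := by
  rw [AddSubmonoidClass.coe_finsetSum, Finset.sum_apply]

/-- Evaluation of vector fields at a point. -/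
def VecField.eval (U : Opens M) (x : M) : VecField E U →ₗ[ℝ] TangentSpace 𝓘(ℝ, E) x where
  toFun X := X.1 x
  map_add' _ _ := rfl
  map_smul' _ _ := rfl

theorem VecField.eval_apply {U : Opens M} (X : VecField E U) (x : M) :
    VecField.eval U x X = X.1 x := rfl

variable [FiniteDimensional ℝ E]

/-- Restriction of vector fields to a smaller open set. -/
def VecField.restrict {U V : Opens M} (h : V ≤ U) : VecField E U →ₗ⁅ℝ⁆ VecField E V where
  toFun X := VecField.mkOn V X.1 fun _ hx => VecField.smoothAt X (h hx)
  map_add' X Y := VecField.ext fun x hx => by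
    change _ = (VecField.mkOn V X.1 _).1 x + (VecField.mkOn V Y.1 _).1 x
    simp only [VecField.mkOn_apply _ hx]
    rfl
  map_smul' c X := VecField.ext fun x hx => by
    change _ = c • (VecField.mkOn V X.1 _).1 x
    simp only [VecField.mkOn_apply _ hx]
    rfl
  map_lie' {X Y} := VecField.ext fun x hx => by
    change (VecField.mkOn V _ _).1 x = _
    rw [VecField.mkOn_apply _ hx, VecField.bracket_apply _ _ hx, VecField.bracket_apply _ _ (h hx)]
    refine Filter.EventuallyEq.mlieBracket_vectorField_eq ?_ ?_ <;>
    · filter_upwards [V.isOpen.mem_nhds hx] with y hy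
      exact (VecField.mkOn_apply _ hy).symm

theorem VecField.restrict_apply {U V : Opens M} (h : V ≤ U) (X : VecField E U) {x : M}
    (hx : x ∈ V) : (VecField.restrict h X).1 x = X.1 x :=
  VecField.mkOn_apply (fun _ hx => VecField.smoothAt X (h hx)) hx

theorem VecField.mvfderiv_lie {U : Opens M} (X Y : VecField E U) {x : M} (hx : x ∈ U) {f : M → ℝ}
    (hf : ContMDiffAt 𝓘(ℝ, E) 𝓘(ℝ, ℝ) ∞ f x) :
    mvfderiv 𝓘(ℝ, E) f x (⁅X, Y⁆.1 x) =
      mvfderiv 𝓘(ℝ, E) (fun y => mvfderiv 𝓘(ℝ, E) f y (Y.1 y)) x (X.1 x) -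
      mvfderiv 𝓘(ℝ, E) (fun y => mvfderiv 𝓘(ℝ, E) f y (X.1 y)) x (Y.1 x) := by
  rw [VecField.bracket_apply _ _ hx]
  exact mvfderiv_mlieBracket (VecField.smoothAt X hx) (VecField.smoothAt Y hx) hf

theorem VecField.lie_eq_sum {U : Opens M} {ι : Type*} [Fintype ι] (X V : VecField E U)
    (Z : ι → VecField E U) {g : ι → M → ℝ} {x : M} (hx : x ∈ U)
    (hg : ∀ i, ContMDiffAt 𝓘(ℝ, E) 𝓘(ℝ, ℝ) ∞ (g i) x)
    (hV : ∀ y ∈ U, V.1 y = ∑ i, g i y • (Z i).1 y) :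
    ⁅X, V⁆.1 x = ∑ i, (mvfderiv 𝓘(ℝ, E) (g i) x (X.1 x) • (Z i).1 x + g i x • ⁅X, Z i⁆.1 x) := by
  simp only [VecField.bracket_apply _ _ hx]
  rw [← mlieBracket_sum_smul_right Finset.univ (fun i _ => hg i)
    fun i _ => VecField.smoothAt (Z i) hx]
  refine Filter.EventuallyEq.mlieBracket_vectorField_eq (Filter.EventuallyEq.refl _ _) ?_
  filter_upwards [U.isOpen.mem_nhds hx] with y hy
  exact hV y hy

theorem VecField.lie_apply_eq_zero {U : Opens M} {X Y : VecField E U} {x : M} (hx : x ∈ U)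
    (hX : X.1 x = 0) (hY : Y.1 x = 0) : ⁅X, Y⁆.1 x = 0 := by
  rw [VecField.bracket_apply _ _ hx, ← mlieBracketWithin_univ]
  exact mlieBracketWithin_eq_zero_of_eq_zero hX hY

end VecFieldOps

section Centralizer

variable {E : Type*} [NormedAddCommGroup E] [NormedSpace ℝ E] [FiniteDimensional ℝ E]
  {M : Type*} [TopologicalSpace M] [ChartedSpace E M] [IsManifold 𝓘(ℝ, E) ∞ M]
  {U : Opens M} {B B' : Type*}

/-- The vector fields on `U` that are contained in `K` and commute with all elements of `T`. -/
def verticalCentralizer (K : (x : M) → Submodule ℝ (TangentSpace 𝓘(ℝ, E) x))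
    (T : Set (VecField E U)) : Submodule ℝ (VecField E U) where
  carrier := {X | X ∈ sections K U ∧ ∀ Y ∈ T, ⁅X, Y⁆ = 0}
  add_mem' {X Y} hX hY := ⟨fun x hx => (K x).add_mem (hX.1 x hx) (hY.1 x hx), fun Z hZ => by
    rw [add_lie, hX.2 Z hZ, hY.2 Z hZ, add_zero]⟩
  zero_mem' := ⟨fun x _ => (K x).zero_mem, fun Z _ => zero_lie Z⟩
  smul_mem' c X hX := ⟨fun x hx => (K x).smul_mem c (hX.1 x hx), fun Z hZ => by
    rw [smul_lie, hX.2 Z hZ, smul_zero]⟩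

theorem verticalCentralizer.lie_mem {K : (x : M) → Submodule ℝ (TangentSpace 𝓘(ℝ, E) x)}
    (hK : ∀ X ∈ sections K U, ∀ Y ∈ sections K U, ⁅X, Y⁆ ∈ sections K U)
    {T : Set (VecField E U)} {X Y : VecField E U} (hX : X ∈ verticalCentralizer K T)
    (hY : Y ∈ verticalCentralizer K T) : ⁅X, Y⁆ ∈ verticalCentralizer K T := by
  refine ⟨hK X hX.1 Y hY.1, fun Z hZ => ?_⟩
  rw [lie_lie, hX.2 Z hZ, hY.2 Z hZ, lie_zero, lie_zero, sub_zero]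

/-- `Z` is a frame of `K` over `U` that commutes with the family `T` of vector fields spanning the
distribution `H`, whose invariants factor through `p`. -/
structure IsAdaptedFrame (H K : (x : M) → Submodule ℝ (TangentSpace 𝓘(ℝ, E) x)) (p : M → B)
    (T : Set (VecField E U)) {ι : Type*} (Z : ι → VecField E U) : Prop where
  le : ∀ x ∈ U, K x ≤ H x
  mem : ∀ Y ∈ T, Y ∈ sections H U
  le_span : ∀ x ∈ U, H x ≤ Submodule.span ℝ (VecField.eval U x '' T)
  linearIndependent : ∀ x ∈ U, LinearIndependent ℝ fun i => (Z i).1 x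
  span_eq : ∀ x ∈ U, Submodule.span ℝ (range fun i => (Z i).1 x) = K x
  lie_eq_zero : ∀ i, ∀ Y ∈ T, ⁅Z i, Y⁆ = 0
  factors : ∀ f : M → ℝ, (∀ x ∈ U, ContMDiffAt 𝓘(ℝ, E) 𝓘(ℝ, ℝ) ∞ f x) →
    (∀ x ∈ U, ∀ v ∈ H x, mvfderiv 𝓘(ℝ, E) f x v = 0) →
    ∀ x ∈ U, ∀ y ∈ U, p x = p y → f x = f y

theorem exists_smooth_coeff {ι : Type*} [Fintype ι]
    {K : (x : M) → Submodule ℝ (TangentSpace 𝓘(ℝ, E) x)} {Z : ι → VecField E U}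
    (hli : ∀ x ∈ U, LinearIndependent ℝ fun i => (Z i).1 x)
    (hspan : ∀ x ∈ U, Submodule.span ℝ (range fun i => (Z i).1 x) = K x)
    {X : VecField E U} (hX : X ∈ sections K U) :
    ∃ g : ι → M → ℝ, (∀ i, ∀ x ∈ U, ContMDiffAt 𝓘(ℝ, E) 𝓘(ℝ, ℝ) ∞ (g i) x) ∧
      ∀ x ∈ U, X.1 x = ∑ i, g i x • (Z i).1 x := by
  have h : ∀ x : M, ∃ c : ι → ℝ, x ∈ U → X.1 x = ∑ i, c i • (Z i).1 x := by
    intro x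
    by_cases hx : x ∈ U
    · have h1 := hX x hx
      rw [← hspan x hx, Submodule.mem_span_range_iff_exists_fun] at h1
      obtain ⟨c, hc⟩ := h1
      exact ⟨c, fun _ => hc.symm⟩
    · exact ⟨0, fun h => absurd h hx⟩
  choose c hc using h
  refine ⟨fun i x => c x i, fun i x hx => ?_, hc⟩
  refine SmoothSectionAt.coeff (fun i => VecField.smoothAt (Z i) hx) (hli x hx)
    (VecField.smoothAt X hx) (g := fun i x => c x i) ?_ i
  filter_upwards [U.isOpen.mem_nhds hx] with y hy
  exact hc y hy

namespace IsAdaptedFrame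

variable {H K : (x : M) → Submodule ℝ (TangentSpace 𝓘(ℝ, E) x)} {p : M → B}
  {T : Set (VecField E U)} {ι : Type*} {Z : ι → VecField E U}

theorem mem_verticalCentralizer (h : IsAdaptedFrame H K p T Z) (i : ι) :
    Z i ∈ verticalCentralizer K T :=
  ⟨fun x hx => by rw [← h.span_eq x hx]; exact Submodule.subset_span ⟨i, rfl⟩, h.lie_eq_zero i⟩

variable [Fintype ι]

theorem exists_coeff (h : IsAdaptedFrame H K p T Z) {X : VecField E U}
    (hX : X ∈ verticalCentralizer K T) :
    ∃ g : ι → M → ℝ, (∀ i, ∀ x ∈ U, ContMDiffAt 𝓘(ℝ, E) 𝓘(ℝ, ℝ) ∞ (g i) x) ∧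
      (∀ x ∈ U, X.1 x = ∑ i, g i x • (Z i).1 x) ∧
      (∀ i, ∀ x ∈ U, ∀ v ∈ H x, mvfderiv 𝓘(ℝ, E) (g i) x v = 0) ∧
      ∀ i, ∀ x ∈ U, ∀ y ∈ U, p x = p y → g i x = g i y := by
  obtain ⟨g, hg, hXg⟩ := exists_smooth_coeff h.linearIndependent h.span_eq hX.1
  have hd : ∀ i, ∀ x ∈ U, ∀ v ∈ H x, mvfderiv 𝓘(ℝ, E) (g i) x v = 0 := by
    intro i x hx v hv
    have hT : ∀ w ∈ VecField.eval U x '' T, mvfderiv 𝓘(ℝ, E) (g i) x w = 0 := by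
      rintro _ ⟨Y, hY, rfl⟩
      have h1 := VecField.lie_eq_sum Y X Z hx (fun j => hg j x hx) hXg
      rw [← lie_skew, hX.2 Y hY] at h1
      have h2 : ∀ j, ⁅Y, Z j⁆ = 0 := fun j => by rw [← lie_skew, h.lie_eq_zero j Y hY, neg_zero]
      simp only [h2] at h1
      have h3 : ∑ j, mvfderiv 𝓘(ℝ, E) (g j) x (Y.1 x) • (Z j).1 x = 0 := by
        rw [neg_zero] at h1
        have h0 : (0 : VecField E U).1 x = 0 := rfl
        simpa [h0] using h1.symm
      exact Fintype.linearIndependent_iff.1 (h.linearIndependent x hx) _ h3 i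
    have hle : Submodule.span ℝ (VecField.eval U x '' T) ≤
        LinearMap.ker (mvfderiv 𝓘(ℝ, E) (g i) x).toLinearMap :=
      Submodule.span_le.2 fun w hw => hT w hw
    exact hle (h.le_span x hx hv)
  exact ⟨g, hg, hXg, hd, fun i => h.factors (g i) (hg i) (hd i)⟩

theorem apply_eq_zero (h : IsAdaptedFrame H K p T Z) {X : VecField E U}
    (hX : X ∈ verticalCentralizer K T) {x y : M} (hx : x ∈ U) (hy : y ∈ U) (hxy : p x = p y)
    (h0 : X.1 x = 0) : X.1 y = 0 := by
  obtain ⟨g, -, hXg, -, hp⟩ := h.exists_coeff hX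
  have h1 : ∀ i, g i x = 0 :=
    Fintype.linearIndependent_iff.1 (h.linearIndependent x hx) _ ((hXg x hx).symm.trans h0)
  rw [hXg y hy]
  exact Finset.sum_eq_zero fun i _ => by rw [← hp i x hx y hy hxy, h1 i, zero_smul]

theorem lie_apply_eq_zero (h : IsAdaptedFrame H K p T Z) {X Y : VecField E U}
    (hX : X ∈ verticalCentralizer K T) (hY : Y ∈ sections K U) {x : M} (hx : x ∈ U)
    (h0 : X.1 x = 0) : ⁅Y, X⁆.1 x = 0 := by
  obtain ⟨g, hg, hXg, hd, -⟩ := h.exists_coeff hX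
  have h1 : ∀ i, g i x = 0 :=
    Fintype.linearIndependent_iff.1 (h.linearIndependent x hx) _ ((hXg x hx).symm.trans h0)
  rw [VecField.lie_eq_sum Y X Z hx (fun j => hg j x hx) hXg]
  exact Finset.sum_eq_zero fun i _ => by
    rw [h1 i, hd i x hx _ (h.le x hx (hY x hx)), zero_smul, zero_smul, add_zero]

theorem lie_eq_zero_of_centralizers {H' : (x : M) → Submodule ℝ (TangentSpace 𝓘(ℝ, E) x)}
    {p' : M → B'} {T' : Set (VecField E U)} {W : ι → VecField E U}
    (h' : IsAdaptedFrame H' K p' T' W) (hWT : ∀ i, W i ∈ T) {X Y : VecField E U}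
    (hX : X ∈ verticalCentralizer K T) (hY : Y ∈ verticalCentralizer K T') : ⁅X, Y⁆ = 0 := by
  obtain ⟨g, hg, hYg, hd, -⟩ := h'.exists_coeff hY
  refine VecField.ext fun x hx => ?_
  rw [VecField.lie_eq_sum X Y W hx (fun j => hg j x hx) hYg]
  refine Finset.sum_eq_zero fun i _ => ?_
  rw [hd i x hx _ (h'.le x hx (hX.1 x hx)), hX.2 _ (hWT i)]
  have h0 : (0 : VecField E U).1 x = 0 := rfl
  rw [h0, zero_smul, smul_zero, add_zero]

/-- If the vertical frames `Z` and `W` commute with `T` and `T'`, which are mutually commuting, the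
centralizer of `T` contains a Lie algebra that trivializes the vertical bundle. -/
theorem exists_lieSubalgebra {H' : (x : M) → Submodule ℝ (TangentSpace 𝓘(ℝ, E) x)}
    {p' : M → B'} {T' : Set (VecField E U)} {W : ι → VecField E U}
    (h : IsAdaptedFrame H K p T Z) (h' : IsAdaptedFrame H' K p' T' W) (hWT : ∀ i, W i ∈ T)
    (hK : ∀ X ∈ sections K U, ∀ Y ∈ sections K U, ⁅X, Y⁆ ∈ sections K U)
    {σ : M → M} (hσ : ∀ x ∈ U, ContMDiffAt 𝓘(ℝ, E) 𝓘(ℝ, E) ∞ σ x) (hσU : ∀ x ∈ U, σ x ∈ U)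
    (hσd : ∀ x ∈ U, ∀ v ∈ H x, mfderiv 𝓘(ℝ, E) 𝓘(ℝ, E) σ x v = 0)
    (hσσ : ∀ x ∈ U, σ (σ x) = σ x) (hσp : ∀ x ∈ U, p (σ x) = p x)
    (hσp' : ∀ x ∈ U, ∀ y ∈ U, p' (σ x) = p' (σ y))
    {m : M} (hm : m ∈ U) :
    ∃ L : LieSubalgebra ℝ (VecField E U), FiniteDimensional ℝ L ∧
      (∀ X ∈ L, X ∈ verticalCentralizer K T) ∧
      (∀ x ∈ U, ∀ v ∈ K x, ∃ X ∈ L, X.1 x = v) ∧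
      ∀ X ∈ L, ∀ x ∈ U, X.1 x = 0 → X = 0 := by
  have hW := fun i => exists_smooth_coeff h.linearIndependent h.span_eq
    (h'.mem_verticalCentralizer i).1
  choose g hg hWg using hW
  have hgσ : ∀ i j, ∀ x ∈ U, ContMDiffAt 𝓘(ℝ, E) 𝓘(ℝ, ℝ) ∞ (fun y => g i j (σ y)) x :=
    fun i j x hx => (hg i j (σ x) (hσU x hx)).comp x (hσ x hx)
  let X : ι → VecField E U := fun i => VecField.mkOn U (fun y => ∑ j, g i j (σ y) • (Z j).1 y)
    fun x hx => SmoothSectionAt.sum fun j _ =>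
      SmoothSectionAt.smul (hgσ i j x hx) (VecField.smoothAt (Z j) hx)
  have hXe : ∀ i, ∀ x ∈ U, (X i).1 x = ∑ j, g i j (σ x) • (Z j).1 x :=
    fun i x hx => VecField.mkOn_apply _ hx
  have hXc : ∀ i, X i ∈ verticalCentralizer K T := by
    intro i
    refine ⟨fun x hx => ?_, fun Y hY => ?_⟩
    · rw [hXe i x hx]
      exact (K x).sum_mem fun j _ => (K x).smul_mem _ ((h.mem_verticalCentralizer j).1 x hx)
    · rw [← lie_skew, neg_eq_zero]
      refine VecField.ext fun x hx => ?_
      rw [VecField.lie_eq_sum Y (X i) Z hx (fun j => hgσ i j x hx) (hXe i)]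
      refine Finset.sum_eq_zero fun j _ => ?_
      have h1 : mvfderiv 𝓘(ℝ, E) (fun y => g i j (σ y)) x (Y.1 x) = 0 := by
        have := mvfderiv_comp_apply x ((hg i j (σ x) (hσU x hx)).mdifferentiableAt (by simp))
          ((hσ x hx).mdifferentiableAt (by simp)) (Y.1 x)
        refine this.trans ?_
        rw [hσd x hx _ (h.mem Y hY x hx), map_zero]
      have h0 : (0 : VecField E U).1 x = 0 := rfl
      rw [h1, ← lie_skew, h.lie_eq_zero j Y hY, neg_zero, h0, zero_smul, smul_zero, add_zero]
  have hXσ : ∀ i, ∀ x ∈ U, (X i).1 (σ x) = (W i).1 (σ x) := by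
    intro i x hx
    rw [hXe i _ (hσU x hx), hWg i _ (hσU x hx)]
    refine Finset.sum_congr rfl fun j _ => ?_
    rw [hσσ x hx]
  have heq : ∀ A ∈ verticalCentralizer K T, ∀ c : ι → ℝ, ∀ x ∈ U,
      A.1 (σ x) = ∑ i, c i • (W i).1 (σ x) → A.1 x = ∑ i, c i • (X i).1 x := by
    intro A hA c x hx hAx
    have h1 : A - ∑ i, c i • X i ∈ verticalCentralizer K T :=
      Submodule.sub_mem _ hA (Submodule.sum_mem _ fun i _ => Submodule.smul_mem _ _ (hXc i))
    have h2 : ∀ y, (A - ∑ i, c i • X i).1 y = A.1 y - ∑ i, c i • (X i).1 y := by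
      intro y
      rw [← VecField.eval_apply, map_sub, map_sum]
      rfl
    have h3 := h.apply_eq_zero h1 (hσU x hx) hx (hσp x hx) (by
      rw [h2, hAx, sub_eq_zero]
      exact Finset.sum_congr rfl fun i _ => by rw [hXσ i x hx])
    rwa [h2, sub_eq_zero] at h3
  have hlie : ∀ i j, ⁅X i, X j⁆ ∈ Submodule.span ℝ (range X) := by
    intro i j
    obtain ⟨d, -, hd, -, hdp⟩ := h'.exists_coeff (verticalCentralizer.lie_mem hK
      (h'.mem_verticalCentralizer i) (h'.mem_verticalCentralizer j))
    have h1 : ⁅X i, X j⁆ = ∑ a, (-d a (σ m)) • X a := by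
      refine VecField.ext fun x hx => ?_
      rw [VecField.sum_apply]
      refine heq _ (verticalCentralizer.lie_mem hK (hXc i) (hXc j)) _ x hx ?_
      have h2 : ⁅X i - W i, X j - W j⁆.1 (σ x) = 0 := by
        refine VecField.lie_apply_eq_zero (hσU x hx) ?_ ?_
        · rw [← VecField.eval_apply, map_sub, sub_eq_zero]
          exact hXσ i x hx
        · rw [← VecField.eval_apply, map_sub, sub_eq_zero]
          exact hXσ j x hx
      have h3 : ⁅X i - W i, X j - W j⁆ = ⁅X i, X j⁆ + ⁅W i, W j⁆ := by
        rw [sub_lie, lie_sub, lie_sub, (hXc i).2 _ (hWT j), ← lie_skew (W i) (X j),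
          (hXc j).2 _ (hWT i)]
        abel
      rw [h3, ← VecField.eval_apply, map_add, VecField.eval_apply, VecField.eval_apply,
        hd _ (hσU x hx)] at h2
      rw [eq_neg_of_add_eq_zero_left h2, ← Finset.sum_neg_distrib]
      refine Finset.sum_congr rfl fun a _ => ?_
      rw [neg_smul, hdp a (σ x) (hσU x hx) (σ m) (hσU m hm) (hσp' x hx m hm)]
    rw [h1]
    exact Submodule.sum_mem _ fun a _ => Submodule.smul_mem _ _ (Submodule.subset_span ⟨a, rfl⟩)
  let L : LieSubalgebra ℝ (VecField E U) :=
    { Submodule.span ℝ (range X) with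
      lie_mem' := by
        intro A B hA hB
        change ⁅A, B⁆ ∈ Submodule.span ℝ (range X)
        refine Submodule.span_induction₂ (p := fun A B _ _ => ⁅A, B⁆ ∈ Submodule.span ℝ (range X))
          ?_ ?_ ?_ ?_ ?_ ?_ ?_ hA hB
        · rintro _ _ ⟨i, rfl⟩ ⟨j, rfl⟩
          exact hlie i j
        · intro A _
          rw [zero_lie]
          exact Submodule.zero_mem _
        · intro A _
          rw [lie_zero]
          exact Submodule.zero_mem _
        · intro A B C _ _ _ h1 h2
          rw [add_lie]
          exact Submodule.add_mem _ h1 h2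
        · intro A B C _ _ _ h1 h2
          rw [lie_add]
          exact Submodule.add_mem _ h1 h2
        · intro c A B _ _ h1
          rw [smul_lie]
          exact Submodule.smul_mem _ _ h1
        · intro c A B _ _ h1
          rw [lie_smul]
          exact Submodule.smul_mem _ _ h1 }
  have hLT : ∀ A ∈ L, A ∈ verticalCentralizer K T := by
    intro A hA
    have h1 : Submodule.span ℝ (range X) ≤ verticalCentralizer K T :=
      Submodule.span_le.2 (by rintro _ ⟨i, rfl⟩; exact hXc i)
    exact h1 hA
  refine ⟨L, ?_, hLT, ?_, ?_⟩
  · exact (FiniteDimensional.span_of_finite ℝ (finite_range X) :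
      FiniteDimensional ℝ (Submodule.span ℝ (range X)))
  · intro x hx v hv
    rw [← h.span_eq x hx, Submodule.mem_span_range_iff_exists_fun] at hv
    obtain ⟨c, rfl⟩ := hv
    have hA : ∑ i, c i • Z i ∈ verticalCentralizer K T :=
      Submodule.sum_mem _ fun i _ => Submodule.smul_mem _ _ (h.mem_verticalCentralizer i)
    have h1 := hA.1 (σ x) (hσU x hx)
    rw [← h'.span_eq _ (hσU x hx), Submodule.mem_span_range_iff_exists_fun] at h1
    obtain ⟨c', hc'⟩ := h1
    refine ⟨∑ i, c' i • X i, ?_, ?_⟩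
    · change _ ∈ Submodule.span ℝ (range X)
      exact Submodule.sum_mem _ fun a _ => Submodule.smul_mem _ _ (Submodule.subset_span ⟨a, rfl⟩)
    · have h2 := heq _ hA c' x hx hc'.symm
      rw [VecField.sum_apply] at h2 ⊢
      exact h2.symm
  · intro A hA x hx hA0
    have h1 := h.apply_eq_zero (hLT A hA) hx (hσU x hx) (hσp x hx).symm hA0
    have hA' : A ∈ Submodule.span ℝ (range X) := hA
    rw [Submodule.mem_span_range_iff_exists_fun] at hA'
    obtain ⟨c, rfl⟩ := hA'
    rw [VecField.sum_apply] at h1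
    have h2 : ∑ i, c i • (W i).1 (σ x) = 0 := by
      rw [← h1]
      exact Finset.sum_congr rfl fun i _ => by rw [← hXσ i x hx]; rfl
    have h3 := Fintype.linearIndependent_iff.1 (h'.linearIndependent _ (hσU x hx)) c h2
    exact Finset.sum_eq_zero fun i _ => by rw [h3 i, zero_smul]

end IsAdaptedFrame

theorem isSymmetry_of_frame {D : (x : M) → Submodule ℝ (TangentSpace 𝓘(ℝ, E) x)} {ι : Type*}
    [Fintype ι] {Γ : ι → VecField E U} (hli : ∀ x ∈ U, LinearIndependent ℝ fun i => (Γ i).1 x)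
    (hspan : ∀ x ∈ U, Submodule.span ℝ (range fun i => (Γ i).1 x) = D x) {X : VecField E U}
    (hX : ∀ i, ⁅X, Γ i⁆ = 0) : IsSymmetry D X := by
  intro Y hY x hx
  obtain ⟨g, hg, hYg⟩ := exists_smooth_coeff hli hspan hY
  rw [VecField.lie_eq_sum X Y Γ hx (fun j => hg j x hx) hYg]
  refine (D x).sum_mem fun i _ => (D x).add_mem ?_ ?_
  · refine (D x).smul_mem _ ?_
    rw [← hspan x hx]
    exact Submodule.subset_span ⟨i, rfl⟩
  · rw [hX i]
    exact (D x).smul_mem _ (D x).zero_mem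

theorem IsAdaptedFrame.restrictsIsomorphically
    {H K : (x : M) → Submodule ℝ (TangentSpace 𝓘(ℝ, E) x)}
    {p : M → B} {T : Set (VecField E U)} {ι : Type*} [Fintype ι] {Z : ι → VecField E U}
    (h : IsAdaptedFrame H K p T Z)
    (hK : ∀ X ∈ sections K U, ∀ Y ∈ sections K U, ⁅X, Y⁆ ∈ sections K U) {B₁ B₂ : Type*}
    {π₁ : M → B₁} {π₂ : M → B₂} {x : M} (hx : x ∈ U)
    (hp : ∀ y, π₁ y = π₁ x → π₂ y = π₂ x → p x = p y) {L : LieSubalgebra ℝ (VecField E U)}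
    {A : Submodule ℝ (VecField E U)} (hL : ∀ X ∈ L, X ∈ verticalCentralizer K T)
    (hA : A ≤ verticalCentralizer K T) (hLK : ∀ v ∈ K x, ∃ X ∈ L, X.1 x = v)
    (hL0 : ∀ X ∈ L, X.1 x = 0 → X = 0) (hAK : ∀ v ∈ K x, ∃ X ∈ A, X.1 x = v) :
    RestrictsIsomorphically π₁ π₂ (π₁ x, π₂ x) L A := by
  have hext : ∀ X ∈ verticalCentralizer K T, ∀ Y ∈ verticalCentralizer K T, X.1 x = Y.1 x →
      fibreRestriction π₁ π₂ U (π₁ x, π₂ x) X = fibreRestriction π₁ π₂ U (π₁ x, π₂ x) Y := by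
    intro X hX Y hY hXY
    funext ⟨y, hy, hyx⟩
    rw [Prod.mk.injEq] at hyx
    have h1 := h.apply_eq_zero (Submodule.sub_mem _ hX hY) hx hy (hp y hyx.1 hyx.2) (by
      rw [← VecField.eval_apply, map_sub, sub_eq_zero]
      exact hXY)
    rw [← VecField.eval_apply, map_sub, sub_eq_zero] at h1
    exact h1
  have hat : ∀ X Y : VecField E U, fibreRestriction π₁ π₂ U (π₁ x, π₂ x) X =
      fibreRestriction π₁ π₂ U (π₁ x, π₂ x) Y → X.1 x = Y.1 x :=
    fun X Y hXY => congrFun hXY ⟨x, hx, rfl⟩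
  refine ⟨?_, ?_, ?_⟩
  · intro X hX Y hY hXY
    rw [← sub_eq_zero]
    refine hL0 _ (L.sub_mem hX hY) ?_
    rw [← VecField.eval_apply, map_sub, sub_eq_zero]
    exact hat X Y hXY
  · apply le_antisymm
    · rintro _ ⟨X, hX, rfl⟩
      have hX' := hL X hX
      obtain ⟨Y, hY, hYX⟩ := hAK _ (hX'.1 x hx)
      exact ⟨Y, hY, hext Y (hA hY) X hX' hYX⟩
    · rintro _ ⟨X, hX, rfl⟩
      have hX' := hA hX
      obtain ⟨Y, hY, hYX⟩ := hLK _ (hX'.1 x hx)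
      exact ⟨Y, hY, hext Y (hL Y hY) X hX' hYX⟩
  · intro X hX Y hY X' hX' Y' hY' hXX hYY
    have hX := hL X hX
    have hY := hL Y hY
    have hX' := hA hX'
    have hY' := hA hY'
    have hd : ⁅X, Y⁆ - ⁅X', Y'⁆ = ⁅X, Y - Y'⁆ - ⁅Y', X - X'⁆ := by
      rw [lie_sub, lie_sub, ← lie_skew X' Y', ← lie_skew X Y']
      abel
    have h0 : (⁅X, Y⁆ - ⁅X', Y'⁆).1 x = 0 := by
      rw [hd, ← VecField.eval_apply, map_sub, VecField.eval_apply, VecField.eval_apply,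
        h.lie_apply_eq_zero (Submodule.sub_mem _ hY hY') hX.1 hx,
        h.lie_apply_eq_zero (Submodule.sub_mem _ hX hX') hY'.1 hx, sub_zero]
      · rw [← VecField.eval_apply, map_sub, sub_eq_zero]
        exact hat _ _ hXX
      · rw [← VecField.eval_apply, map_sub, sub_eq_zero]
        exact hat _ _ hYY
    refine hext _ (verticalCentralizer.lie_mem hK hX hY) _
      (verticalCentralizer.lie_mem hK hX' hY') ?_
    rwa [← VecField.eval_apply, map_sub, sub_eq_zero] at h0

end Centralizer

section CubeChart

variable {E : Type*} [NormedAddCommGroup E] [NormedSpace ℝ E]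
  {M : Type*} [TopologicalSpace M] [ChartedSpace E M] [IsManifold 𝓘(ℝ, E) ∞ M]
  {V : Type*} [NormedAddCommGroup V] [NormedSpace ℝ V]

/-- `ψ` is a chart of `M` that maps the open set `U` onto the ball of radius `ε` around `ψ m`, and
`θ` is its inverse. -/
structure IsBallChart (U : Opens M) (m : M) (ψ : M → V) (θ : V → M) (ε : ℝ) : Prop where
  mem : m ∈ U
  smooth : ∀ x ∈ U, ContMDiffAt 𝓘(ℝ, E) 𝓘(ℝ, V) ∞ ψ x
  mapsTo : ∀ x ∈ U, ψ x ∈ Metric.ball (ψ m) ε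
  smooth_symm : ∀ z ∈ Metric.ball (ψ m) ε, ContMDiffAt 𝓘(ℝ, V) 𝓘(ℝ, E) ∞ θ z
  mapsTo_symm : ∀ z ∈ Metric.ball (ψ m) ε, θ z ∈ U
  left_inv : ∀ x ∈ U, θ (ψ x) = x
  right_inv : ∀ z ∈ Metric.ball (ψ m) ε, ψ (θ z) = z

namespace IsBallChart

variable {U : Opens M} {m : M} {ψ : M → V} {θ : V → M} {ε : ℝ}

omit [IsManifold 𝓘(ℝ, E) ∞ M] in
theorem mvfderiv_mfderiv (h : IsBallChart (E := E) U m ψ θ ε) {z : V}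
    (hz : z ∈ Metric.ball (ψ m) ε) (w : V) :
    mvfderiv 𝓘(ℝ, E) ψ (θ z) (mfderiv 𝓘(ℝ, V) 𝓘(ℝ, E) θ z w) = w := by
  have h1 : mvfderiv 𝓘(ℝ, V) (ψ ∘ θ) z w =
      mvfderiv 𝓘(ℝ, E) ψ (θ z) (mfderiv 𝓘(ℝ, V) 𝓘(ℝ, E) θ z w) :=
    mfderiv_comp_apply z ((h.smooth _ (h.mapsTo_symm z hz)).mdifferentiableAt (by simp))
      ((h.smooth_symm z hz).mdifferentiableAt (by simp)) w
  have h2 : (ψ ∘ θ) =ᶠ[𝓝 z] id := by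
    filter_upwards [Metric.isOpen_ball.mem_nhds hz] with y hy
    exact h.right_inv y hy
  refine h1.symm.trans ?_
  simp only [mvfderiv]
  rw [h2.mfderiv_eq, mfderiv_id]
  rfl

omit [IsManifold 𝓘(ℝ, E) ∞ M] in
theorem factors (h : IsBallChart (E := E) U m ψ θ ε) (Q : V →L[ℝ] V)
    {H : (x : M) → Submodule ℝ (TangentSpace 𝓘(ℝ, E) x)}
    (hH : ∀ x ∈ U, ∀ v, Q (mvfderiv 𝓘(ℝ, E) ψ x v) = 0 → v ∈ H x) {f : M → ℝ}
    (hf : ∀ x ∈ U, ContMDiffAt 𝓘(ℝ, E) 𝓘(ℝ, ℝ) ∞ f x)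
    (hfH : ∀ x ∈ U, ∀ v ∈ H x, mvfderiv 𝓘(ℝ, E) f x v = 0) {x y : M} (hx : x ∈ U) (hy : y ∈ U)
    (hxy : Q (ψ x) = Q (ψ y)) : f x = f y := by
  set c : ℝ → V := fun t => ψ x + t • (ψ y - ψ x) with hc
  have hcb : ∀ t ∈ Icc (0 : ℝ) 1, c t ∈ Metric.ball (ψ m) ε := fun t ht =>
    (convex_ball (ψ m) ε).add_smul_sub_mem (h.mapsTo x hx) (h.mapsTo y hy) ht
  have hd : ∀ t ∈ Icc (0 : ℝ) 1, HasDerivAt (fun t => f (θ (c t))) 0 t := by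
    intro t ht
    have hb := hcb t ht
    have h1 : HasDerivAt c (ψ y - ψ x) t := by
      have := ((hasDerivAt_id t).smul_const (ψ y - ψ x)).const_add (ψ x)
      simpa [hc] using this
    have hfθ : MDifferentiableAt 𝓘(ℝ, V) 𝓘(ℝ, ℝ) (f ∘ θ) (c t) :=
      ((hf _ (h.mapsTo_symm _ hb)).mdifferentiableAt (by simp)).comp (c t)
        ((h.smooth_symm _ hb).mdifferentiableAt (by simp))
    have h2 := (mdifferentiableAt_iff_differentiableAt.1 hfθ).hasFDerivAt.comp_hasDerivAt t h1
    have h3 : fderiv ℝ (f ∘ θ) (c t) (ψ y - ψ x) = 0 := by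
      rw [← mfderiv_eq_fderiv]
      have h4 := mvfderiv_comp_apply (c t)
        ((hf _ (h.mapsTo_symm _ hb)).mdifferentiableAt (by simp))
        ((h.smooth_symm _ hb).mdifferentiableAt (by simp)) (ψ y - ψ x)
      refine h4.trans (hfH _ (h.mapsTo_symm _ hb) _ (hH _ (h.mapsTo_symm _ hb) _ ?_))
      rw [h.mvfderiv_mfderiv hb, map_sub, hxy, sub_self]
    rw [h3] at h2
    exact h2
  have h0 : f (θ (c 1)) = f (θ (c 0)) := by
    refine constant_of_has_deriv_right_zero (f := fun t => f (θ (c t)))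
      (fun t ht => (hd t ht).continuousAt.continuousWithinAt)
      (fun t ht => (hd t ⟨ht.1, ht.2.le⟩).hasDerivWithinAt) 1 (by simp)
  simpa [hc, h.left_inv x hx, h.left_inv y hy] using h0.symm

omit [IsManifold 𝓘(ℝ, E) ∞ M] in
theorem exists_retraction (h : IsBallChart (E := E) U m ψ θ ε) (Q : V →L[ℝ] V)
    (hQ : ∀ v, ‖Q v‖ ≤ ‖v‖) (hQQ : ∀ v, Q (Q v) = Q v) :
    ∃ σ : M → M, (∀ x ∈ U, ContMDiffAt 𝓘(ℝ, E) 𝓘(ℝ, E) ∞ σ x) ∧ (∀ x ∈ U, σ x ∈ U) ∧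
      (∀ x ∈ U, ∀ v, Q (mvfderiv 𝓘(ℝ, E) ψ x v) = 0 → mfderiv 𝓘(ℝ, E) 𝓘(ℝ, E) σ x v = 0) ∧
      (∀ x ∈ U, σ (σ x) = σ x) ∧ (∀ x ∈ U, Q (ψ (σ x)) = Q (ψ x)) ∧
      ∀ R : V →L[ℝ] V, (∀ v, R (Q v) = 0) → ∀ x ∈ U, R (ψ (σ x)) = R (ψ m) := by
  let τ : V → V := fun z => ψ m + Q (z - ψ m)
  have hτ : ∀ z ∈ Metric.ball (ψ m) ε, τ z ∈ Metric.ball (ψ m) ε := by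
    intro z hz
    rw [mem_ball_iff_norm] at hz ⊢
    simp only [τ, add_sub_cancel_left]
    exact (hQ _).trans_lt hz
  have hτd : ∀ z, HasFDerivAt τ Q z := fun z =>
    ((Q.hasFDerivAt (x := z - ψ m)).comp z ((hasFDerivAt_id z).sub_const (ψ m))).const_add (ψ m)
  have hτs : ContDiff ℝ ∞ τ := contDiff_const.add (Q.contDiff.comp (contDiff_id.sub contDiff_const))
  have hψσ : ∀ x ∈ U, ψ (θ (τ (ψ x))) = τ (ψ x) := fun x hx =>
    h.right_inv _ (hτ _ (h.mapsTo x hx))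
  refine ⟨fun x => θ (τ (ψ x)), fun x hx => ?_, fun x hx => ?_, fun x hx v hv => ?_,
    fun x hx => ?_, fun x hx => ?_, fun R hR x hx => ?_⟩
  · exact (h.smooth_symm _ (hτ _ (h.mapsTo x hx))).comp x
      (hτs.contMDiff.contMDiffAt.comp x (h.smooth x hx))
  · exact h.mapsTo_symm _ (hτ _ (h.mapsTo x hx))
  · have h1 : HasMFDerivAt 𝓘(ℝ, E) 𝓘(ℝ, V) (fun y => τ (ψ y)) x
        (Q.comp (mvfderiv 𝓘(ℝ, E) ψ x)) :=
      (hτd (ψ x)).hasMFDerivAt.comp x ((h.smooth x hx).mdifferentiableAt (by simp)).hasMFDerivAt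
    have h2 := ((h.smooth_symm _ (hτ _ (h.mapsTo x hx))).mdifferentiableAt
      (by simp)).hasMFDerivAt.comp x h1
    have h3 := h2.mfderiv
    have h4 : mfderiv 𝓘(ℝ, E) 𝓘(ℝ, E) (fun x => θ (τ (ψ x))) x v =
      mfderiv 𝓘(ℝ, V) 𝓘(ℝ, E) θ (τ (ψ x)) (Q (mvfderiv 𝓘(ℝ, E) ψ x v)) :=
      congrArg (fun A => A v) h3
    rw [h4, hv]
    exact map_zero _
  · simp only [hψσ x hx]
    simp only [τ, add_sub_cancel_left, hQQ]
  · simp only [hψσ x hx]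
    simp only [τ, map_add, map_sub, hQQ]
    abel
  · simp only [hψσ x hx]
    simp only [τ, map_add, hR, add_zero]

end IsBallChart

end CubeChart

section Submersion

variable {E : Type*} [NormedAddCommGroup E] [NormedSpace ℝ E] [FiniteDimensional ℝ E]
  {M : Type*} [TopologicalSpace M] [ChartedSpace E M] [IsManifold 𝓘(ℝ, E) ∞ M]
  {F : Type*} [NormedAddCommGroup F] [NormedSpace ℝ F]

omit [FiniteDimensional ℝ E] in
/-- A smooth map between normed spaces with invertible derivative at a point is, when composed with
a chart, a ball chart around that point. -/
theorem exists_isBallChart_comp_chart [CompleteSpace E] {V : Type*} [NormedAddCommGroup V]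
    [NormedSpace ℝ V] (m : M) {g : E → V} {e : E ≃L[ℝ] V} {O : Set E} (hO : IsOpen O)
    (hmO : chartAt E m m ∈ O) (hg : ∀ z ∈ O, ContDiffAt ℝ ∞ g z)
    (hge : HasFDerivAt g (e : E →L[ℝ] V) (chartAt E m m)) {N : Set M} (hN : IsOpen N) (hm : m ∈ N) :
    ∃ U : Opens M, (U : Set M) ⊆ N ∩ (chartAt E m).source ∩ chartAt E m ⁻¹' O ∧ ∃ θ : V → M, ∃ ε,
      IsBallChart (E := E) U m (fun x => g (chartAt E m x)) θ ε := by
  have hga := hg _ hmO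
  let G := hga.toOpenPartialHomeomorph g hge (by simp)
  let Ψ : OpenPartialHomeomorph M V := (chartAt E m).trans G
  have hΨ : ∀ x, Ψ x = g (chartAt E m x) := fun x => rfl
  have hinv : ∀ᶠ z in 𝓝 (chartAt E m m), (fderiv ℝ g z).IsInvertible := by
    have h1 : ContinuousAt (fderiv ℝ g) (chartAt E m m) :=
      (hga.fderiv_right (m := 0) (by simp)).continuousAt
    refine h1.eventually ?_
    rw [hge.fderiv]
    exact ContinuousLinearEquiv.nhds e
  obtain ⟨O', hO', hO'o, hmO'⟩ := eventually_nhds_iff.1 hinv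
  have hmΨ : m ∈ Ψ.source := by
    simp only [Ψ, OpenPartialHomeomorph.trans_source, mem_inter_iff, mem_preimage]
    exact ⟨mem_chart_source E m, hga.mem_toOpenPartialHomeomorph_source hge (by simp)⟩
  let S : Set M := N ∩ ((chartAt E m).source ∩ chartAt E m ⁻¹' (O ∩ O'))
  have hS : IsOpen S := hN.inter ((chartAt E m).isOpen_inter_preimage (hO.inter hO'o))
  let Ψ' := Ψ.restrOpen S hS
  have hsrc : Ψ'.source = Ψ.source ∩ S := Ψ.restrOpen_source S hS
  have hmΨ' : m ∈ Ψ'.source := by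
    rw [hsrc]
    exact ⟨hmΨ, hm, mem_chart_source E m, hmO, hmO'⟩
  obtain ⟨ε, hε, hball⟩ := Metric.isOpen_iff.1 Ψ'.open_target (Ψ' m) (Ψ'.map_source hmΨ')
  refine ⟨⟨Ψ'.source ∩ Ψ' ⁻¹' Metric.ball (Ψ' m) ε,
    Ψ'.isOpen_inter_preimage Metric.isOpen_ball⟩, ?_, Ψ'.symm, ε, ?_⟩
  · rintro x ⟨hx, -⟩
    rw [hsrc] at hx
    exact ⟨⟨hx.2.1, hx.2.2.1⟩, hx.2.2.2.1⟩
  refine ⟨⟨hmΨ', Metric.mem_ball_self hε⟩, ?_, fun x hx => hx.2, ?_, ?_, fun x hx => ?_, ?_⟩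
  · rintro x ⟨hx, -⟩
    rw [hsrc] at hx
    exact (hg _ hx.2.2.2.1).contMDiffAt.comp x
      ((contMDiffOn_chart (I := 𝓘(ℝ, E)) x hx.2.2.1).contMDiffAt
        ((chartAt E m).open_source.mem_nhds hx.2.2.1))
  · intro z hz
    have h1 : Ψ'.symm z ∈ Ψ'.source := Ψ'.map_target (hball hz)
    have hz' : z ∈ Ψ.target := by
      have := Ψ'.map_source h1
      rw [Ψ'.right_inv (hball hz)] at this
      have h2 := Ψ.map_source (hsrc ▸ h1).1
      have h3 : Ψ (Ψ'.symm z) = z := Ψ'.right_inv (hball hz)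
      rwa [h3] at h2
    have hzG : z ∈ G.target := hz'.1
    have hsy : Ψ'.symm z = (chartAt E m).symm (G.symm z) := rfl
    have hGz : G.symm z ∈ (chartAt E m).target := hz'.2
    have hch : chartAt E m (Ψ'.symm z) = G.symm z := by
      rw [hsy]
      exact (chartAt E m).right_inv hGz
    have hzS : Ψ'.symm z ∈ S := (hsrc ▸ h1).2
    have hGO : G.symm z ∈ O ∩ O' := by
      rw [← hch]
      exact hzS.2.2
    obtain ⟨e', he'⟩ := hO' _ hGO.2
    have h4 : ContDiffAt ℝ ∞ G.symm z :=
      G.contDiffAt_symm hzG (f₀' := e')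
        (by rw [he']; exact ((hg _ hGO.1).differentiableAt (by simp)).hasFDerivAt) (hg _ hGO.1)
    exact ContMDiffAt.comp z (g := (chartAt E m).symm) (f := G.symm) (I' := 𝓘(ℝ, E))
      ((contMDiffOn_chart_symm (I := 𝓘(ℝ, E)) _ hGz).contMDiffAt
      ((chartAt E m).open_target.mem_nhds hGz)) h4.contMDiffAt
  · intro z hz
    refine ⟨Ψ'.map_target (hball hz), ?_⟩
    rw [mem_preimage, Ψ'.right_inv (hball hz)]
    exact hz
  · exact Ψ'.left_inv hx.1
  · intro z hz
    exact Ψ'.right_inv (hball hz)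

theorem exists_isBallChart_of_submersion (m : M) {q : M → F} {N : Opens M} (hm : m ∈ N)
    (hq : ∀ x ∈ N, ContMDiffAt 𝓘(ℝ, E) 𝓘(ℝ, F) ∞ q x)
    (hsurj : Function.Surjective (mvfderiv 𝓘(ℝ, E) q m)) :
    ∃ (U : Opens M) (S : Submodule ℝ E) (ψ : M → F × S) (θ : F × S → M) (ε : ℝ),
      U ≤ N ∧ IsBallChart (E := E) U m ψ θ ε ∧ (∀ x ∈ U, (ψ x).1 = q x) ∧
      ∀ x ∈ U, ∀ v, (mvfderiv 𝓘(ℝ, E) ψ x v).1 = mvfderiv 𝓘(ℝ, E) q x v := by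
  have hcm := mem_chart_source E m
  let O : Set E := (chartAt E m).target ∩ (chartAt E m).symm ⁻¹' N
  have hO : IsOpen O := (chartAt E m).symm.isOpen_inter_preimage N.isOpen
  have hmO : chartAt E m m ∈ O :=
    ⟨(chartAt E m).map_source hcm, by rw [mem_preimage, (chartAt E m).left_inv hcm]; exact hm⟩
  let q' : E → F := fun z => q ((chartAt E m).symm z)
  have hq's : ∀ z ∈ O, ContDiffAt ℝ ∞ q' z := fun z hz =>
    ContMDiffAt.contDiffAt (ContMDiffAt.comp z (hq _ hz.2)
      ((contMDiffOn_chart_symm (I := 𝓘(ℝ, E)) _ hz.1).contMDiffAt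
        ((chartAt E m).open_target.mem_nhds hz.1)))
  have hqq' : q =ᶠ[𝓝 m] q' ∘ chartAt E m := by
    filter_upwards [(chartAt E m).open_source.mem_nhds hcm] with x hx
    simp only [q', Function.comp_apply, (chartAt E m).left_inv hx]
  have hD : Function.Surjective (fderiv ℝ q' (chartAt E m m)) := by
    intro w
    obtain ⟨v, hv⟩ := hsurj w
    have h1 : mvfderiv 𝓘(ℝ, E) q m v = fderiv ℝ q' (chartAt E m m)
        (mfderiv 𝓘(ℝ, E) 𝓘(ℝ, E) (chartAt E m) m v) := by
      rw [← mfderiv_eq_fderiv]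
      have h2 := mfderiv_comp_apply m (g := q') (I' := 𝓘(ℝ, E)) (I'' := 𝓘(ℝ, F))
        (f := chartAt E m) ((hq's _ hmO).contMDiffAt.mdifferentiableAt (by simp))
        ((contMDiffOn_chart (I := 𝓘(ℝ, E)) m hcm).contMDiffAt
        ((chartAt E m).open_source.mem_nhds hcm) |>.mdifferentiableAt (n := ∞) (by simp)) v
      refine Eq.trans ?_ h2
      simp only [mvfderiv]
      rw [hqq'.mfderiv_eq]
      rfl
    exact ⟨_, h1.symm.trans hv⟩
  generalize hDdef : fderiv ℝ q' (chartAt E m m) = D at hD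
  let S : Submodule ℝ E := LinearMap.ker D.toLinearMap
  obtain ⟨ρ₀, hρ₀⟩ := S.subtype.exists_leftInverse_of_injective S.ker_subtype
  obtain ⟨ρ, hρ⟩ : ∃ ρ : E →L[ℝ] S, ∀ v : S, ρ v = v :=
    ⟨LinearMap.toContinuousLinearMap ρ₀, fun v => LinearMap.congr_fun hρ₀ v⟩
  have hbij : Function.Bijective (D.prod ρ) := by
    constructor
    · rw [injective_iff_map_eq_zero]
      intro v hv
      have h1 : D v = 0 := congrArg Prod.fst hv
      have h2 : ρ v = 0 := congrArg Prod.snd hv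
      have h3 := hρ ⟨v, h1⟩
      rw [show ρ ((⟨v, h1⟩ : S) : E) = 0 from h2] at h3
      exact (congrArg Subtype.val h3).symm
    · rintro ⟨a, s⟩
      obtain ⟨v, rfl⟩ := hD a
      refine ⟨v + ((s - ρ v : S) : E), ?_⟩
      have h1 : D ((s - ρ v : S) : E) = 0 := (s - ρ v).2
      refine Prod.ext ?_ ?_
      · change D (v + ((s - ρ v : S) : E)) = D v
        rw [map_add, h1, add_zero]
      · change ρ (v + ((s - ρ v : S) : E)) = s
        rw [map_add, hρ, add_sub_cancel]
  let e : E ≃L[ℝ] F × S :=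
    (LinearEquiv.ofBijective (D.prod ρ).toLinearMap hbij).toContinuousLinearEquiv
  have he : (e : E →L[ℝ] F × S) = D.prod ρ := rfl
  obtain ⟨U, hUN, θ, ε, hU⟩ := exists_isBallChart_comp_chart m (g := fun z => (q' z, ρ z)) (e := e)
    hO hmO (fun z hz => (hq's z hz).prodMk ρ.contDiff.contDiffAt)
    (by
      rw [he, ← hDdef]
      exact (((hq's _ hmO).differentiableAt (by simp)).hasFDerivAt).prodMk ρ.hasFDerivAt)
    N.isOpen hm
  have hψ : ∀ x ∈ U, q' (chartAt E m x) = q x := fun x hx => by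
    simp only [q', (chartAt E m).left_inv (hUN hx).1.2]
  refine ⟨U, S, _, θ, ε, fun x hx => (hUN hx).1.1, hU, hψ, fun x hx v => ?_⟩
  set ψ : M → F × S := fun x => (q' (chartAt E m x), ρ (chartAt E m x)) with hψd
  have h1 : q =ᶠ[𝓝 x] (ContinuousLinearMap.fst ℝ F S) ∘ ψ := by
    filter_upwards [U.isOpen.mem_nhds hx] with y hy
    exact (hψ y hy).symm
  have h2 := mfderiv_comp_apply x (I' := 𝓘(ℝ, F × S)) (I'' := 𝓘(ℝ, F))
    (ContinuousLinearMap.fst ℝ F S).mdifferentiableAt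
    ((hU.smooth x hx).mdifferentiableAt (by simp)) v
  have h3 : mvfderiv 𝓘(ℝ, E) q x v =
      mfderiv 𝓘(ℝ, E) 𝓘(ℝ, F) ((ContinuousLinearMap.fst ℝ F S) ∘ ψ) x v := by
    simp only [mvfderiv]
    rw [h1.mfderiv_eq]
    rfl
  rw [h3, h2, ContinuousLinearMap.mfderiv_eq]
  rfl

end Submersion

section ProductNhds

variable {E E₁ E₂ : Type*}
  [NormedAddCommGroup E] [NormedSpace ℝ E]
  [NormedAddCommGroup E₁] [NormedSpace ℝ E₁]
  [NormedAddCommGroup E₂] [NormedSpace ℝ E₂]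
  {M : Type*} [TopologicalSpace M] [ChartedSpace E M]
  {B₁ : Type*} [TopologicalSpace B₁] [ChartedSpace E₁ B₁]
  {B₂ : Type*} [TopologicalSpace B₂] [ChartedSpace E₂ B₂]

variable (E E₁) in
/-- Functions on `U` whose differential vanishes on the fibres of `π₁` factor through `π₁`, and `U`
retracts along the fibres of `π₁` to a part of the fibre of `π₂` through `m`. -/
structure HasProductStructure (U : Opens M) (m : M) (π₁ : M → B₁) (π₂ : M → B₂) : Prop where
  factors : ∀ f : M → ℝ, (∀ x ∈ U, ContMDiffAt 𝓘(ℝ, E) 𝓘(ℝ, ℝ) ∞ f x) →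
    (∀ x ∈ U, ∀ v, mfderiv 𝓘(ℝ, E) 𝓘(ℝ, E₁) π₁ x v = 0 → mvfderiv 𝓘(ℝ, E) f x v = 0) →
    ∀ x ∈ U, ∀ y ∈ U, π₁ x = π₁ y → f x = f y
  retraction : ∃ σ : M → M, (∀ x ∈ U, ContMDiffAt 𝓘(ℝ, E) 𝓘(ℝ, E) ∞ σ x) ∧ (∀ x ∈ U, σ x ∈ U) ∧
    (∀ x ∈ U, ∀ v, mfderiv 𝓘(ℝ, E) 𝓘(ℝ, E₁) π₁ x v = 0 →
      mfderiv 𝓘(ℝ, E) 𝓘(ℝ, E) σ x v = 0) ∧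
    (∀ x ∈ U, σ (σ x) = σ x) ∧ (∀ x ∈ U, π₁ (σ x) = π₁ x) ∧ ∀ x ∈ U, π₂ (σ x) = π₂ m

omit [TopologicalSpace B₂] in
theorem IsBallChart.hasProductStructure {V : Type*} [NormedAddCommGroup V] [NormedSpace ℝ V]
    {U : Opens M} {m : M} {ψ : M → V} {θ : V → M} {ε : ℝ} (h : IsBallChart (E := E) U m ψ θ ε)
    {π₁ : M → B₁} {π₂ : M → B₂} (Q R : V →L[ℝ] V) (hQ : ∀ v, ‖Q v‖ ≤ ‖v‖)
    (hQQ : ∀ v, Q (Q v) = Q v) (hRQ : ∀ v, R (Q v) = 0)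
    (hd : ∀ x ∈ U, ∀ v, Q (mvfderiv 𝓘(ℝ, E) ψ x v) = 0 ↔ mfderiv 𝓘(ℝ, E) 𝓘(ℝ, E₁) π₁ x v = 0)
    (h₁ : ∀ x ∈ U, ∀ y ∈ U, Q (ψ x) = Q (ψ y) ↔ π₁ x = π₁ y)
    (h₂ : ∀ x ∈ U, ∀ y ∈ U, R (ψ x) = R (ψ y) → π₂ x = π₂ y) :
    HasProductStructure E E₁ U m π₁ π₂ := by
  refine ⟨fun f hf hfd x hx y hy hxy => ?_, ?_⟩
  · exact h.factors Q (H := fun x => LinearMap.ker (mfderiv 𝓘(ℝ, E) 𝓘(ℝ, E₁) π₁ x).toLinearMap)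
      (fun x hx v hv => (hd x hx v).1 hv) hf (fun x hx v hv => hfd x hx v hv) hx hy
      ((h₁ x hx y hy).2 hxy)
  · obtain ⟨σ, s1, s2, s3, s4, s5, s6⟩ := h.exists_retraction Q hQ hQQ
    exact ⟨σ, s1, s2, fun x hx v hv => s3 x hx v ((hd x hx v).2 hv), s4,
      fun x hx => (h₁ _ (s2 x hx) x hx).1 (s5 x hx),
      fun x hx => h₂ _ (s2 x hx) m h.mem (s6 R hRQ x hx)⟩

variable [FiniteDimensional ℝ E] [IsManifold 𝓘(ℝ, E) ∞ M] [IsManifold 𝓘(ℝ, E₁) ∞ B₁]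
  [IsManifold 𝓘(ℝ, E₂) ∞ B₂]

theorem exists_hasProductStructure {π₁ : M → B₁} {π₂ : M → B₂}
    (hπ₁ : ContMDiff 𝓘(ℝ, E) 𝓘(ℝ, E₁) ∞ π₁) (hπ₂ : ContMDiff 𝓘(ℝ, E) 𝓘(ℝ, E₂) ∞ π₂) {m : M}
    (hsurj : ∀ a b, ∃ v, mfderiv 𝓘(ℝ, E) 𝓘(ℝ, E₁) π₁ m v = a ∧
      mfderiv 𝓘(ℝ, E) 𝓘(ℝ, E₂) π₂ m v = b) {N : Opens M} (hm : m ∈ N) :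
    ∃ U : Opens M, m ∈ U ∧ U ≤ N ∧ HasProductStructure E E₁ U m π₁ π₂ ∧
      HasProductStructure E E₂ U m π₂ π₁ := by
  let φ₁ : B₁ → E₁ := chartAt E₁ (π₁ m)
  let φ₂ : B₂ → E₂ := chartAt E₂ (π₂ m)
  have hφ₁ : ∀ b ∈ (chartAt E₁ (π₁ m)).source, ContMDiffAt 𝓘(ℝ, E₁) 𝓘(ℝ, E₁) ∞ φ₁ b := fun b hb =>
    (contMDiffOn_chart b hb).contMDiffAt ((chartAt E₁ (π₁ m)).open_source.mem_nhds hb)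
  have hφ₂ : ∀ b ∈ (chartAt E₂ (π₂ m)).source, ContMDiffAt 𝓘(ℝ, E₂) 𝓘(ℝ, E₂) ∞ φ₂ b := fun b hb =>
    (contMDiffOn_chart b hb).contMDiffAt ((chartAt E₂ (π₂ m)).open_source.mem_nhds hb)
  have hb₁ : ∀ b ∈ (chartAt E₁ (π₁ m)).source,
      Function.Bijective (mfderiv 𝓘(ℝ, E₁) 𝓘(ℝ, E₁) φ₁ b) := fun b hb =>
    (mdifferentiable_chart (π₁ m)).mfderiv_bijective hb
  have hb₂ : ∀ b ∈ (chartAt E₂ (π₂ m)).source,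
      Function.Bijective (mfderiv 𝓘(ℝ, E₂) 𝓘(ℝ, E₂) φ₂ b) := fun b hb =>
    (mdifferentiable_chart (π₂ m)).mfderiv_bijective hb
  let N' : Opens M := ⟨N ∩ (π₁ ⁻¹' (chartAt E₁ (π₁ m)).source ∩ π₂ ⁻¹' (chartAt E₂ (π₂ m)).source),
    N.isOpen.inter (((chartAt E₁ (π₁ m)).open_source.preimage hπ₁.continuous).inter
      ((chartAt E₂ (π₂ m)).open_source.preimage hπ₂.continuous))⟩
  have hm' : m ∈ N' := ⟨hm, mem_chart_source E₁ _, mem_chart_source E₂ _⟩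
  let q : M → E₁ × E₂ := fun x => (φ₁ (π₁ x), φ₂ (π₂ x))
  have hq : ∀ x ∈ N', ContMDiffAt 𝓘(ℝ, E) 𝓘(ℝ, E₁ × E₂) ∞ q x := fun x hx =>
    ((hφ₁ _ hx.2.1).comp x hπ₁.contMDiffAt).prodMk_space ((hφ₂ _ hx.2.2).comp x hπ₂.contMDiffAt)
  have hqd : ∀ x ∈ N', ∀ v, mvfderiv 𝓘(ℝ, E) q x v =
      (mfderiv 𝓘(ℝ, E₁) 𝓘(ℝ, E₁) φ₁ (π₁ x) (mfderiv 𝓘(ℝ, E) 𝓘(ℝ, E₁) π₁ x v),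
        mfderiv 𝓘(ℝ, E₂) 𝓘(ℝ, E₂) φ₂ (π₂ x) (mfderiv 𝓘(ℝ, E) 𝓘(ℝ, E₂) π₂ x v)) := by
    intro x hx v
    have a1 := ((hφ₁ _ hx.2.1).mdifferentiableAt (by simp)).hasMFDerivAt.comp x
      (hπ₁.contMDiffAt.mdifferentiableAt (by simp)).hasMFDerivAt
    have a2 := ((hφ₂ _ hx.2.2).mdifferentiableAt (by simp)).hasMFDerivAt.comp x
      (hπ₂.contMDiffAt.mdifferentiableAt (by simp)).hasMFDerivAt
    have h1 : HasMFDerivAt 𝓘(ℝ, E) 𝓘(ℝ, E₁ × E₂) q x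
      (((mfderiv 𝓘(ℝ, E₁) 𝓘(ℝ, E₁) φ₁ (π₁ x)).comp (mfderiv 𝓘(ℝ, E) 𝓘(ℝ, E₁) π₁ x)).prod
        ((mfderiv 𝓘(ℝ, E₂) 𝓘(ℝ, E₂) φ₂ (π₂ x)).comp (mfderiv 𝓘(ℝ, E) 𝓘(ℝ, E₂) π₂ x))) :=
      ⟨a1.1.prodMk a2.1, a1.2.prodMk a2.2⟩
    exact congrArg (fun A => A v) h1.mfderiv
  obtain ⟨U, S, ψ, θ, ε, hUN, hU, hψ, hψd⟩ := exists_isBallChart_of_submersion m hm' hq (by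
    rintro ⟨a, b⟩
    obtain ⟨a', rfl⟩ := (hb₁ _ hm'.2.1).2 a
    obtain ⟨b', rfl⟩ := (hb₂ _ hm'.2.2).2 b
    obtain ⟨v, rfl, rfl⟩ := hsurj a' b'
    exact ⟨v, hqd m hm' v⟩)
  let V := (E₁ × E₂) × S
  let Q₁ : V →L[ℝ] V := ((ContinuousLinearMap.inl ℝ (E₁ × E₂) S).comp
    (ContinuousLinearMap.inl ℝ E₁ E₂)).comp ((ContinuousLinearMap.fst ℝ E₁ E₂).comp
      (ContinuousLinearMap.fst ℝ (E₁ × E₂) S))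
  let Q₂ : V →L[ℝ] V := ((ContinuousLinearMap.inl ℝ (E₁ × E₂) S).comp
    (ContinuousLinearMap.inr ℝ E₁ E₂)).comp ((ContinuousLinearMap.snd ℝ E₁ E₂).comp
      (ContinuousLinearMap.fst ℝ (E₁ × E₂) S))
  have hQ₁ : ∀ v, Q₁ v = ((v.1.1, 0), 0) := fun v => rfl
  have hQ₂ : ∀ v, Q₂ v = ((0, v.1.2), 0) := fun v => rfl
  have hd₁ : ∀ x ∈ U, ∀ v, Q₁ (mvfderiv 𝓘(ℝ, E) ψ x v) = 0 ↔
      mfderiv 𝓘(ℝ, E) 𝓘(ℝ, E₁) π₁ x v = 0 := by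
    intro x hx v
    rw [hQ₁, hψd x hx, hqd x (hUN hx)]
    have : mfderiv 𝓘(ℝ, E₁) 𝓘(ℝ, E₁) φ₁ (π₁ x) (mfderiv 𝓘(ℝ, E) 𝓘(ℝ, E₁) π₁ x v) = 0 ↔
      mfderiv 𝓘(ℝ, E) 𝓘(ℝ, E₁) π₁ x v = 0 := map_eq_zero_iff _ (hb₁ _ (hUN hx).2.1).1
    rw [← this]
    constructor
    · intro h
      exact congrArg (fun z => z.1.1) h
    · intro h
      rw [h]
      rfl
  have hd₂ : ∀ x ∈ U, ∀ v, Q₂ (mvfderiv 𝓘(ℝ, E) ψ x v) = 0 ↔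
      mfderiv 𝓘(ℝ, E) 𝓘(ℝ, E₂) π₂ x v = 0 := by
    intro x hx v
    rw [hQ₂, hψd x hx, hqd x (hUN hx)]
    have : mfderiv 𝓘(ℝ, E₂) 𝓘(ℝ, E₂) φ₂ (π₂ x) (mfderiv 𝓘(ℝ, E) 𝓘(ℝ, E₂) π₂ x v) = 0 ↔
      mfderiv 𝓘(ℝ, E) 𝓘(ℝ, E₂) π₂ x v = 0 := map_eq_zero_iff _ (hb₂ _ (hUN hx).2.2).1
    rw [← this]
    constructor
    · intro h
      exact congrArg (fun z => z.1.2) h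
    · intro h
      rw [h]
      rfl
  have he₁ : ∀ x ∈ U, ∀ y ∈ U, Q₁ (ψ x) = Q₁ (ψ y) ↔ π₁ x = π₁ y := by
    intro x hx y hy
    rw [hQ₁, hQ₁, hψ x hx, hψ y hy]
    constructor
    · intro h
      exact (chartAt E₁ (π₁ m)).injOn (hUN hx).2.1 (hUN hy).2.1 (congrArg (fun z => z.1.1) h)
    · intro h
      simp only [q, h]
  have he₂ : ∀ x ∈ U, ∀ y ∈ U, Q₂ (ψ x) = Q₂ (ψ y) ↔ π₂ x = π₂ y := by
    intro x hx y hy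
    rw [hQ₂, hQ₂, hψ x hx, hψ y hy]
    constructor
    · intro h
      exact (chartAt E₂ (π₂ m)).injOn (hUN hx).2.2 (hUN hy).2.2 (congrArg (fun z => z.1.2) h)
    · intro h
      simp only [q, h]
  refine ⟨U, hU.mem, fun x hx => (hUN hx).1, ?_, ?_⟩
  · refine hU.hasProductStructure Q₁ Q₂ (fun v => ?_) (fun v => rfl) (fun v => rfl) hd₁ he₁
      fun x hx y hy => (he₂ x hx y hy).1
    rw [hQ₁]
    simp [Prod.norm_def]
  · refine hU.hasProductStructure Q₂ Q₁ (fun v => ?_) (fun v => rfl) (fun v => rfl) hd₂ he₂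
      fun x hx y hy => (he₁ x hx y hy).1
    rw [hQ₂]
    simp [Prod.norm_def]

end ProductNhds

section Related

variable {E E₁ : Type*}
  [NormedAddCommGroup E] [NormedSpace ℝ E] [FiniteDimensional ℝ E]
  [NormedAddCommGroup E₁] [NormedSpace ℝ E₁] [FiniteDimensional ℝ E₁]
  {M : Type*} [TopologicalSpace M] [ChartedSpace E M] [IsManifold 𝓘(ℝ, E) ∞ M]
  {B₁ : Type*} [TopologicalSpace B₁] [ChartedSpace E₁ B₁] [IsManifold 𝓘(ℝ, E₁) ∞ B₁]

omit [FiniteDimensional ℝ E] in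
theorem contMDiffAt_clm_comp_chart (ℓ : E →L[ℝ] ℝ) (m : M) {x : M}
    (hx : x ∈ (chartAt E m).source) :
    ContMDiffAt 𝓘(ℝ, E) 𝓘(ℝ, ℝ) ∞ (fun y => ℓ (chartAt E m y)) x :=
  ℓ.contMDiff.contMDiffAt.comp x ((contMDiffOn_chart (I := 𝓘(ℝ, E)) x hx).contMDiffAt
    ((chartAt E m).open_source.mem_nhds hx))

omit [FiniteDimensional ℝ E] in
theorem mvfderiv_clm_comp_chart (ℓ : E →L[ℝ] ℝ) (m : M) {x : M}
    (hx : x ∈ (chartAt E m).source) (v : TangentSpace 𝓘(ℝ, E) x) :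
    mvfderiv 𝓘(ℝ, E) (fun y => ℓ (chartAt E m y)) x v =
      ℓ (mfderiv 𝓘(ℝ, E) 𝓘(ℝ, E) (chartAt E m) x v) := by
  have h := mfderiv_comp_apply x (I' := 𝓘(ℝ, E)) (I'' := 𝓘(ℝ, ℝ)) ℓ.mdifferentiableAt
    ((mdifferentiable_chart (I := 𝓘(ℝ, E)) m).mdifferentiableAt hx) v
  refine Eq.trans h ?_
  rw [ContinuousLinearMap.mfderiv_eq]
  rfl

omit [FiniteDimensional ℝ E] in
theorem eq_of_forall_mvfderiv_eq {x : M} {v w : TangentSpace 𝓘(ℝ, E) x}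
    (h : ∀ f : M → ℝ, (∀ᶠ y in 𝓝 x, ContMDiffAt 𝓘(ℝ, E) 𝓘(ℝ, ℝ) ∞ f y) →
      mvfderiv 𝓘(ℝ, E) f x v = mvfderiv 𝓘(ℝ, E) f x w) : v = w := by
  have hx := mem_chart_source E x
  refine ((mdifferentiable_chart (I := 𝓘(ℝ, E)) x).mfderiv_bijective hx).1 ?_
  have h1 : ∀ ℓ : E →L[ℝ] ℝ, ℓ (mfderiv 𝓘(ℝ, E) 𝓘(ℝ, E) (chartAt E x) x v) =
      ℓ (mfderiv 𝓘(ℝ, E) 𝓘(ℝ, E) (chartAt E x) x w) := by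
    intro ℓ
    rw [← mvfderiv_clm_comp_chart ℓ x hx, ← mvfderiv_clm_comp_chart ℓ x hx]
    refine h _ ?_
    filter_upwards [(chartAt E x).open_source.mem_nhds hx] with y hy
    exact contMDiffAt_clm_comp_chart ℓ x hy
  exact (SeparatingDual.eq_iff_forall_dual_eq (R := ℝ) (V := E)).2 h1

theorem VecField.lie_related {U : Opens M} {W : Opens B₁} {π : M → B₁}
    (hπ : ContMDiff 𝓘(ℝ, E) 𝓘(ℝ, E₁) ∞ π) (hUW : ∀ x ∈ U, π x ∈ W) {X Y : VecField E U}
    {X' Y' : VecField E₁ W} (hX : ∀ x ∈ U, mfderiv 𝓘(ℝ, E) 𝓘(ℝ, E₁) π x (X.1 x) = X'.1 (π x))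
    (hY : ∀ x ∈ U, mfderiv 𝓘(ℝ, E) 𝓘(ℝ, E₁) π x (Y.1 x) = Y'.1 (π x)) :
    ∀ x ∈ U, mfderiv 𝓘(ℝ, E) 𝓘(ℝ, E₁) π x (⁅X, Y⁆.1 x) = ⁅X', Y'⁆.1 (π x) := by
  intro x hx
  refine eq_of_forall_mvfderiv_eq fun f hf => ?_
  have hπd : ∀ y, MDifferentiableAt 𝓘(ℝ, E) 𝓘(ℝ, E₁) π y := fun y =>
    hπ.contMDiffAt.mdifferentiableAt (by simp)
  have hfx : ContMDiffAt 𝓘(ℝ, E₁) 𝓘(ℝ, ℝ) ∞ f (π x) := hf.self_of_nhds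
  have hcomp : ∀ g : B₁ → ℝ, MDifferentiableAt 𝓘(ℝ, E₁) 𝓘(ℝ, ℝ) g (π x) → ∀ v,
      mvfderiv 𝓘(ℝ, E) (fun y => g (π y)) x v =
        mvfderiv 𝓘(ℝ, E₁) g (π x) (mfderiv 𝓘(ℝ, E) 𝓘(ℝ, E₁) π x v) :=
    fun g hg v => mvfderiv_comp_apply x hg (hπd x) v
  have hfπ : ContMDiffAt 𝓘(ℝ, E) 𝓘(ℝ, ℝ) ∞ (fun y => f (π y)) x := hfx.comp x hπ.contMDiffAt
  have hrel : ∀ (A : VecField E U) (A' : VecField E₁ W),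
      (∀ x ∈ U, mfderiv 𝓘(ℝ, E) 𝓘(ℝ, E₁) π x (A.1 x) = A'.1 (π x)) →
      (fun y => mvfderiv 𝓘(ℝ, E) (fun y => f (π y)) y (A.1 y)) =ᶠ[𝓝 x]
      fun y => mvfderiv 𝓘(ℝ, E₁) f (π y) (A'.1 (π y)) := by
    intro A A' hA
    filter_upwards [hπ.continuous.continuousAt.eventually hf, U.isOpen.mem_nhds hx] with y hy hyU
    rw [← hA y hyU]
    exact mvfderiv_comp_apply y (hy.mdifferentiableAt (by simp)) (hπd y) _
  have hd : ∀ A' : VecField E₁ W, MDifferentiableAt 𝓘(ℝ, E₁) 𝓘(ℝ, ℝ)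
      (fun b => mvfderiv 𝓘(ℝ, E₁) f b (A'.1 b)) (π x) := fun A' =>
    (SmoothSectionAt.mvfderiv_apply hfx (VecField.smoothAt A' (hUW x hx))).mdifferentiableAt
      (by simp)
  have hcongr : ∀ g h : M → ℝ, g =ᶠ[𝓝 x] h → ∀ v, mvfderiv 𝓘(ℝ, E) g x v =
      mvfderiv 𝓘(ℝ, E) h x v := by
    intro g h hgh v
    have := hgh.mfderiv_eq (I := 𝓘(ℝ, E)) (I' := 𝓘(ℝ, ℝ))
    exact congrArg (fun A => A v) this
  rw [← hcomp f (hfx.mdifferentiableAt (by simp)), VecField.mvfderiv_lie X Y hx hfπ,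
    VecField.mvfderiv_lie X' Y' (hUW x hx) hfx, hcongr _ _ (hrel X X' hX),
    hcongr _ _ (hrel Y Y' hY),
    hcomp _ (hd X'), hcomp _ (hd Y'), hX x hx, hY x hx]

theorem mvfderiv_eq_zero_of_mem_completion
    {D : (x : M) → Submodule ℝ (TangentSpace 𝓘(ℝ, E) x)} {U : Opens M} {f : M → ℝ}
    (hf : ∀ x ∈ U, ContMDiffAt 𝓘(ℝ, E) 𝓘(ℝ, ℝ) ∞ f x)
    (hfD : ∀ x ∈ U, ∀ v ∈ D x, mvfderiv 𝓘(ℝ, E) f x v = 0) {x : M} (hx : x ∈ U)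
    {v : TangentSpace 𝓘(ℝ, E) x} (hv : v ∈ completion D x) : mvfderiv 𝓘(ℝ, E) f x v = 0 := by
  have hle : completion D x ≤ LinearMap.ker (mvfderiv 𝓘(ℝ, E) f x).toLinearMap := by
    refine Submodule.span_le.2 ?_
    rintro _ ⟨U', hx', X, hX, rfl⟩
    let N : LieSubalgebra ℝ (VecField E U') :=
      { carrier := {X | ∀ y ∈ U, y ∈ U' → mvfderiv 𝓘(ℝ, E) f y (X.1 y) = 0}
        add_mem' := fun {X Y} hX hY y hy hy' => by
          rw [← VecField.eval_apply, map_add, map_add, VecField.eval_apply, VecField.eval_apply,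
            hX y hy hy', hY y hy hy', add_zero]
        zero_mem' := fun y _ _ => map_zero _
        smul_mem' := fun c X hX y hy hy' => by
          rw [← VecField.eval_apply, map_smul, map_smul, VecField.eval_apply,
            hX y hy hy', smul_zero]
        lie_mem' := fun {X Y} hX hY y hy hy' => by
          have h0 : ∀ Z : VecField E U', (∀ y ∈ U, y ∈ U' → mvfderiv 𝓘(ℝ, E) f y (Z.1 y) = 0) →
              ∀ w, mvfderiv 𝓘(ℝ, E) (fun z => mvfderiv 𝓘(ℝ, E) f z (Z.1 z)) y w = 0 := by
            intro Z hZ w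
            have h1 : (fun z => mvfderiv 𝓘(ℝ, E) f z (Z.1 z)) =ᶠ[𝓝 y] fun _ => (0 : ℝ) := by
              filter_upwards [U.isOpen.mem_nhds hy, U'.isOpen.mem_nhds hy'] with z hz hz'
              exact hZ z hz hz'
            have h2 := h1.mfderiv_eq (I := 𝓘(ℝ, E)) (I' := 𝓘(ℝ, ℝ))
            have h3 := congrArg (fun A => A w) h2
            refine Eq.trans h3 ?_
            rw [mfderiv_const]
            rfl
          rw [VecField.mvfderiv_lie X Y hy' (hf y hy), h0 X hX, h0 Y hY, sub_zero] }
    have h1 : LieSubalgebra.lieSpan ℝ (VecField E U') (sections D U') ≤ N :=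
      LieSubalgebra.lieSpan_le.2 fun Y hY y hy hy' => hfD y hy _ (hY y hy')
    exact h1 hX x hx hx'
  exact hle hv

theorem IsDistribution.le_completion {D : (x : M) → Submodule ℝ (TangentSpace 𝓘(ℝ, E) x)} {k : ℕ}
    (hD : IsDistribution D k) (x : M) : D x ≤ completion D x := by
  obtain ⟨U, hx, X, hX⟩ := hD x
  rw [← (hX x hx).2]
  refine Submodule.span_mono ?_
  rintro _ ⟨i, rfl⟩
  refine ⟨U, hx, X i, LieSubalgebra.subset_lieSpan fun y hy => ?_, rfl⟩
  rw [← (hX y hy).2]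
  exact Submodule.subset_span ⟨i, rfl⟩

omit [FiniteDimensional ℝ E] in
theorem IsDistribution.finrank_eq {D : (x : M) → Submodule ℝ (TangentSpace 𝓘(ℝ, E) x)} {k : ℕ}
    (hD : IsDistribution D k) (x : M) : Module.finrank ℝ (D x) = k := by
  obtain ⟨U, hx, X, hX⟩ := hD x
  rw [← (hX x hx).2, finrank_span_eq_card (hX x hx).1, Fintype.card_fin]

/-- If the differentials of `k` invariants of `G` are independent on the rank `k` distribution `F`,
then `F` is transversal to the completion of `G`. -/
theorem eq_zero_of_mem_completion {F G : (x : M) → Submodule ℝ (TangentSpace 𝓘(ℝ, E) x)} {k : ℕ}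
    (hF : IsDistribution F k) {U : Opens M} {J : Fin k → M → ℝ} (hJ : IndependentInvariants G U J)
    {x : M} (hx : x ∈ U)
    (hnd : ∀ c : Fin k → ℝ, (∀ v ∈ F x, ∑ j, c j * mvfderiv 𝓘(ℝ, E) (J j) x v = 0) → c = 0)
    {v : TangentSpace 𝓘(ℝ, E) x} (hvF : v ∈ F x) (hvG : v ∈ completion G x) : v = 0 := by
  let A : F x →ₗ[ℝ] (Fin k → ℝ) :=
    LinearMap.pi fun j => (mvfderiv 𝓘(ℝ, E) (J j) x).toLinearMap.comp (F x).subtype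
  have hA : ∀ w j, A w j = mvfderiv 𝓘(ℝ, E) (J j) x w := fun w j => rfl
  have : FiniteDimensional ℝ (TangentSpace 𝓘(ℝ, E) x) := inferInstanceAs (FiniteDimensional ℝ E)
  have hsurj : Function.Surjective A := by
    rw [← LinearMap.range_eq_top]
    by_contra hne
    obtain ⟨f, hf, hfA⟩ := Submodule.exists_le_ker_of_lt_top _ (lt_top_iff_ne_top.2 hne)
    refine hf ?_
    have hfe : ∀ w, f w = ∑ j, f (Pi.single j 1) * w j := by
      intro w
      conv_lhs => rw [← Finset.univ_sum_single w]
      rw [map_sum]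
      refine Finset.sum_congr rfl fun j _ => ?_
      have : Pi.single j (w j) = w j • (Pi.single j 1 : Fin k → ℝ) := by
        rw [← Pi.single_smul, smul_eq_mul, mul_one]
      rw [this, map_smul, smul_eq_mul, mul_comm]
    have h0 := hnd (fun j => f (Pi.single j 1)) fun w hw => by
      have h1 : f (A ⟨w, hw⟩) = 0 := hfA ⟨_, rfl⟩
      rw [hfe] at h1
      exact h1
    ext j
    exact congrFun h0 j
  have hinj : Function.Injective A := by
    refine (LinearMap.injective_iff_surjective_of_finrank_eq_finrank ?_).2 hsurj
    rw [hF.finrank_eq x, Module.finrank_fin_fun]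
  have h1 : A ⟨v, hvF⟩ = 0 := by
    ext j
    rw [hA]
    exact mvfderiv_eq_zero_of_mem_completion
      (fun y hy => (hJ.smooth j y hy).contMDiffAt (U.isOpen.mem_nhds hy)) (hJ.invariant j) hx hvG
  exact congrArg Subtype.val (hinj (h1.trans (map_zero A).symm))

theorem finrank_le_of_hasNumInvariants
    {G : (x : M) → Submodule ℝ (TangentSpace 𝓘(ℝ, E) x)} {k l : ℕ}
    (hG : HasNumInvariants G k) (hGd : IsDistribution G l) {π : M → B₁}
    (hπ : IsFoliationProjection E₁ G π) (m : M) : Module.finrank ℝ E₁ ≤ k := by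
  refine (hG m).2 ?_
  let b := Module.finBasis ℝ E₁
  let ℓ : Fin (Module.finrank ℝ E₁) → E₁ →L[ℝ] ℝ := fun i =>
    LinearMap.toContinuousLinearMap (b.coord i)
  let U : Opens M := ⟨π ⁻¹' (chartAt E₁ (π m)).source,
    (chartAt E₁ (π m)).open_source.preimage hπ.smooth.continuous⟩
  have hd : ∀ i, ∀ x ∈ U, ∀ v, mvfderiv 𝓘(ℝ, E) (fun y => ℓ i (chartAt E₁ (π m) (π y))) x v =
      ℓ i (mfderiv 𝓘(ℝ, E₁) 𝓘(ℝ, E₁) (chartAt E₁ (π m)) (π x)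
        (mfderiv 𝓘(ℝ, E) 𝓘(ℝ, E₁) π x v)) := by
    intro i x hx v
    rw [← mvfderiv_clm_comp_chart (ℓ i) (π m) hx]
    exact mvfderiv_comp_apply x
      ((contMDiffAt_clm_comp_chart (ℓ i) (π m) hx).mdifferentiableAt (by simp))
      (hπ.smooth.contMDiffAt.mdifferentiableAt (by simp)) v
  refine ⟨U, mem_chart_source E₁ (π m), fun i y => ℓ i (chartAt E₁ (π m) (π y)), ?_, ?_, ?_⟩
  · intro i x hx
    exact ((contMDiffAt_clm_comp_chart (ℓ i) (π m) hx).comp x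
      hπ.smooth.contMDiffAt).contMDiffWithinAt
  · intro i x hx v hv
    have h1 : v ∈ LinearMap.ker (mfderiv 𝓘(ℝ, E) 𝓘(ℝ, E₁) π x).toLinearMap := by
      rw [hπ.ker_eq]
      exact hGd.le_completion x hv
    have h2 : mfderiv 𝓘(ℝ, E) 𝓘(ℝ, E₁) π x v = 0 := h1
    rw [hd i x hx, h2, map_zero]
    exact map_zero _
  · intro x hx
    rw [Fintype.linearIndependent_iff]
    intro c hc i
    obtain ⟨w, hw⟩ := ((mdifferentiable_chart (I := 𝓘(ℝ, E₁)) (π m)).mfderiv_bijective hx).2 (b i)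
    obtain ⟨v, rfl⟩ := hπ.submersion x w
    have h1 := congrArg (fun A => A v) hc
    simp only [sum_apply, smul_apply] at h1
    have h2 : ∀ j, mvfderiv 𝓘(ℝ, E) (fun y => ℓ j (chartAt E₁ (π m) (π y))) x v =
        if i = j then 1 else 0 := by
      intro j
      rw [hd j x hx, hw]
      change b.coord j (b i) = _
      rw [Module.Basis.coord_apply, Module.Basis.repr_self, Finsupp.single_apply]
    simpa [h2] using h1

end Related

section Generated

variable {E : Type*} [NormedAddCommGroup E] [NormedSpace ℝ E] [FiniteDimensional ℝ E]
  {M : Type*} [TopologicalSpace M] [ChartedSpace E M] [IsManifold 𝓘(ℝ, E) ∞ M]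
  {U : Opens M}

/-- Near `x`, the section `X` is a linear combination of elements of `𝔞` with smooth functions as
coefficients. -/
inductive IsGeneratedAt (𝔞 : LieSubalgebra ℝ (VecField E U)) (x : M) :
    ((y : M) → TangentSpace 𝓘(ℝ, E) y) → Prop
  | smul {Y : VecField E U} {g : M → ℝ} {X : (y : M) → TangentSpace 𝓘(ℝ, E) y} (hY : Y ∈ 𝔞)
      (hg : ContMDiffAt 𝓘(ℝ, E) 𝓘(ℝ, ℝ) ∞ g x) (hX : X =ᶠ[𝓝 x] fun y => g y • Y.1 y) :
      IsGeneratedAt 𝔞 x X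
  | add {X Y Z : (y : M) → TangentSpace 𝓘(ℝ, E) y} (hX : IsGeneratedAt 𝔞 x X)
      (hY : IsGeneratedAt 𝔞 x Y) (hZ : Z =ᶠ[𝓝 x] fun y => X y + Y y) : IsGeneratedAt 𝔞 x Z

namespace IsGeneratedAt

variable {𝔞 : LieSubalgebra ℝ (VecField E U)} {x : M} {X Y : (y : M) → TangentSpace 𝓘(ℝ, E) y}

theorem smoothSectionAt (hx : x ∈ U) (h : IsGeneratedAt 𝔞 x X) : SmoothSectionAt X x := by
  induction h with
  | @smul Y g X hY hg hX =>
    refine ContMDiffAt.congr_of_eventuallyEq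
      (SmoothSectionAt.smul hg (VecField.smoothAt Y hx)) ?_
    filter_upwards [hX] with y hy
    rw [hy]
  | add _ _ hZ h1 h2 =>
    refine ContMDiffAt.congr_of_eventuallyEq (ContMDiffAt.add_section h1 h2) ?_
    filter_upwards [hZ] with y hy
    rw [hy]
    rfl

theorem congr (h : IsGeneratedAt 𝔞 x X) (hXY : Y =ᶠ[𝓝 x] X) : IsGeneratedAt 𝔞 x Y := by
  cases h with
  | smul h1 h2 h3 => exact smul h1 h2 (hXY.trans h3)
  | add h1 h2 h3 => exact add h1 h2 (hXY.trans h3)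

theorem fun_smul (h : IsGeneratedAt 𝔞 x X) {f : M → ℝ}
    (hf : ContMDiffAt 𝓘(ℝ, E) 𝓘(ℝ, ℝ) ∞ f x) : IsGeneratedAt 𝔞 x fun y => f y • X y := by
  induction h with
  | @smul Y g X hY hg hX =>
    refine smul hY (hf.mul hg) ?_
    filter_upwards [hX] with y hy
    rw [hy, smul_smul]
    rfl
  | add _ _ hZ h1 h2 =>
    refine add h1 h2 ?_
    filter_upwards [hZ] with y hy
    rw [hy, smul_add]

theorem of_mem {A : VecField E U} (hA : A ∈ 𝔞) : IsGeneratedAt 𝔞 x A.1 :=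
  smul hA (contMDiffAt_const (c := (1 : ℝ))) (Eventually.of_forall fun _ => (one_smul ℝ _).symm)

theorem zero : IsGeneratedAt 𝔞 x (fun _ => 0) :=
  (of_mem 𝔞.zero_mem).congr (Eventually.of_forall fun _ => rfl)

theorem sum {ι : Type*} (s : Finset ι) {X : ι → (y : M) → TangentSpace 𝓘(ℝ, E) y}
    (h : ∀ i ∈ s, IsGeneratedAt 𝔞 x (X i)) : IsGeneratedAt 𝔞 x fun y => ∑ i ∈ s, X i y := by
  classical
  induction s using Finset.induction_on with
  | empty => simpa using zero
  | insert a s ha ih =>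
    refine add (h a (by simp)) (ih fun i hi => h i (by simp [hi])) ?_
    exact Eventually.of_forall fun y => Finset.sum_insert ha

theorem exists_mem_apply_eq (h : IsGeneratedAt 𝔞 x X) : ∃ A ∈ 𝔞, A.1 x = X x := by
  induction h with
  | @smul Y g X hY hg hX =>
    exact ⟨g x • Y, 𝔞.smul_mem _ hY, hX.self_of_nhds.symm⟩
  | add _ _ hZ h1 h2 =>
    obtain ⟨A, hA, hAx⟩ := h1
    obtain ⟨B, hB, hBx⟩ := h2
    refine ⟨A + B, 𝔞.add_mem hA hB, ?_⟩
    refine Eq.trans ?_ hZ.self_of_nhds.symm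
    rw [← VecField.eval_apply, map_add]
    exact congrArg₂ (· + ·) hAx hBx

omit [FiniteDimensional ℝ E] in
theorem eventually_mdifferentiableAt {f : M → ℝ} (hf : ContMDiffAt 𝓘(ℝ, E) 𝓘(ℝ, ℝ) ∞ f x) :
    ∀ᶠ y in 𝓝 x, MDifferentiableAt 𝓘(ℝ, E) 𝓘(ℝ, ℝ) f y := by
  have h : ContMDiffAt 𝓘(ℝ, E) 𝓘(ℝ, ℝ) ((1 : ℕ) : WithTop ℕ∞) f x := hf.of_le (nat_le_infty 1)
  filter_upwards [(contMDiffAt_iff_contMDiffAt_nhds (by simp)).1 h] with y hy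
  exact ContMDiffAt.mdifferentiableAt hy (by simp)

theorem mlieBracket (hx : x ∈ U) (hX : IsGeneratedAt 𝔞 x X) (hY : IsGeneratedAt 𝔞 x Y) :
    IsGeneratedAt 𝔞 x (mlieBracket 𝓘(ℝ, E) X Y) := by
  have : CompleteSpace E := FiniteDimensional.complete ℝ E
  have : IsManifold 𝓘(ℝ, E) 2 M := IsManifold.of_le (n := ∞) (nat_le_infty 2)
  have hadd : ∀ A B C X' : (y : M) → TangentSpace 𝓘(ℝ, E) y, IsGeneratedAt 𝔞 x A →
      IsGeneratedAt 𝔞 x B → C =ᶠ[𝓝 x] (fun y => A y + B y) →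
      IsGeneratedAt 𝔞 x (VectorField.mlieBracket 𝓘(ℝ, E) X' A) →
      IsGeneratedAt 𝔞 x (VectorField.mlieBracket 𝓘(ℝ, E) X' B) →
      IsGeneratedAt 𝔞 x (VectorField.mlieBracket 𝓘(ℝ, E) X' C) := by
    intro A B C X' hA hB hC h1 h2
    refine add h1 h2 ?_
    filter_upwards [(hA.smoothSectionAt hx).eventually_mdiffAt,
      (hB.smoothSectionAt hx).eventually_mdiffAt, hC.eventually_nhds] with y h3 h4 h5
    rw [Filter.EventuallyEq.mlieBracket_vectorField_eq (Filter.EventuallyEq.refl _ X') h5]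
    exact mlieBracket_add_right (V := X') h3 h4
  have hneg : ∀ A : (y : M) → TangentSpace 𝓘(ℝ, E) y, IsGeneratedAt 𝔞 x A →
      IsGeneratedAt 𝔞 x fun y => -A y := fun A hA =>
    (hA.fun_smul (contMDiffAt_const (c := (-1 : ℝ)))).congr
      (Eventually.of_forall fun y => (neg_one_smul ℝ (A y)).symm)
  have hswap : ∀ A B : (y : M) → TangentSpace 𝓘(ℝ, E) y,
      IsGeneratedAt 𝔞 x (VectorField.mlieBracket 𝓘(ℝ, E) A B) →
      IsGeneratedAt 𝔞 x (VectorField.mlieBracket 𝓘(ℝ, E) B A) := fun A B h =>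
    (hneg _ h).congr (Eventually.of_forall fun y => mlieBracket_swap_apply)
  induction hY with
  | @smul Y g Y' hYa hg hY' =>
    induction hX with
    | @smul X f X' hXa hf hX' =>
      have e1 : ∀ᶠ y in 𝓝 x, VectorField.mlieBracket 𝓘(ℝ, E) X' Y' y =
          ((f y * mvfderiv 𝓘(ℝ, E) g y (X.1 y)) • Y.1 y +
            (-(g y * mvfderiv 𝓘(ℝ, E) f y (Y.1 y))) • X.1 y) +
            (g y * f y) • (⁅X, Y⁆ : VecField E U).1 y := by
        filter_upwards [hX'.eventually_nhds, hY'.eventually_nhds, eventually_mdifferentiableAt hf,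
          eventually_mdifferentiableAt hg, U.isOpen.mem_nhds hx] with y h1 h2 h3 h4 h5
        rw [Filter.EventuallyEq.mlieBracket_vectorField_eq h1 h2,
          mlieBracket_fun_smul_right h4 (VecField.mdiffAt Y h5),
          mlieBracket_swap_apply, mlieBracket_fun_smul_right h3 (VecField.mdiffAt X h5),
          mlieBracket_swap_apply, ← VecField.bracket_apply X Y h5, map_smul]
        simp only [smul_eq_mul, smul_add, smul_neg, neg_add, neg_neg, smul_smul, neg_smul]
        abel
      have s1 := SmoothSectionAt.mvfderiv_apply hg (VecField.smoothAt X hx)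
      have s2 := SmoothSectionAt.mvfderiv_apply hf (VecField.smoothAt Y hx)
      exact add (add (smul hYa (hf.mul s1) (EventuallyEq.refl _ _))
        (smul hXa (hg.mul s2).neg (EventuallyEq.refl _ _)) (EventuallyEq.refl _ _))
        (smul (𝔞.lie_mem hXa hYa) (hg.mul hf) (EventuallyEq.refl _ _)) e1
    | @add A B C hA hB hC h1 h2 =>
      exact hswap _ _ (hadd A B C _ hA hB hC (hswap _ _ h1) (hswap _ _ h2))
  | @add A B C hA hB hC h1 h2 => exact hadd A B C X hA hB hC h1 h2

end IsGeneratedAt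

theorem exists_mem_lieSpan_of_mem_completion {ι : Type*} [Fintype ι]
    {D : (x : M) → Submodule ℝ (TangentSpace 𝓘(ℝ, E) x)} {Φ : ι → VecField E U}
    (hli : ∀ x ∈ U, LinearIndependent ℝ fun i => (Φ i).1 x)
    (hspan : ∀ x ∈ U, Submodule.span ℝ (range fun i => (Φ i).1 x) = D x) {x : M} (hx : x ∈ U)
    {v : TangentSpace 𝓘(ℝ, E) x} (hv : v ∈ completion D x) :
    ∃ A ∈ LieSubalgebra.lieSpan ℝ (VecField E U) (range Φ), A.1 x = v := by
  set 𝔞 := LieSubalgebra.lieSpan ℝ (VecField E U) (range Φ) with h𝔞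
  have hle : completion D x ≤ 𝔞.toSubmodule.map (VecField.eval U x) := by
    refine Submodule.span_le.2 ?_
    rintro _ ⟨U', hx', X, hX, rfl⟩
    let N : LieSubalgebra ℝ (VecField E U') :=
      { carrier := {X | ∀ y ∈ U, y ∈ U' → IsGeneratedAt 𝔞 y X.1}
        add_mem' := fun {X Y} hX hY y hy hy' =>
          IsGeneratedAt.add (hX y hy hy') (hY y hy hy') (EventuallyEq.refl _ _)
        zero_mem' := fun y _ _ => IsGeneratedAt.zero
        smul_mem' := fun c X hX y hy hy' => (hX y hy hy').fun_smul contMDiffAt_const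
        lie_mem' := fun {X Y} hX hY y hy hy' =>
          ((hX y hy hy').mlieBracket hy (hY y hy hy')).congr
            (VecField.bracket_eventuallyEq X Y hy') }
    have h1 : LieSubalgebra.lieSpan ℝ (VecField E U') (sections D U') ≤ N := by
      refine LieSubalgebra.lieSpan_le.2 fun Y hY y hy hy' => ?_
      obtain ⟨g, hg, hYg⟩ := exists_smooth_coeff (U := U ⊓ U') (K := D)
        (Z := fun i => VecField.restrict inf_le_left (Φ i))
        (fun z hz => by simpa only [VecField.restrict_apply inf_le_left _ hz] using hli z hz.1)
        (fun z hz => by simpa only [VecField.restrict_apply inf_le_left _ hz] using hspan z hz.1)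
        (X := VecField.restrict inf_le_right Y)
        (fun z hz => by rw [VecField.restrict_apply _ _ hz]; exact hY z hz.2)
      refine (IsGeneratedAt.sum Finset.univ (X := fun i z => g i z • (Φ i).1 z) fun i _ =>
        (IsGeneratedAt.of_mem (𝔞 := 𝔞)
          (LieSubalgebra.subset_lieSpan (mem_range_self i))).fun_smul (hg i y ⟨hy, hy'⟩)).congr ?_
      filter_upwards [(U ⊓ U').isOpen.mem_nhds (show y ∈ U ⊓ U' from ⟨hy, hy'⟩)] with z hz
      have h2 := hYg z hz
      simp only [VecField.restrict_apply _ _ hz] at h2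
      exact h2
    obtain ⟨A, hA, hAx⟩ := (h1 hX x hx hx').exists_mem_apply_eq
    exact ⟨A, hA, hAx⟩
  obtain ⟨A, hA, hAv⟩ := hle hv
  exact ⟨A, hA, hAv⟩

end Generated

section Darboux

variable {E E₁ E₂ : Type*}
  [NormedAddCommGroup E] [NormedSpace ℝ E] [FiniteDimensional ℝ E]
  [NormedAddCommGroup E₁] [NormedSpace ℝ E₁] [FiniteDimensional ℝ E₁]
  [NormedAddCommGroup E₂] [NormedSpace ℝ E₂] [FiniteDimensional ℝ E₂]
  {M : Type*} [TopologicalSpace M] [ChartedSpace E M] [IsManifold 𝓘(ℝ, E) ∞ M]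
  {B₁ : Type*} [TopologicalSpace B₁] [ChartedSpace E₁ B₁] [IsManifold 𝓘(ℝ, E₁) ∞ B₁]
  {B₂ : Type*} [TopologicalSpace B₂] [ChartedSpace E₂ B₂] [IsManifold 𝓘(ℝ, E₂) ∞ B₂]

set_option linter.unusedSectionVars false

variable (E₁ E₂) in
/-- The pointwise content of the hypotheses on a Darboux integrable system with a Darboux
projection, in a form that is symmetric in `F` and `G`. -/
structure IsDarbouxSplit (F G : (x : M) → Submodule ℝ (TangentSpace 𝓘(ℝ, E) x)) (k l : ℕ)
    (π₁ : M → B₁) (π₂ : M → B₂) : Prop where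
  distF : IsDistribution F k
  distG : IsDistribution G l
  bracket_mem : ∀ (U : Opens M), ∀ X ∈ sections F U, ∀ Y ∈ sections G U, ∀ x ∈ U,
    (⁅X, Y⁆ : VecField E U).1 x ∈ F x ⊔ G x
  smooth₁ : ContMDiff 𝓘(ℝ, E) 𝓘(ℝ, E₁) ∞ π₁
  smooth₂ : ContMDiff 𝓘(ℝ, E) 𝓘(ℝ, E₂) ∞ π₂
  completionF : ∀ x v, v ∈ completion F x ↔ mfderiv 𝓘(ℝ, E) 𝓘(ℝ, E₂) π₂ x v = 0
  completionG : ∀ x v, v ∈ completion G x ↔ mfderiv 𝓘(ℝ, E) 𝓘(ℝ, E₁) π₁ x v = 0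
  injF : ∀ x, ∀ v ∈ F x, mfderiv 𝓘(ℝ, E) 𝓘(ℝ, E₁) π₁ x v = 0 → v = 0
  injG : ∀ x, ∀ v ∈ G x, mfderiv 𝓘(ℝ, E) 𝓘(ℝ, E₂) π₂ x v = 0 → v = 0
  finrank₁ : Module.finrank ℝ E₁ = k
  finrank₂ : Module.finrank ℝ E₂ = l

theorem IsDistribution.injOn_and_finrank_eq {F G : (x : M) → Submodule ℝ (TangentSpace 𝓘(ℝ, E) x)}
    {k l : ℕ} (hF : IsDistribution F k) (hG : IsDistribution G l) (hnG : HasNumInvariants G k)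
    {π₁ : M → B₁} (hπ₁ : IsFoliationProjection E₁ G π₁)
    (hJ : ∀ x, ∃ U : Opens M, x ∈ U ∧ ∃ J : Fin k → M → ℝ, IndependentInvariants G U J ∧
      ∀ c : Fin k → ℝ, (∀ v ∈ F x, ∑ j, c j * mvfderiv 𝓘(ℝ, E) (J j) x v = 0) → c = 0) (x : M) :
    (∀ v ∈ F x, mfderiv 𝓘(ℝ, E) 𝓘(ℝ, E₁) π₁ x v = 0 → v = 0) ∧ Module.finrank ℝ E₁ = k := by
  have h1 : ∀ v ∈ F x, mfderiv 𝓘(ℝ, E) 𝓘(ℝ, E₁) π₁ x v = 0 → v = 0 := by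
    intro v hv hv0
    obtain ⟨U, hx, J, hJ, hnd⟩ := hJ x
    refine eq_zero_of_mem_completion hF hJ hx hnd hv ?_
    rw [← hπ₁.ker_eq]
    exact hv0
  refine ⟨h1, le_antisymm (finrank_le_of_hasNumInvariants hnG hG hπ₁ x) ?_⟩
  have : FiniteDimensional ℝ (TangentSpace 𝓘(ℝ, E₁) (π₁ x)) :=
    inferInstanceAs (FiniteDimensional ℝ E₁)
  have h2 := LinearMap.finrank_le_finrank_of_injective
    (f := (mfderiv 𝓘(ℝ, E) 𝓘(ℝ, E₁) π₁ x).toLinearMap.comp (F x).subtype) (by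
      rw [injective_iff_map_eq_zero]
      rintro ⟨v, hv⟩ hv0
      exact Subtype.ext (h1 v hv hv0))
  rw [hF.finrank_eq x] at h2
  exact h2

theorem IsDarbouxProjection.isDarbouxSplit
    {F G : (x : M) → Submodule ℝ (TangentSpace 𝓘(ℝ, E) x)} {k l : ℕ}
    (hFG : IsDecomposable F G k l) (hD : IsDarbouxIntegrable F G k l)
    (hnF : HasNumInvariants F l) (hnG : HasNumInvariants G k) {π₁ : M → B₁} {π₂ : M → B₂}
    (hπ : IsDarbouxProjection E₁ E₂ F G π₁ π₂) (m : M) : IsDarbouxSplit E₁ E₂ F G k l π₁ π₂ := by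
  have hs : ∀ (A : (x : M) → Submodule ℝ (TangentSpace 𝓘(ℝ, E) x)) (n : ℕ) (U : Opens M) (x : M)
      (J : Fin n → M → ℝ), IndependentInvariants A U J → x ∈ U →
      ∀ (D : (x : M) → Submodule ℝ (TangentSpace 𝓘(ℝ, E) x))
      (S : Set (TangentSpace 𝓘(ℝ, E) x →L[ℝ] ℝ)), (range fun j => mvfderiv 𝓘(ℝ, E) (J j) x) ⊆ S →
      (∀ α ∈ Submodule.span ℝ S, (∀ v ∈ D x ⊔ A x, α v = 0) → α = 0) →
      ∀ c : Fin n → ℝ, (∀ v ∈ D x, ∑ j, c j * mvfderiv 𝓘(ℝ, E) (J j) x v = 0) → c = 0 := by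
    intro A n U x J hJ hx D S hJS hnd c hc
    have h0 := hnd (∑ j, c j • mvfderiv 𝓘(ℝ, E) (J j) x)
      (Submodule.sum_mem _ fun j _ => Submodule.smul_mem _ _
        (Submodule.subset_span (hJS ⟨j, rfl⟩))) (fun v hv => by
        obtain ⟨a, ha, b, hb, rfl⟩ := Submodule.mem_sup.1 hv
        rw [map_add]
        have h1 : (∑ j, c j • mvfderiv 𝓘(ℝ, E) (J j) x) a = 0 := by
          simpa [sum_apply] using hc a ha
        have h2 : (∑ j, c j • mvfderiv 𝓘(ℝ, E) (J j) x) b = 0 := by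
          rw [sum_apply]
          exact Finset.sum_eq_zero fun j _ => by
            rw [smul_apply, hJ.invariant j x hx b hb, smul_zero]
        rw [h1, h2, add_zero])
    funext j
    exact Fintype.linearIndependent_iff.1 (hJ.independent x hx) c h0 j
  have h1 := IsDistribution.injOn_and_finrank_eq hFG.distF hFG.distG hnG hπ.fst fun x => by
    obtain ⟨U, hx, I, J, hI, hJ, hnd⟩ := hD x
    exact ⟨U, hx, J, hJ, hs G k U x J hJ hx F _ subset_union_right (hnd x hx)⟩
  have h2 := IsDistribution.injOn_and_finrank_eq hFG.distG hFG.distF hnF hπ.snd fun x => by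
    obtain ⟨U, hx, I, J, hI, hJ, hnd⟩ := hD x
    refine ⟨U, hx, I, hI, hs F l U x I hI hx G _ subset_union_left fun α hα h =>
      hnd x hx α hα ?_⟩
    rwa [sup_comm]
  exact
    { distF := hFG.distF
      distG := hFG.distG
      bracket_mem := hFG.bracket_mem
      smooth₁ := hπ.fst.smooth
      smooth₂ := hπ.snd.smooth
      completionF := fun x v => by rw [← hπ.snd.ker_eq]; rfl
      completionG := fun x v => by rw [← hπ.fst.ker_eq]; rfl
      injF := fun x => (h1 x).1
      injG := fun x => (h2 x).1
      finrank₁ := (h1 m).2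
      finrank₂ := (h2 m).2 }

namespace IsDarbouxSplit

variable {F G : (x : M) → Submodule ℝ (TangentSpace 𝓘(ℝ, E) x)} {k l : ℕ}
  {π₁ : M → B₁} {π₂ : M → B₂}

theorem symm (h : IsDarbouxSplit E₁ E₂ F G k l π₁ π₂) : IsDarbouxSplit E₂ E₁ G F l k π₂ π₁ where
  distF := h.distG
  distG := h.distF
  bracket_mem U X hX Y hY x hx := by
    rw [← lie_skew, sup_comm]
    exact Submodule.neg_mem _ (h.bracket_mem U Y hY X hX x hx)
  smooth₁ := h.smooth₂
  smooth₂ := h.smooth₁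
  completionF := h.completionG
  completionG := h.completionF
  injF := h.injG
  injG := h.injF
  finrank₁ := h.finrank₂
  finrank₂ := h.finrank₁

theorem mfderiv_eq_zero (h : IsDarbouxSplit E₁ E₂ F G k l π₁ π₂) {x : M}
    {v : TangentSpace 𝓘(ℝ, E) x} (hv : v ∈ F x) : mfderiv 𝓘(ℝ, E) 𝓘(ℝ, E₂) π₂ x v = 0 :=
  (h.completionF x v).1 (h.distF.le_completion x hv)

theorem exists_mem_mfderiv_eq (h : IsDarbouxSplit E₁ E₂ F G k l π₁ π₂) (x : M)
    (a : TangentSpace 𝓘(ℝ, E₁) (π₁ x)) : ∃ v ∈ F x, mfderiv 𝓘(ℝ, E) 𝓘(ℝ, E₁) π₁ x v = a := by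
  have : FiniteDimensional ℝ (TangentSpace 𝓘(ℝ, E₁) (π₁ x)) :=
    inferInstanceAs (FiniteDimensional ℝ E₁)
  have : FiniteDimensional ℝ (TangentSpace 𝓘(ℝ, E) x) := inferInstanceAs (FiniteDimensional ℝ E)
  have h1 : Function.Injective
      ((mfderiv 𝓘(ℝ, E) 𝓘(ℝ, E₁) π₁ x).toLinearMap.comp (F x).subtype) := by
    rw [injective_iff_map_eq_zero]
    rintro ⟨v, hv⟩ hv0
    exact Subtype.ext (h.injF x v hv hv0)
  obtain ⟨v, hv⟩ := (LinearMap.injective_iff_surjective_of_finrank_eq_finrank (by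
    rw [h.distF.finrank_eq x]
    exact h.finrank₁.symm)).1 h1 a
  exact ⟨v, v.2, hv⟩

theorem exists_mfderiv_eq (h : IsDarbouxSplit E₁ E₂ F G k l π₁ π₂) (x : M)
    (a : TangentSpace 𝓘(ℝ, E₁) (π₁ x)) (b : TangentSpace 𝓘(ℝ, E₂) (π₂ x)) :
    ∃ v, mfderiv 𝓘(ℝ, E) 𝓘(ℝ, E₁) π₁ x v = a ∧ mfderiv 𝓘(ℝ, E) 𝓘(ℝ, E₂) π₂ x v = b := by
  obtain ⟨v, hv, rfl⟩ := h.exists_mem_mfderiv_eq x a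
  obtain ⟨w, hw, rfl⟩ := h.symm.exists_mem_mfderiv_eq x b
  refine ⟨v + w, ?_, ?_⟩
  · rw [map_add, h.symm.mfderiv_eq_zero hw, add_zero]
  · rw [map_add, h.mfderiv_eq_zero hv, zero_add]

end IsDarbouxSplit

end Darboux

section Lifts

variable {E E₁ E₂ : Type*}
  [NormedAddCommGroup E] [NormedSpace ℝ E] [FiniteDimensional ℝ E]
  [NormedAddCommGroup E₁] [NormedSpace ℝ E₁] [FiniteDimensional ℝ E₁]
  [NormedAddCommGroup E₂] [NormedSpace ℝ E₂] [FiniteDimensional ℝ E₂]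
  {M : Type*} [TopologicalSpace M] [ChartedSpace E M] [IsManifold 𝓘(ℝ, E) ∞ M]
  {B₁ : Type*} [TopologicalSpace B₁] [ChartedSpace E₁ B₁] [IsManifold 𝓘(ℝ, E₁) ∞ B₁]
  {B₂ : Type*} [TopologicalSpace B₂] [ChartedSpace E₂ B₂] [IsManifold 𝓘(ℝ, E₂) ∞ B₂]
  {F G : (x : M) → Submodule ℝ (TangentSpace 𝓘(ℝ, E) x)} {k l : ℕ}
  {π₁ : M → B₁} {π₂ : M → B₂} {U : Opens M}

set_option linter.unusedSectionVars false

theorem IsLiftedCommutingFrame.sup_swap {Φ : Fin k → VecField E U}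
    (hΦ : IsLiftedCommutingFrame E₁ E₂ F G π₁ π₂ Φ) : IsLiftedCommutingFrame E₁ E₂ G F π₁ π₂ Φ := by
  obtain ⟨W, hW, Ψ, h1, h2, h3⟩ := hΦ
  exact ⟨W, hW, Ψ, h1, h2, fun i x hx => by rw [sup_comm]; exact h3 i x hx⟩

theorem IsLiftedCommutingFrame.restrict {Φ : Fin k → VecField E U}
    (hΦ : IsLiftedCommutingFrame E₁ E₂ F G π₁ π₂ Φ) {V : Opens M} (hV : V ≤ U) :
    IsLiftedCommutingFrame E₁ E₂ F G π₁ π₂ fun i => VecField.restrict hV (Φ i) := by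
  obtain ⟨W, hW, Ψ, h1, h2, h3⟩ := hΦ
  refine ⟨W, fun x hx => hW x (hV hx), Ψ, h1, h2, fun i x hx => ?_⟩
  rw [VecField.restrict_apply hV _ hx]
  exact h3 i x (hV hx)

namespace IsDarbouxSplit

variable (h : IsDarbouxSplit E₁ E₂ F G k l π₁ π₂)
include h

theorem lift_mem {Φ : Fin k → VecField E U} (hΦ : IsLiftedCommutingFrame E₁ E₂ F G π₁ π₂ Φ)
    (i : Fin k) : Φ i ∈ sections F U := by
  intro x hx
  obtain ⟨W, -, Ψ, -, -, h3⟩ := hΦ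
  obtain ⟨h4, -, h5⟩ := h3 i x hx
  obtain ⟨a, ha, b, hb, hab⟩ := Submodule.mem_sup.1 h4
  rw [← hab, map_add, h.mfderiv_eq_zero ha, zero_add] at h5
  rw [← hab, h.injG x b hb h5, add_zero]
  exact ha

theorem lift_linearIndependent {Φ : Fin k → VecField E U}
    (hΦ : IsLiftedCommutingFrame E₁ E₂ F G π₁ π₂ Φ) {x : M} (hx : x ∈ U) :
    LinearIndependent ℝ fun i => (Φ i).1 x := by
  obtain ⟨W, hW, Ψ, -, h2, h3⟩ := hΦ
  refine LinearIndependent.of_comp (mfderiv 𝓘(ℝ, E) 𝓘(ℝ, E₁) π₁ x).toLinearMap ?_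
  have h4 : ((mfderiv 𝓘(ℝ, E) 𝓘(ℝ, E₁) π₁ x).toLinearMap ∘ fun i => (Φ i).1 x) =
      fun i => (Ψ i).1 (π₁ x) := by
    funext i
    exact (h3 i x hx).2.1
  rw [h4]
  exact (h2 _ (hW x hx)).1

theorem lift_span {Φ : Fin k → VecField E U}
    (hΦ : IsLiftedCommutingFrame E₁ E₂ F G π₁ π₂ Φ) {x : M} (hx : x ∈ U) :
    Submodule.span ℝ (range fun i => (Φ i).1 x) = F x := by
  have : FiniteDimensional ℝ (TangentSpace 𝓘(ℝ, E) x) := inferInstanceAs (FiniteDimensional ℝ E)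
  refine Submodule.eq_of_le_of_finrank_eq (Submodule.span_le.2 ?_) ?_
  · rintro _ ⟨i, rfl⟩
    exact h.lift_mem hΦ i x hx
  · rw [finrank_span_eq_card (h.lift_linearIndependent hΦ hx), Fintype.card_fin,
      h.distF.finrank_eq x]

theorem exists_mfderiv_eq_of_mem_lieSpan {Φ : Fin k → VecField E U}
    (hΦ : IsLiftedCommutingFrame E₁ E₂ F G π₁ π₂ Φ) :
    ∃ W : Opens B₁, (∀ x ∈ U, π₁ x ∈ W) ∧ ∃ 𝔥 : LieSubalgebra ℝ (VecField E₁ W),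
      (∀ X ∈ 𝔥, ∀ Y ∈ 𝔥, ⁅X, Y⁆ = 0) ∧
      ∀ X ∈ LieSubalgebra.lieSpan ℝ (VecField E U) (range Φ), ∃ X' ∈ 𝔥, ∀ x ∈ U,
        mfderiv 𝓘(ℝ, E) 𝓘(ℝ, E₁) π₁ x (X.1 x) = X'.1 (π₁ x) := by
  obtain ⟨W, hW, Ψ, h1, -, h3⟩ := hΦ
  have hab : ∀ X ∈ Submodule.span ℝ (range Ψ), ∀ Y ∈ Submodule.span ℝ (range Ψ), ⁅X, Y⁆ = 0 := by
    intro X hX Y hY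
    refine Submodule.span_induction₂ (p := fun A B _ _ => ⁅A, B⁆ = 0)
          ?_ ?_ ?_ ?_ ?_ ?_ ?_ hX hY
    · rintro _ _ ⟨i, rfl⟩ ⟨j, rfl⟩
      exact h1 i j
    · intro A _
      exact zero_lie A
    · intro A _
      exact lie_zero A
    · intro A B C _ _ _ e1 e2
      rw [add_lie, e1, e2, add_zero]
    · intro A B C _ _ _ e1 e2
      rw [lie_add, e1, e2, add_zero]
    · intro c A B _ _ e1
      rw [smul_lie, e1, smul_zero]
    · intro c A B _ _ e1
      rw [lie_smul, e1, smul_zero]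
  let 𝔥 : LieSubalgebra ℝ (VecField E₁ W) :=
    { Submodule.span ℝ (range Ψ) with
      lie_mem' := fun {X Y} hX hY => by
        change ⁅X, Y⁆ ∈ Submodule.span ℝ (range Ψ)
        rw [hab X hX Y hY]
        exact Submodule.zero_mem _ }
  let N : LieSubalgebra ℝ (VecField E U) :=
    { carrier := {X | ∃ X' ∈ 𝔥, ∀ x ∈ U, mfderiv 𝓘(ℝ, E) 𝓘(ℝ, E₁) π₁ x (X.1 x) = X'.1 (π₁ x)}
      add_mem' := by
        rintro X Y ⟨X', hX', hX⟩ ⟨Y', hY', hY⟩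
        refine ⟨X' + Y', 𝔥.add_mem hX' hY', fun x hx => ?_⟩
        rw [← VecField.eval_apply (X + Y), ← VecField.eval_apply (X' + Y'), map_add, map_add,
          map_add, VecField.eval_apply, VecField.eval_apply, VecField.eval_apply,
          VecField.eval_apply, hX x hx, hY x hx]
      zero_mem' := ⟨0, 𝔥.zero_mem, fun x _ => map_zero _⟩
      smul_mem' := by
        rintro c X ⟨X', hX', hX⟩
        refine ⟨c • X', 𝔥.smul_mem c hX', fun x hx => ?_⟩
        rw [← VecField.eval_apply (c • X), ← VecField.eval_apply (c • X'), map_smul, map_smul,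
          map_smul, VecField.eval_apply, VecField.eval_apply, hX x hx]
      lie_mem' := by
        rintro X Y ⟨X', hX', hX⟩ ⟨Y', hY', hY⟩
        exact ⟨⁅X', Y'⁆, 𝔥.lie_mem hX' hY', VecField.lie_related h.smooth₁ hW hX hY⟩ }
  have hN : LieSubalgebra.lieSpan ℝ (VecField E U) (range Φ) ≤ N := by
    refine LieSubalgebra.lieSpan_le.2 ?_
    rintro _ ⟨i, rfl⟩
    exact ⟨Ψ i, Submodule.subset_span (mem_range_self i), fun x hx => (h3 i x hx).2.1⟩
  exact ⟨W, hW, 𝔥, hab, fun X hX => hN hX⟩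

theorem mfderiv_snd_of_mem_lieSpan {Φ : Fin k → VecField E U}
    (hΦ : IsLiftedCommutingFrame E₁ E₂ F G π₁ π₂ Φ) {X : VecField E U}
    (hX : X ∈ LieSubalgebra.lieSpan ℝ (VecField E U) (range Φ)) {x : M} (hx : x ∈ U) :
    mfderiv 𝓘(ℝ, E) 𝓘(ℝ, E₂) π₂ x (X.1 x) = 0 := by
  rw [← h.completionF]
  refine Submodule.subset_span ⟨U, hx, X, ?_, rfl⟩
  refine LieSubalgebra.lieSpan_mono ?_ hX
  rintro _ ⟨i, rfl⟩
  exact h.lift_mem hΦ i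

theorem isTangential_of_mem_derived {Φ : Fin k → VecField E U}
    (hΦ : IsLiftedCommutingFrame E₁ E₂ F G π₁ π₂ Φ) {Z : VecField E U}
    (hZ : Z ∈ derivedOfGenerated Φ) : IsTangential E₁ E₂ π₁ π₂ Z := by
  intro x hx
  let K : Submodule ℝ (TangentSpace 𝓘(ℝ, E) x) :=
    LinearMap.ker (mfderiv 𝓘(ℝ, E) 𝓘(ℝ, E₁) π₁ x).toLinearMap ⊓
      LinearMap.ker (mfderiv 𝓘(ℝ, E) 𝓘(ℝ, E₂) π₂ x).toLinearMap
  have hle : derivedOfGenerated Φ ≤ K.comap (VecField.eval U x) := by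
    refine Submodule.span_le.2 ?_
    rintro _ ⟨X, hX, Y, hY, rfl⟩
    refine ⟨?_, h.mfderiv_snd_of_mem_lieSpan hΦ (LieSubalgebra.lie_mem _ hX hY) hx⟩
    obtain ⟨W, hW, 𝔥, hab, h𝔥⟩ := h.exists_mfderiv_eq_of_mem_lieSpan hΦ
    obtain ⟨X', hX', hXX⟩ := h𝔥 X hX
    obtain ⟨Y', hY', hYY⟩ := h𝔥 Y hY
    have h1 := VecField.lie_related h.smooth₁ hW hXX hYY x hx
    rw [hab X' hX' Y' hY'] at h1
    exact h1
  exact hle hZ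

theorem mem_lieSpan_of_mem_derived {Φ : Fin k → VecField E U} {Z : VecField E U}
    (hZ : Z ∈ derivedOfGenerated Φ) : Z ∈ LieSubalgebra.lieSpan ℝ (VecField E U) (range Φ) := by
  have hle : derivedOfGenerated Φ ≤
      (LieSubalgebra.lieSpan ℝ (VecField E U) (range Φ)).toSubmodule := by
    refine Submodule.span_le.2 ?_
    rintro _ ⟨X, hX, Y, hY, rfl⟩
    exact LieSubalgebra.lie_mem _ hX hY
  exact hle hZ

theorem exists_mem_lieSpan {Φ : Fin k → VecField E U}
    (hΦ : IsLiftedCommutingFrame E₁ E₂ F G π₁ π₂ Φ) {x : M} (hx : x ∈ U)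
    {v : TangentSpace 𝓘(ℝ, E) x} (hv : mfderiv 𝓘(ℝ, E) 𝓘(ℝ, E₂) π₂ x v = 0) :
    ∃ A ∈ LieSubalgebra.lieSpan ℝ (VecField E U) (range Φ), A.1 x = v :=
  exists_mem_lieSpan_of_mem_completion (fun _ hy => h.lift_linearIndependent hΦ hy)
    (fun _ hy => h.lift_span hΦ hy) hx ((h.completionF x v).2 hv)

theorem exists_mem_derived {Φ : Fin k → VecField E U}
    (hΦ : IsLiftedCommutingFrame E₁ E₂ F G π₁ π₂ Φ) {x : M} (hx : x ∈ U)
    {v : TangentSpace 𝓘(ℝ, E) x} (hv₁ : mfderiv 𝓘(ℝ, E) 𝓘(ℝ, E₁) π₁ x v = 0)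
    (hv₂ : mfderiv 𝓘(ℝ, E) 𝓘(ℝ, E₂) π₂ x v = 0) : ∃ Z ∈ derivedOfGenerated Φ, Z.1 x = v := by
  set 𝔣 := LieSubalgebra.lieSpan ℝ (VecField E U) (range Φ) with h𝔣
  let N : LieSubalgebra ℝ (VecField E U) :=
    { 𝔣.toSubmodule ⊓ (Submodule.span ℝ (range Φ) ⊔ derivedOfGenerated Φ) with
      lie_mem' := fun {X Y} hX hY =>
        ⟨𝔣.lie_mem hX.1 hY.1, Submodule.mem_sup_right
          (Submodule.subset_span ⟨X, hX.1, Y, hY.1, rfl⟩)⟩ }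
  have hN : 𝔣 ≤ N := by
    refine LieSubalgebra.lieSpan_le.2 ?_
    rintro _ ⟨i, rfl⟩
    exact ⟨LieSubalgebra.subset_lieSpan (mem_range_self i),
      Submodule.mem_sup_left (Submodule.subset_span (mem_range_self i))⟩
  obtain ⟨A, hA, rfl⟩ := h.exists_mem_lieSpan hΦ hx hv₂
  obtain ⟨C, hC, Z, hZ, rfl⟩ := Submodule.mem_sup.1 (hN hA).2
  refine ⟨Z, hZ, ?_⟩
  rw [Submodule.mem_span_range_iff_exists_fun] at hC
  obtain ⟨c, rfl⟩ := hC
  rw [← VecField.eval_apply (_ + Z), map_add, VecField.eval_apply, VecField.eval_apply] at hv₁ ⊢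
  rw [map_add, (h.isTangential_of_mem_derived hΦ hZ x hx).1, add_zero] at hv₁
  have h0 : (∑ i, c i • Φ i).1 x = 0 := by
    refine h.injF x _ ?_ hv₁
    rw [VecField.sum_apply]
    exact Submodule.sum_mem _ fun i _ => Submodule.smul_mem _ _ (h.lift_mem hΦ i x hx)
  rw [h0, zero_add]

theorem lie_lift_eq_zero {Φ : Fin k → VecField E U} {Γ : Fin l → VecField E U}
    (hΦ : IsLiftedCommutingFrame E₁ E₂ F G π₁ π₂ Φ)
    (hΓ : IsLiftedCommutingFrame E₂ E₁ F G π₂ π₁ Γ) (i : Fin k) (j : Fin l) : ⁅Φ i, Γ j⁆ = 0 := by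
  have hF := h.lift_mem hΦ i
  have hG := h.symm.lift_mem hΓ.sup_swap j
  refine VecField.ext fun x hx => ?_
  obtain ⟨a, ha, b, hb, hab⟩ := Submodule.mem_sup.1 (h.bracket_mem U _ hF _ hG x hx)
  obtain ⟨W, hW, Ψ, -, -, h3⟩ := hΦ
  obtain ⟨W', hW', Ψ', -, -, h3'⟩ := hΓ
  have e1 := VecField.lie_related h.smooth₁ hW (X := Φ i) (Y := Γ j) (X' := Ψ i) (Y' := 0)
    (fun x hx => (h3 i x hx).2.1) (fun x hx => (h3' j x hx).2.2) x hx
  have e2 := VecField.lie_related h.smooth₂ hW' (X := Φ i) (Y := Γ j) (X' := 0) (Y' := Ψ' j)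
    (fun x hx => (h3 i x hx).2.2) (fun x hx => (h3' j x hx).2.1) x hx
  rw [lie_zero] at e1
  rw [zero_lie] at e2
  have e1' : mfderiv 𝓘(ℝ, E) 𝓘(ℝ, E₁) π₁ x (⁅Φ i, Γ j⁆.1 x) = 0 := e1
  have e2' : mfderiv 𝓘(ℝ, E) 𝓘(ℝ, E₂) π₂ x (⁅Φ i, Γ j⁆.1 x) = 0 := e2
  rw [← hab, map_add, h.symm.mfderiv_eq_zero hb, add_zero] at e1'
  rw [← hab, map_add, h.mfderiv_eq_zero ha, zero_add] at e2'
  rw [← hab, h.injF x a ha e1', h.injG x b hb e2', add_zero]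
  rfl

theorem lie_eq_zero_of_mem_lieSpan {Φ : Fin k → VecField E U} {Γ : Fin l → VecField E U}
    (hΦ : IsLiftedCommutingFrame E₁ E₂ F G π₁ π₂ Φ)
    (hΓ : IsLiftedCommutingFrame E₂ E₁ F G π₂ π₁ Γ) {X Y : VecField E U}
    (hX : X ∈ LieSubalgebra.lieSpan ℝ (VecField E U) (range Φ))
    (hY : Y ∈ LieSubalgebra.lieSpan ℝ (VecField E U) (range Γ)) : ⁅X, Y⁆ = 0 := by
  have hcent : ∀ (S : Set (VecField E U)) (A : VecField E U), (∀ B ∈ S, ⁅A, B⁆ = 0) →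
      ∀ B ∈ LieSubalgebra.lieSpan ℝ (VecField E U) S, ⁅A, B⁆ = 0 := by
    intro S A hA
    let N : LieSubalgebra ℝ (VecField E U) :=
      { LinearMap.ker (LieAlgebra.ad ℝ (VecField E U) A) with
        lie_mem' := fun {B C} hB hC => by
          have hB' : ⁅A, B⁆ = 0 := hB
          have hC' : ⁅A, C⁆ = 0 := hC
          change ⁅A, ⁅B, C⁆⁆ = 0
          rw [leibniz_lie, hB', hC', zero_lie, lie_zero, add_zero] }
    have : LieSubalgebra.lieSpan ℝ (VecField E U) S ≤ N := LieSubalgebra.lieSpan_le.2 hA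
    exact fun B hB => this hB
  refine hcent _ X ?_ Y hY
  rintro _ ⟨j, rfl⟩
  rw [← lie_skew, neg_eq_zero]
  refine hcent _ (Γ j) ?_ X hX
  rintro _ ⟨i, rfl⟩
  rw [← lie_skew, h.lie_lift_eq_zero hΦ hΓ, neg_zero]

end IsDarbouxSplit

end Lifts

section Existence

variable {E E₁ E₂ : Type*}
  [NormedAddCommGroup E] [NormedSpace ℝ E] [FiniteDimensional ℝ E]
  [NormedAddCommGroup E₁] [NormedSpace ℝ E₁] [FiniteDimensional ℝ E₁]
  [NormedAddCommGroup E₂] [NormedSpace ℝ E₂] [FiniteDimensional ℝ E₂]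
  {M : Type*} [TopologicalSpace M] [ChartedSpace E M] [IsManifold 𝓘(ℝ, E) ∞ M]
  {B₁ : Type*} [TopologicalSpace B₁] [ChartedSpace E₁ B₁] [IsManifold 𝓘(ℝ, E₁) ∞ B₁]
  {B₂ : Type*} [TopologicalSpace B₂] [ChartedSpace E₂ B₂] [IsManifold 𝓘(ℝ, E₂) ∞ B₂]

set_option linter.unusedSectionVars false

/-- The domain of the preferred chart at `m`. -/
def chartDomain (E : Type*) [NormedAddCommGroup E] [NormedSpace ℝ E] {M : Type*}
    [TopologicalSpace M] [ChartedSpace E M] (m : M) : Opens M :=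
  ⟨(chartAt E m).source, (chartAt E m).open_source⟩

/-- The coordinate vector fields of a chart. -/
theorem exists_coordinate_frame (m : M) {ι : Type*} (b : Module.Basis ι ℝ E) :
    ∃ Ψ : ι → VecField E (chartDomain E m),
      (∀ i, ∀ x ∈ chartDomain E m, mfderiv 𝓘(ℝ, E) 𝓘(ℝ, E) (chartAt E m) x ((Ψ i).1 x) = b i) ∧
      (∀ i j, ⁅Ψ i, Ψ j⁆ = 0) ∧
      ∀ x ∈ chartDomain E m, LinearIndependent ℝ (fun i => (Ψ i).1 x) ∧
        Submodule.span ℝ (range fun i => (Ψ i).1 x) = ⊤ := by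
  let e := trivializationAt E (TangentSpace 𝓘(ℝ, E) (M := M)) m
  have he : ∀ x ∈ chartDomain E m, x ∈ e.baseSet := fun x hx => by
    rw [TangentBundle.trivializationAt_baseSet]
    exact hx
  let Ψ : ι → VecField E (chartDomain E m) := fun i =>
    VecField.mkOn _ (e.localFrame b i) fun x hx =>
      contMDiffAt_localFrame_of_mem ∞ e b i (he x hx)
  have hΨ : ∀ i x (hx : x ∈ chartDomain E m), (Ψ i).1 x = e.basisAt b (he x hx) i := by
    intro i x hx
    rw [VecField.mkOn_apply _ hx, e.localFrame_apply_of_mem_baseSet b (he x hx)]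
  have hd : ∀ i, ∀ x ∈ chartDomain E m,
      mfderiv 𝓘(ℝ, E) 𝓘(ℝ, E) (chartAt E m) x ((Ψ i).1 x) = b i := by
    intro i x hx
    have h1 := TangentBundle.continuousLinearMapAt_trivializationAt (I := 𝓘(ℝ, E)) (x₀ := m) hx
    have h2 : e.continuousLinearMapAt ℝ x ((Ψ i).1 x) = b i := by
      rw [hΨ i x hx]
      simp [Bundle.Trivialization.basisAt, he x hx]
    rw [← h2]
    exact (congrArg (fun A => A ((Ψ i).1 x)) h1).symm
  refine ⟨Ψ, hd, fun i j => VecField.ext fun x hx => ?_, fun x hx => ?_⟩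
  · refine ((mdifferentiable_chart (I := 𝓘(ℝ, E)) m).mfderiv_bijective hx).1 ?_
    refine (SeparatingDual.eq_iff_forall_dual_eq (R := ℝ) (V := E)).2 fun ℓ => ?_
    have h0 : ∀ i v, mvfderiv 𝓘(ℝ, E)
        (fun y => mvfderiv 𝓘(ℝ, E) (fun y => ℓ (chartAt E m y)) y ((Ψ i).1 y)) x v = 0 := by
      intro i v
      have h1 : (fun y => mvfderiv 𝓘(ℝ, E) (fun y => ℓ (chartAt E m y)) y ((Ψ i).1 y)) =ᶠ[𝓝 x]
          fun _ => ℓ (b i) := by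
        filter_upwards [(chartDomain E m).isOpen.mem_nhds hx] with y hy
        rw [mvfderiv_clm_comp_chart ℓ m hy]
        exact congrArg ℓ (hd i y hy)
      refine (congrArg (fun A => A v) (h1.mfderiv_eq (I := 𝓘(ℝ, E)) (I' := 𝓘(ℝ, ℝ)))).trans ?_
      rw [mfderiv_const]
      rfl
    have h2 := VecField.mvfderiv_lie (Ψ i) (Ψ j) hx (contMDiffAt_clm_comp_chart ℓ m hx)
    rw [h0, h0, sub_zero, mvfderiv_clm_comp_chart ℓ m hx] at h2
    refine Eq.trans h2 ?_
    rw [← map_zero ℓ]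
    exact congrArg ℓ (map_zero _).symm
  · have h1 : (fun i => (Ψ i).1 x) = e.basisAt b (he x hx) := funext fun i => hΨ i x hx
    rw [h1]
    exact ⟨(e.basisAt b (he x hx)).linearIndependent, (e.basisAt b (he x hx)).span_eq⟩

theorem IsDarbouxSplit.exists_lift {F G : (x : M) → Submodule ℝ (TangentSpace 𝓘(ℝ, E) x)} {k l : ℕ}
    {π₁ : M → B₁} {π₂ : M → B₂} (h : IsDarbouxSplit E₁ E₂ F G k l π₁ π₂) (m : M) :
    ∃ U : Opens M, m ∈ U ∧
      ∃ Φ : Fin k → VecField E U, IsLiftedCommutingFrame E₁ E₂ F G π₁ π₂ Φ := by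
  let b : Module.Basis (Fin k) ℝ E₁ := Module.finBasisOfFinrankEq ℝ E₁ h.finrank₁
  obtain ⟨Ψ, hΨ, hcomm, hframe⟩ := exists_coordinate_frame (π₁ m) b
  obtain ⟨N, hmN, X, hX⟩ := h.distF m
  let U : Opens M := N ⊓ ⟨π₁ ⁻¹' (chartDomain E₁ (π₁ m)),
    (chartDomain E₁ (π₁ m)).isOpen.preimage h.smooth₁.continuous⟩
  have hUN : ∀ y ∈ U, y ∈ N := fun y hy => hy.1
  have hUW : ∀ y ∈ U, π₁ y ∈ chartDomain E₁ (π₁ m) := fun y hy => hy.2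
  let f : M → E₁ := fun y => chartAt E₁ (π₁ m) (π₁ y)
  have hf : ∀ y ∈ U, ContMDiffAt 𝓘(ℝ, E) 𝓘(ℝ, E₁) ∞ f y := fun y hy =>
    ((contMDiffOn_chart (I := 𝓘(ℝ, E₁)) _ (hUW y hy)).contMDiffAt
      ((chartAt E₁ (π₁ m)).open_source.mem_nhds (hUW y hy))).comp y h.smooth₁.contMDiffAt
  have hbij : ∀ y ∈ U, Function.Bijective
      (mfderiv 𝓘(ℝ, E₁) 𝓘(ℝ, E₁) (chartAt E₁ (π₁ m)) (π₁ y)) := fun y hy =>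
    (mdifferentiable_chart (I := 𝓘(ℝ, E₁)) (π₁ m)).mfderiv_bijective (hUW y hy)
  have hdf : ∀ y ∈ U, ∀ v, mvfderiv 𝓘(ℝ, E) f y v =
      mfderiv 𝓘(ℝ, E₁) 𝓘(ℝ, E₁) (chartAt E₁ (π₁ m)) (π₁ y)
        (mfderiv 𝓘(ℝ, E) 𝓘(ℝ, E₁) π₁ y v) := fun y hy v =>
    mfderiv_comp_apply y
      ((mdifferentiable_chart (I := 𝓘(ℝ, E₁)) (π₁ m)).mdifferentiableAt (hUW y hy))
      (h.smooth₁.contMDiffAt.mdifferentiableAt (by simp)) v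
  let A : M → (Fin k → ℝ) →L[ℝ] E₁ := fun y =>
    ∑ i, (ContinuousLinearMap.proj (R := ℝ) (φ := fun _ : Fin k => ℝ) i).smulRight
      (mvfderiv 𝓘(ℝ, E) f y ((X i).1 y))
  have hA : ∀ y c, A y c = mvfderiv 𝓘(ℝ, E) f y (∑ i, c i • (X i).1 y) := by
    intro y c
    simp [A]
  have hAs : ∀ y ∈ U, ContMDiffAt 𝓘(ℝ, E) 𝓘(ℝ, (Fin k → ℝ) →L[ℝ] E₁) ∞ A y := by
    intro y hy
    refine ContMDiffAt.sum fun i _ => ?_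
    exact ((ContinuousLinearMap.smulRightL ℝ (Fin k → ℝ) E₁
      (ContinuousLinearMap.proj (R := ℝ) (φ := fun _ : Fin k => ℝ) i)).contMDiff.contMDiffAt).comp y
      (SmoothSectionAt.mvfderiv_apply (hf y hy) (VecField.smoothAt (X i) (hUN y hy)))
  have hXF : ∀ y ∈ U, ∀ c : Fin k → ℝ, ∑ i, c i • (X i).1 y ∈ F y := by
    intro y hy c
    rw [← (hX y (hUN y hy)).2]
    exact Submodule.sum_mem _ fun i _ => Submodule.smul_mem _ _ (Submodule.subset_span ⟨i, rfl⟩)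
  have hAe : ∀ y ∈ U, ∃ e : (Fin k → ℝ) ≃L[ℝ] E₁, (e : (Fin k → ℝ) →L[ℝ] E₁) = A y := by
    intro y hy
    have hinj : Function.Injective (A y).toLinearMap := by
      rw [injective_iff_map_eq_zero]
      intro c hc
      have h1 : mvfderiv 𝓘(ℝ, E) f y (∑ i, c i • (X i).1 y) = 0 := (hA y c).symm.trans hc
      rw [hdf y hy] at h1
      have h2 := h.injF y _ (hXF y hy c) ((hbij y hy).1 (h1.trans (map_zero _).symm))
      exact funext (Fintype.linearIndependent_iff.1 (hX y (hUN y hy)).1 c h2)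
    refine ⟨(LinearEquiv.ofInjectiveOfFinrankEq (A y).toLinearMap hinj (by
      rw [h.finrank₁, Module.finrank_fin_fun])).toContinuousLinearEquiv, ?_⟩
    ext c
    rfl
  have hs : ∀ i, ∀ y ∈ U,
      SmoothSectionAt (fun y => ∑ j, ((A y).inverse (b i)) j • (X j).1 y) y := by
    intro i y hy
    refine SmoothSectionAt.sum fun j _ =>
      SmoothSectionAt.smul ?_ (VecField.smoothAt (X j) (hUN y hy))
    obtain ⟨e, he⟩ := hAe y hy
    exact ((ContinuousLinearMap.proj (R := ℝ)
      (φ := fun _ : Fin k => ℝ) j).contMDiff.contMDiffAt).comp y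
      ((contMDiffAt_inverse (hAs y hy) e he).clm_apply contMDiffAt_const)
  refine ⟨U, ⟨hmN, mem_chart_source E₁ (π₁ m)⟩, fun i => VecField.mkOn U _ (hs i),
    chartDomain E₁ (π₁ m), hUW, Ψ, hcomm, hframe, fun i y hy => ?_⟩
  rw [VecField.mkOn_apply _ hy]
  refine ⟨Submodule.mem_sup_left (hXF y hy _), (hbij y hy).1 ?_, h.mfderiv_eq_zero (hXF y hy _)⟩
  rw [← hdf y hy, ← hA, hΨ i _ (hUW y hy)]
  obtain ⟨e, he⟩ := hAe y hy
  rw [← he, ContinuousLinearMap.inverse_equiv]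
  exact e.apply_symm_apply _

end Existence

section Vertical

variable {E E₁ E₂ : Type*}
  [NormedAddCommGroup E] [NormedSpace ℝ E] [FiniteDimensional ℝ E]
  [NormedAddCommGroup E₁] [NormedSpace ℝ E₁] [FiniteDimensional ℝ E₁]
  [NormedAddCommGroup E₂] [NormedSpace ℝ E₂] [FiniteDimensional ℝ E₂]
  {M : Type*} [TopologicalSpace M] [ChartedSpace E M] [IsManifold 𝓘(ℝ, E) ∞ M]
  {B₁ : Type*} [TopologicalSpace B₁] [ChartedSpace E₁ B₁] [IsManifold 𝓘(ℝ, E₁) ∞ B₁]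
  {B₂ : Type*} [TopologicalSpace B₂] [ChartedSpace E₂ B₂] [IsManifold 𝓘(ℝ, E₂) ∞ B₂]

set_option linter.unusedSectionVars false

variable (E E₁) in
/-- The vectors tangent to the fibres of a map. -/
def kerBundle (π : M → B₁) (x : M) : Submodule ℝ (TangentSpace 𝓘(ℝ, E) x) :=
  LinearMap.ker (mfderiv 𝓘(ℝ, E) 𝓘(ℝ, E₁) π x).toLinearMap

variable (E E₁ E₂) in
/-- The vectors tangent to the fibres of `(π₁, π₂)`. -/
def verticalBundle (π₁ : M → B₁) (π₂ : M → B₂) (x : M) : Submodule ℝ (TangentSpace 𝓘(ℝ, E) x) :=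
  kerBundle E E₁ π₁ x ⊓ kerBundle E E₂ π₂ x

theorem verticalBundle_comm (π₁ : M → B₁) (π₂ : M → B₂) :
    verticalBundle E E₂ E₁ π₂ π₁ = verticalBundle E E₁ E₂ π₁ π₂ :=
  funext fun _ => inf_comm _ _

theorem VecField.lie_mem_kerBundle {π : M → B₁} (hπ : ContMDiff 𝓘(ℝ, E) 𝓘(ℝ, E₁) ∞ π)
    {U : Opens M} {X Y : VecField E U} (hX : X ∈ sections (kerBundle E E₁ π) U)
    (hY : Y ∈ sections (kerBundle E E₁ π) U) : ⁅X, Y⁆ ∈ sections (kerBundle E E₁ π) U := by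
  intro x hx
  have h := VecField.lie_related (W := ⊤) (X' := 0) (Y' := 0) hπ (fun _ _ => trivial)
    (fun x hx => hX x hx) (fun x hx => hY x hx) x hx
  rw [lie_zero] at h
  exact h

theorem VecField.lie_mem_verticalBundle {π₁ : M → B₁} {π₂ : M → B₂}
    (hπ₁ : ContMDiff 𝓘(ℝ, E) 𝓘(ℝ, E₁) ∞ π₁) (hπ₂ : ContMDiff 𝓘(ℝ, E) 𝓘(ℝ, E₂) ∞ π₂)
    {U : Opens M} : ∀ X ∈ sections (verticalBundle E E₁ E₂ π₁ π₂) U,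
      ∀ Y ∈ sections (verticalBundle E E₁ E₂ π₁ π₂) U,
      ⁅X, Y⁆ ∈ sections (verticalBundle E E₁ E₂ π₁ π₂) U := fun _ hX _ hY x hx =>
  ⟨VecField.lie_mem_kerBundle hπ₁ (fun x hx => (hX x hx).1) (fun x hx => (hY x hx).1) x hx,
    VecField.lie_mem_kerBundle hπ₂ (fun x hx => (hX x hx).2) (fun x hx => (hY x hx).2) x hx⟩

theorem VecField.restrict_mem_lieSpan {U V : Opens M} (hV : V ≤ U) {ι : Type*}
    {Φ : ι → VecField E U} {X : VecField E U}
    (hX : X ∈ LieSubalgebra.lieSpan ℝ (VecField E U) (range Φ)) :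
    VecField.restrict hV X ∈
      LieSubalgebra.lieSpan ℝ (VecField E V) (range fun i => VecField.restrict hV (Φ i)) := by
  have h : LieSubalgebra.lieSpan ℝ (VecField E U) (range Φ) ≤
      (LieSubalgebra.lieSpan ℝ (VecField E V)
        (range fun i => VecField.restrict hV (Φ i))).comap (VecField.restrict hV) := by
    refine LieSubalgebra.lieSpan_le.2 ?_
    rintro _ ⟨i, rfl⟩
    exact LieSubalgebra.subset_lieSpan ⟨i, rfl⟩
  exact h hX

namespace IsDarbouxSplit

variable {F G : (x : M) → Submodule ℝ (TangentSpace 𝓘(ℝ, E) x)} {k l : ℕ}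
  {π₁ : M → B₁} {π₂ : M → B₂} (h : IsDarbouxSplit E₁ E₂ F G k l π₁ π₂)
include h

theorem finrank_verticalBundle (x : M) :
    Module.finrank ℝ (verticalBundle E E₁ E₂ π₁ π₂ x) + (k + l) = Module.finrank ℝ E := by
  let A : E →ₗ[ℝ] E₁ × E₂ := (mfderiv 𝓘(ℝ, E) 𝓘(ℝ, E₁) π₁ x).toLinearMap.prod
    (mfderiv 𝓘(ℝ, E) 𝓘(ℝ, E₂) π₂ x).toLinearMap
  have h1 := LinearMap.finrank_range_add_finrank_ker A
  have h2 : LinearMap.range A = ⊤ := LinearMap.range_eq_top.2 fun ⟨a, b⟩ => by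
    obtain ⟨v, hv₁, hv₂⟩ := h.exists_mfderiv_eq x a b
    exact ⟨v, Prod.ext hv₁ hv₂⟩
  have h3 : LinearMap.ker A = verticalBundle E E₁ E₂ π₁ π₂ x := LinearMap.ker_prod _ _
  rw [h2, finrank_top, Module.finrank_prod, h.finrank₁, h.finrank₂, h3, add_comm] at h1
  exact h1

theorem span_eq_verticalBundle {ι : Type*} [Fintype ι]
    (hι : Fintype.card ι + (k + l) = Module.finrank ℝ E) {x : M}
    {v : ι → TangentSpace 𝓘(ℝ, E) x} (hv : LinearIndependent ℝ v)
    (hK : ∀ i, v i ∈ verticalBundle E E₁ E₂ π₁ π₂ x) :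
    Submodule.span ℝ (range v) = verticalBundle E E₁ E₂ π₁ π₂ x := by
  have : FiniteDimensional ℝ (TangentSpace 𝓘(ℝ, E) x) := inferInstanceAs (FiniteDimensional ℝ E)
  refine Submodule.eq_of_le_of_finrank_eq (Submodule.span_le.2 ?_) ?_
  · rintro _ ⟨i, rfl⟩
    exact hK i
  · have := h.finrank_verticalBundle x
    rw [finrank_span_eq_card hv]
    omega

theorem exists_vertical_frame {U : Opens M} {Φ : Fin k → VecField E U}
    (hΦ : IsLiftedCommutingFrame E₁ E₂ F G π₁ π₂ Φ) {ι : Type*} [Fintype ι]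
    (hι : Fintype.card ι + (k + l) = Module.finrank ℝ E) {m : M} (hm : m ∈ U) :
    ∃ Z : ι → VecField E U, (∀ i, Z i ∈ derivedOfGenerated Φ) ∧
      ∀ᶠ x in 𝓝 m, LinearIndependent ℝ fun i => (Z i).1 x := by
  have : FiniteDimensional ℝ (TangentSpace 𝓘(ℝ, E) m) := inferInstanceAs (FiniteDimensional ℝ E)
  have hc : Module.finrank ℝ (verticalBundle E E₁ E₂ π₁ π₂ m) = Fintype.card ι := by
    have := h.finrank_verticalBundle m
    omega
  let b := (Module.finBasisOfFinrankEq ℝ _ hc).reindex (Fintype.equivFin ι).symm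
  choose Z hZ hZb using fun i => h.exists_mem_derived hΦ hm (b i).2.1 (b i).2.2
  refine ⟨Z, hZ, SmoothSectionAt.eventually_linearIndependent
    (fun i => VecField.smoothAt (Z i) hm) ?_⟩
  simp only [hZb]
  exact b.linearIndependent.map' (verticalBundle E E₁ E₂ π₁ π₂ m).subtype (Submodule.ker_subtype _)

theorem isAdaptedFrame {U : Opens M} {Φ : Fin k → VecField E U} {Γ : Fin l → VecField E U}
    (hΦ : IsLiftedCommutingFrame E₁ E₂ F G π₁ π₂ Φ)
    (hΓ : IsLiftedCommutingFrame E₂ E₁ F G π₂ π₁ Γ) {m : M}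
    (hP : HasProductStructure E E₁ U m π₁ π₂) {ι : Type*} [Fintype ι]
    (hι : Fintype.card ι + (k + l) = Module.finrank ℝ E) {Z : ι → VecField E U}
    (hZ : ∀ i, Z i ∈ LieSubalgebra.lieSpan ℝ (VecField E U) (range Φ))
    (hZK : ∀ i, Z i ∈ sections (verticalBundle E E₁ E₂ π₁ π₂) U)
    (hli : ∀ x ∈ U, LinearIndependent ℝ fun i => (Z i).1 x) :
    IsAdaptedFrame (kerBundle E E₁ π₁) (verticalBundle E E₁ E₂ π₁ π₂) π₁
      (LieSubalgebra.lieSpan ℝ (VecField E U) (range Γ) : Set (VecField E U)) Z where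
  le x hx := inf_le_left
  mem Y hY x hx := h.symm.mfderiv_snd_of_mem_lieSpan hΓ.sup_swap hY hx
  le_span x hx v hv := by
    obtain ⟨A, hA, rfl⟩ := h.symm.exists_mem_lieSpan hΓ.sup_swap hx hv
    exact Submodule.subset_span ⟨A, hA, rfl⟩
  linearIndependent := hli
  span_eq x hx := h.span_eq_verticalBundle hι (hli x hx) fun i => hZK i x hx
  lie_eq_zero i Y hY := h.lie_eq_zero_of_mem_lieSpan hΦ hΓ (hZ i) hY
  factors := hP.factors

/-- The Lie algebra of vertical symmetries that is isomorphic to the derived algebras of the lifted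
commuting frames on each fibre. -/
theorem exists_lieSubalgebra {U : Opens M} {Γ : Fin l → VecField E U}
    (hΓ : IsLiftedCommutingFrame E₂ E₁ F G π₂ π₁ Γ) {m : M} (hm : m ∈ U)
    (hP : HasProductStructure E E₁ U m π₁ π₂) {ι : Type*} [Fintype ι] {Z W : ι → VecField E U}
    (hZ : IsAdaptedFrame (kerBundle E E₁ π₁) (verticalBundle E E₁ E₂ π₁ π₂) π₁
      (LieSubalgebra.lieSpan ℝ (VecField E U) (range Γ) : Set (VecField E U)) Z)
    {T : Set (VecField E U)}
    (hW : IsAdaptedFrame (kerBundle E E₂ π₂) (verticalBundle E E₁ E₂ π₁ π₂) π₂ T W)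
    (hWΓ : ∀ i, W i ∈ LieSubalgebra.lieSpan ℝ (VecField E U) (range Γ)) :
    ∃ L : LieSubalgebra ℝ (VecField E U), FiniteDimensional ℝ L ∧
      (∀ X ∈ L, X ∈ verticalCentralizer (verticalBundle E E₁ E₂ π₁ π₂)
        (LieSubalgebra.lieSpan ℝ (VecField E U) (range Γ) : Set (VecField E U)) ∧
          IsSymmetry G X) ∧
      ∀ Φ : Fin k → VecField E U, IsLiftedCommutingFrame E₁ E₂ F G π₁ π₂ Φ → ∀ x ∈ U,
        RestrictsIsomorphically π₁ π₂ (π₁ x, π₂ x) L (derivedOfGenerated Φ) ∧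
        RestrictsIsomorphically π₂ π₁ (π₂ x, π₁ x) L (derivedOfGenerated Φ) := by
  have hK := VecField.lie_mem_verticalBundle h.smooth₁ h.smooth₂ (U := U)
  obtain ⟨σ, hσ, hσU, hσd, hσσ, hσ₁, hσ₂⟩ := hP.retraction
  obtain ⟨L, hfin, hL, hLK, hL0⟩ := hZ.exists_lieSubalgebra hW hWΓ hK hσ hσU hσd hσσ hσ₁
    (fun x hx y hy => (hσ₂ x hx).trans (hσ₂ y hy).symm) hm
  refine ⟨L, hfin, fun X hX => ⟨hL X hX, ?_⟩, fun Φ hΦ x hx => ?_⟩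
  · exact isSymmetry_of_frame (fun x hx => h.symm.lift_linearIndependent hΓ.sup_swap hx)
      (fun x hx => h.symm.lift_span hΓ.sup_swap hx)
      fun i => (hL X hX).2 _ (LieSubalgebra.subset_lieSpan (mem_range_self i))
  · have hA : derivedOfGenerated Φ ≤ verticalCentralizer (verticalBundle E E₁ E₂ π₁ π₂)
        (LieSubalgebra.lieSpan ℝ (VecField E U) (range Γ) : Set (VecField E U)) := fun X hX =>
      ⟨h.isTangential_of_mem_derived hΦ hX, fun Y hY =>
        h.lie_eq_zero_of_mem_lieSpan hΦ hΓ (h.mem_lieSpan_of_mem_derived hX) hY⟩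
    exact ⟨hZ.restrictsIsomorphically hK hx (fun y hy _ => hy.symm) hL hA (hLK x hx)
        (fun X hX => hL0 X hX x hx) fun v hv => h.exists_mem_derived hΦ hx hv.1 hv.2,
      hZ.restrictsIsomorphically hK hx (fun y _ hy => hy.symm) hL hA (hLK x hx)
        (fun X hX => hL0 X hX x hx) fun v hv => h.exists_mem_derived hΦ hx hv.1 hv.2⟩

end IsDarbouxSplit

end Vertical

end DarbouxSystem

end

open DarbouxSystem in
theorem mainTheorem1 {E E₁ E₂ : Type*}
    [NormedAddCommGroup E] [NormedSpace ℝ E] [FiniteDimensional ℝ E]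
    [NormedAddCommGroup E₁] [NormedSpace ℝ E₁] [FiniteDimensional ℝ E₁]
    [NormedAddCommGroup E₂] [NormedSpace ℝ E₂] [FiniteDimensional ℝ E₂]
    {M : Type*} [TopologicalSpace M] [T2Space M] [SecondCountableTopology M]
    [ChartedSpace E M] [IsManifold 𝓘(ℝ, E) ∞ M]
    {B₁ : Type*} [TopologicalSpace B₁] [T2Space B₁] [SecondCountableTopology B₁]
    [ChartedSpace E₁ B₁] [IsManifold 𝓘(ℝ, E₁) ∞ B₁]
    {B₂ : Type*} [TopologicalSpace B₂] [T2Space B₂] [SecondCountableTopology B₂]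
    [ChartedSpace E₂ B₂] [IsManifold 𝓘(ℝ, E₂) ∞ B₂]
    (F G : (x : M) → Submodule ℝ (TangentSpace 𝓘(ℝ, E) x)) (k l : ℕ)
    (hFG : IsDecomposable F G k l) (hV : NoInvariants F G)
    (hD : IsDarbouxIntegrable F G k l)
    (hnF : HasNumInvariants F l) (hnG : HasNumInvariants G k)
    (π₁ : M → B₁) (π₂ : M → B₂) (hπ : IsDarbouxProjection E₁ E₂ F G π₁ π₂)
    (m : M) :
    ∃ U : Opens M, m ∈ U ∧
      (∃ Φ : Fin k → VecField E U, IsLiftedCommutingFrame E₁ E₂ F G π₁ π₂ Φ) ∧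
      (∃ Γ : Fin l → VecField E U, IsLiftedCommutingFrame E₂ E₁ F G π₂ π₁ Γ) ∧
      ∃ L R : LieSubalgebra ℝ (VecField E U),
        FiniteDimensional ℝ L ∧ FiniteDimensional ℝ R ∧
        (∀ X ∈ L, IsTangential E₁ E₂ π₁ π₂ X ∧ IsSymmetry G X) ∧
        (∀ Y ∈ R, IsTangential E₁ E₂ π₁ π₂ Y ∧ IsSymmetry F Y) ∧
        (∀ X ∈ L, ∀ Y ∈ R, ⁅X, Y⁆ = 0) ∧
        (∀ Φ : Fin k → VecField E U, IsLiftedCommutingFrame E₁ E₂ F G π₁ π₂ Φ →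
          ∀ x ∈ U, RestrictsIsomorphically π₁ π₂ (π₁ x, π₂ x) L (derivedOfGenerated Φ)) ∧
        (∀ Γ : Fin l → VecField E U, IsLiftedCommutingFrame E₂ E₁ F G π₂ π₁ Γ →
          ∀ x ∈ U, RestrictsIsomorphically π₁ π₂ (π₁ x, π₂ x) R (derivedOfGenerated Γ)) := by
  have h := hπ.isDarbouxSplit hFG hD hnF hnG m
  obtain ⟨U₁, hm₁, Φ', hΦ'⟩ := h.exists_lift m
  obtain ⟨U₂, hm₂, Γ', hΓ'⟩ := h.symm.exists_lift m
  obtain ⟨r, hι⟩ : ∃ r, Fintype.card (Fin r) + (k + l) = Module.finrank ℝ E :=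
    ⟨_, by rw [Fintype.card_fin]; exact h.finrank_verticalBundle m⟩
  have hι' := hι
  rw [add_comm k l] at hι'
  obtain ⟨Z', hZ', hZli⟩ := h.exists_vertical_frame hΦ' hι hm₁
  obtain ⟨W', hW', hWli⟩ := h.symm.exists_vertical_frame hΓ' hι' hm₂
  obtain ⟨N₀, hN₀, hN₀o, hmN₀⟩ := eventually_nhds_iff.1 (hZli.and hWli)
  obtain ⟨U, hmU, hUN, hP₁, hP₂⟩ := exists_hasProductStructure (N := U₁ ⊓ U₂ ⊓ ⟨N₀, hN₀o⟩)
    h.smooth₁ h.smooth₂ (h.exists_mfderiv_eq m) ⟨⟨hm₁, hm₂⟩, hmN₀⟩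
  have hU₁ : U ≤ U₁ := fun x hx => (hUN hx).1.1
  have hU₂ : U ≤ U₂ := fun x hx => (hUN hx).1.2
  have hΦ := hΦ'.restrict hU₁
  have hΓ := (hΓ'.restrict hU₂).sup_swap
  have hZmem := fun i => VecField.restrict_mem_lieSpan hU₁ (h.mem_lieSpan_of_mem_derived (hZ' i))
  have hWmem := fun i =>
    VecField.restrict_mem_lieSpan hU₂ (h.symm.mem_lieSpan_of_mem_derived (hW' i))
  have hZ := h.isAdaptedFrame hΦ hΓ hP₁ hι hZmem
    (fun i x hx => by
      rw [VecField.restrict_apply hU₁ _ hx]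
      exact h.isTangential_of_mem_derived hΦ' (hZ' i) x (hU₁ hx))
    (fun x hx => by
      simp only [VecField.restrict_apply hU₁ _ hx]
      exact (hN₀ x (hUN hx).2).1)
  have hW := h.symm.isAdaptedFrame hΓ.sup_swap hΦ.sup_swap hP₂ hι' hWmem
    (fun i x hx => by
      rw [VecField.restrict_apply hU₂ _ hx]
      exact h.symm.isTangential_of_mem_derived hΓ' (hW' i) x (hU₂ hx))
    (fun x hx => by
      simp only [VecField.restrict_apply hU₂ _ hx]
      exact (hN₀ x (hUN hx).2).2)
  have hZ₂ := hZ
  rw [← verticalBundle_comm] at hZ₂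
  have hW₁ := hW
  rw [verticalBundle_comm] at hW₁
  obtain ⟨L, hLfin, hL, hLiso⟩ := h.exists_lieSubalgebra hΓ hmU hP₁ hZ hW₁ hWmem
  obtain ⟨R, hRfin, hR, hRiso⟩ := h.symm.exists_lieSubalgebra hΦ.sup_swap hmU hP₂ hW hZ₂ hZmem
  rw [verticalBundle_comm] at hR
  refine ⟨U, hmU, ⟨_, hΦ⟩, ⟨_, hΓ⟩, L, R, hLfin, hRfin, fun X hX => ⟨(hL X hX).1.1, (hL X hX).2⟩,
    fun Y hY => ⟨(hR Y hY).1.1, (hR Y hY).2⟩, fun X hX Y hY =>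
      hW₁.lie_eq_zero_of_centralizers hWmem (hL X hX).1 (hR Y hY).1,
    fun Φ hΦ x hx => (hLiso Φ hΦ x hx).1, fun Γ hΓ x hx => (hRiso Γ hΓ.sup_swap x hx).2⟩
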